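/- Let $H\in(0,1/2)$. For $f:[0,\infty)\to\mathbb{R}$, $S>0$ and $c>0$ let $$\mathrm{TV}^c(f,S)=\sup_{n\ge1}\ \sup_{0\le s_1<t_1\le s_2<t_2\le\dots\le s_n<t_n\le S}\ \sum_{i=1}^n\bigl(|f(t_i)-f(s_i)|-c\bigr)_+,$$ $$\mathrm{UTV}^c(f,S)=\sup_{n\ge1}\ \sup_{0\le s_1<t_1<s_2<t_2<\dots<s_n<t_n\le S}\ \sum_{i=1}^n\bigl(f(t_i)-f(s_i)-c\bigr)_+,$$ and $\mathrm{DTV}^c(f,S)=\mathrm{UTV}^c(-f,S)$, where $(x)_+=\max(x,0)$. A fractional Brownian motion (fBm) with Hurst index $H$ is a centered Gaussian process $(W_t)_{t\ge0}$ with almost surely continuous trajectories and $\mathbf{E}(W_sW_t)=\frac12\bigl(s^{2H}+t^{2H}-|t-s|^{2H}\bigr)$ for $s,t\ge 0$. There exist positive constants $\bar A_H\le36$, $\bar B_H$, $\hat A_H\le18$, $\hat B_H$ and $T_H$, depending only on $H$, such that for every fBm $W$ with Hurst index $H$, every $S>0$ and every $c\in(0,S^H]$, the variables $\mathrm{TV}^c(W,S)$,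 $\mathrm{UTV}^c(W,S)$, $\mathrm{DTV}^c(W,S)$ have finite expectations and the following holds. (1) For every $u>0$, $$\mathbf{P}\bigl(|\mathrm{TV}^c(W,S)-\mathbf{E}\,\mathrm{TV}^c(W,S)|>u\bigr)\le\bar A_H\exp\Bigl(-\bar B_H\,S^{-1}c^{\frac1H-2}u^{1+2H}\min\bigl(Sc^{1-\frac1H},u\bigr)^{1-2H}\Bigr);$$ equivalently, for every $v>0$, $$\mathbf{P}\bigl(|\mathrm{TV}^c(W,S)-\mathbf{E}\,\mathrm{TV}^c(W,S)|>Sc^{1-\frac1H}v\bigr)\le\bar A_H\exp\Bigl(-\bar B_H\,Sc^{-\frac1H}\min\bigl(v^{1+2H},v^2\bigr)\Bigr).$$ (2) Both estimates hold with $\mathrm{TV}$ replaced by $\mathrm{UTV}$, and with $\mathrm{TV}$ replaced by $\mathrm{DTV}$, with $\hat A_H,\hat B_H$ in place of $\bar A_H,\bar B_H$. (3) The non-Gaussian exponent $v^{1+2H}$ is optimal for large $v$: if $X$ is any of $\mathrm{TV}^c(W,S)$, $\mathrm{UTV}^c(W,S)$, $\mathrm{DTV}^c(W,S)$, then for every $v\ge1$,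 $$\mathbf{P}\bigl(|X-\mathbf{E}X|>Sc^{1-\frac1H}v\bigr)\ge\tfrac12\exp\Bigl(-T_H\,Sc^{-\frac1H}v^{1+2H}\Bigr).$$ -/

import Mathlib

open MeasureTheory ProbabilityTheory
open scoped NNReal ENNReal

/-- `a ≤ s₁ < t₁ ≤ s₂ < t₂ ≤ … ≤ sₙ < tₙ ≤ b`. -/
def IsWeakChain (a b : ℝ≥0) {n : ℕ} (s t : Fin n → ℝ≥0) : Prop :=
  (∀ i, a ≤ s i ∧ s i < t i ∧ t i ≤ b) ∧ ∀ i j, i < j → t i ≤ s j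

/-- `a ≤ s₁ < t₁ < s₂ < t₂ < … < sₙ < tₙ ≤ b`. -/
def IsStrictChain (a b : ℝ≥0) {n : ℕ} (s t : Fin n → ℝ≥0) : Prop :=
  (∀ i, a ≤ s i ∧ s i < t i ∧ t i ≤ b) ∧ ∀ i j, i < j → t i < s j

/-- Truncated variation of `f` on `[a, b]` with truncation parameter `c`, with values in `[0, ∞]`.
Here `ENNReal.ofReal x` is the positive part of `x`. -/
noncomputable def truncatedVariation (f : ℝ≥0 → ℝ) (a b : ℝ≥0) (c : ℝ) : ℝ≥0∞ :=
  ⨆ (n : ℕ) (_ : 1 ≤ n) (s : Fin n → ℝ≥0) (t : Fin n → ℝ≥0) (_ : IsWeakChain a b s t),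
    ∑ i, ENNReal.ofReal (|f (t i) - f (s i)| - c)

/-- Upward truncated variation of `f` on `[a, b]` with truncation parameter `c`. -/
noncomputable def upwardTruncatedVariation (f : ℝ≥0 → ℝ) (a b : ℝ≥0) (c : ℝ) : ℝ≥0∞ :=
  ⨆ (n : ℕ) (_ : 1 ≤ n) (s : Fin n → ℝ≥0) (t : Fin n → ℝ≥0) (_ : IsStrictChain a b s t),
    ∑ i, ENNReal.ofReal (f (t i) - f (s i) - c)

/-- Downward truncated variation of `f` on `[a, b]` with truncation parameter `c`. -/
noncomputable def downwardTruncatedVariation (f : ℝ≥0 → ℝ) (a b : ℝ≥0) (c : ℝ) : ℝ≥0∞ :=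
  ⨆ (n : ℕ) (_ : 1 ≤ n) (s : Fin n → ℝ≥0) (t : Fin n → ℝ≥0) (_ : IsStrictChain a b s t),
    ∑ i, ENNReal.ofReal (f (s i) - f (t i) - c)

/-- Fractional Brownian motion with Hurst index `H` on the time set `[0, ∞)`: a centered Gaussian
process with the covariance function of fractional Brownian motion and almost surely continuous
trajectories. -/
structure IsFractionalBrownianMotion {Ω : Type*} [MeasurableSpace Ω] (H : ℝ)
    (W : ℝ≥0 → Ω → ℝ) (P : Measure Ω) : Prop where
  isGaussianProcess : IsGaussianProcess W P
  centered : ∀ t, ∫ ω, W t ω ∂P = 0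
  covariance : ∀ s t : ℝ≥0, ∫ ω, W s ω * W t ω ∂P =
    1 / 2 * ((s : ℝ) ^ (2 * H) + (t : ℝ) ^ (2 * H) - |(t : ℝ) - (s : ℝ)| ^ (2 * H))
  continuous : ∀ᵐ ω ∂P, Continuous fun t ↦ W t ω

/-- `X` is a random variable (up to null sets) with finite expectation. -/
def HasFiniteExpectation {Ω : Type*} [MeasurableSpace Ω] (P : Measure Ω) (X : Ω → ℝ≥0∞) : Prop :=
  AEMeasurable X P ∧ ∫⁻ ω, X ω ∂P < ∞

/-- The probability `P (|X - E X| > u)`, for `X` with finite expectation. -/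
noncomputable def deviationProb {Ω : Type*} [MeasurableSpace Ω] (P : Measure Ω) (X : Ω → ℝ≥0∞)
    (u : ℝ) : ℝ :=
  P.real {ω | u < |(X ω).toReal - ∫ ω', (X ω').toReal ∂P|}

/-!
By self-similarity, `W` may be replaced by `t ↦ c⁻¹ W (c ^ (1 / H) t)`, which turns the truncation
level `c` into `1` and the time `S` into `T = S c ^ (-1 / H) ≥ 1`; the deviation becomes `T v`. Each
of the three functionals is then a supremum `X` over chains of intervals of the sum of
`max (φ (W t - W s)) 0`, where `φ x ≤ |x| - 1` (`chainSup`).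

*Upper bound.* The Gaussian input is that two sets of paths at Cameron–Martin distance at least `r`
have `P A * P B ≤ exp (-r ^ 2 / 4)`. This follows from Prékopa–Leindler on the line, by Maurey's
property, which tensorises (`ProbabilityTheory.IsGaussianProcess.measure_mul_le`). Suppose that a
path `g` differs from a path `f` by a vector of Cameron–Martin norm at most `r`. Then a signed sum
of increments changes by at most `r` times its standard deviation. For `H < 1 / 2` the covariances
of disjoint increments are negative and telescope, so a signed sum of `m` disjoint increments in
`[0, T]` has variance at most `2 m ^ (1 - 2 H) T ^ (2 H)`
(`IsFractionalBrownianMotion.variance_sum_increments_le`). Only the `m` intervals of a chain with a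
positive contribution for `g` matter for `X g - X f`. On each of them the increment exceeds `1`, so
`m / 2` is at most the truncated variation `Y` of `g` with truncation level `1 / 2`, and `Y` moves by
the same amount as `X` at most. Hence if `Y = O(T)` at one of the two paths, either `m = O(T)` or
`m ^ (1 / 2 + H) = O(r T ^ H)`, and `X` varies by at most `T v` for
`r ^ 2` of order `T min (v ^ (1 + 2 H), v ^ 2)` (`mul_rpow_le_of_concentrationRadius`).
The condition on `Y` holds with probability at least `3 / 4`, because `E Y = O(T)` by dyadic
chaining (`exists_lintegral_chainSup_le`): part of the truncation level is spent on each dyadic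
scale, and the contributions of short scales are summable. This gives concentration around a median,
hence around the mean (`exists_deviationProb_le_of_median`).

*Lower bound.* `X` is at least `L - N`, where `L` is the sum of the increments (with a sign for the
downward variation) over `N ≈ T v` equidistant intervals. Gaps of the length of the intervals make
the variance of `L` at least a multiple of `T v ^ (1 - 2 H)`. As `E X = O(T)`, a deviation `T v`
occurs when the Gaussian variable `L` exceeds a multiple of `T v`, which has probability at least
`exp (-D T v ^ (1 + 2 H)) / 2` (`exists_le_deviationProb_chainSup`).

A probability which is at most `A exp (-z)` is also at most `2 exp (-θ z)` with `θ = log 2 / log A`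
(`le_two_mul_exp_of_le`), so that the prefactor `2` is available in all upper bounds.
-/

/-! ### Prékopa–Leindler on the line and Maurey's property of the Gaussian measure -/

open scoped Pointwise in
/-- Brunn–Minkowski on the line: up to one common point, `A + B` contains disjoint translates of
`A` and of `B`. -/
lemma IsCompact.volume_add_volume_le {A B : Set ℝ} (hA : IsCompact A) (hB : IsCompact B)
    (hA' : A.Nonempty) (hB' : B.Nonempty) : volume A + volume B ≤ volume (A + B) := by
  obtain ⟨a, haA, ha⟩ := hA.exists_isGreatest hA'
  obtain ⟨b, hbB, hb⟩ := hB.exists_isLeast hB'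
  have h1 : volume ((fun x ↦ x + b) '' A) = volume A := by simp
  have h2 : volume ((fun x ↦ a + x) '' B) = volume B := by simp
  have hm : MeasurableSet ((fun x ↦ a + x) '' B) :=
    (hB.image (continuous_const.add continuous_id)).measurableSet
  have hd : AEDisjoint volume ((fun x ↦ x + b) '' A) ((fun x ↦ a + x) '' B) := by
    refine measure_mono_null (t := {a + b}) ?_ (by simp)
    rintro _ ⟨⟨x, hx, rfl⟩, ⟨y, hy, hxy⟩⟩
    have := ha hx
    have := hb hy
    simp only at hxy
    simp only [Set.mem_singleton_iff]
    linarith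
  rw [← h1, ← h2, ← measure_union₀ hm.nullMeasurableSet hd]
  refine measure_mono (Set.union_subset ?_ ?_)
  · rintro _ ⟨x, hx, rfl⟩
    exact Set.add_mem_add hx hbB
  · rintro _ ⟨y, hy, rfl⟩
    exact Set.add_mem_add haA hy

lemma volume_add_volume_le_of_midpoint {A B C : Set ℝ} (hA : MeasurableSet A)
    (hB : MeasurableSet B) (hA' : A.Nonempty) (hB' : B.Nonempty)
    (h : ∀ x ∈ A, ∀ y ∈ B, (x + y) / 2 ∈ C) : volume A + volume B ≤ 2 * volume C := by
  obtain ⟨a, ha⟩ := hA'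
  obtain ⟨b, hb⟩ := hB'
  have key : ∀ K ⊆ A, IsCompact K → ∀ L ⊆ B, IsCompact L → volume K + volume L ≤ 2 * volume C := by
    intro K hKA hK L hLB hL
    -- the added points take care of empty `K` or `L`
    have h1 := (hK.insert a).volume_add_volume_le (hL.insert b) (Set.insert_nonempty _ _)
      (Set.insert_nonempty _ _)
    have h2 : volume ((fun z : ℝ ↦ (1 / 2) * z) ⁻¹' C) = 2 * volume C := by
      rw [Real.volume_preimage_mul_left (by norm_num)]
      norm_num
    refine (add_le_add (measure_mono (Set.subset_insert a K))
      (measure_mono (Set.subset_insert b L))).trans (h1.trans ?_)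
    rw [← h2]
    refine measure_mono ?_
    rintro _ ⟨x, hx, y, hy, rfl⟩
    have hx' : x ∈ A := by
      rcases hx with rfl | hx
      exacts [ha, hKA hx]
    have hy' : y ∈ B := by
      rcases hy with rfl | hy
      exacts [hb, hLB hy]
    have := h x hx' y hy'
    simp only [Set.mem_preimage]
    convert this using 1
    ring
  have key2 : ∀ L ⊆ B, IsCompact L → volume A + volume L ≤ 2 * volume C := by
    intro L hLB hL
    have hLC : volume L ≤ 2 * volume C := by
      simpa using key ∅ (Set.empty_subset _) isCompact_empty L hLB hL
    have : volume A ≤ 2 * volume C - volume L := by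
      rw [hA.measure_eq_iSup_isCompact]
      refine iSup_le fun K ↦ iSup_le fun hK ↦ iSup_le fun hKc ↦ ?_
      exact ENNReal.le_sub_of_add_le_right hL.measure_lt_top.ne (key K hK hKc L hLB hL)
    exact (add_le_add_left this _).trans (tsub_add_cancel_of_le hLC).le
  rcases eq_or_ne (volume A) ∞ with hAi | hAi
  · have := key2 ∅ (Set.empty_subset _) isCompact_empty
    simp only [hAi, measure_empty, add_zero, top_le_iff] at this
    rw [this]
    exact le_top
  · have hAC : volume A ≤ 2 * volume C := by
      simpa using key2 ∅ (Set.empty_subset _) isCompact_empty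
    have : volume B ≤ 2 * volume C - volume A := by
      rw [hB.measure_eq_iSup_isCompact]
      refine iSup_le fun K ↦ iSup_le fun hK ↦ iSup_le fun hKc ↦ ?_
      exact ENNReal.le_sub_of_add_le_left hAi (key2 K hK hKc)
    exact (add_le_add_right this _).trans (add_tsub_cancel_of_le hAC).le

/-- Prékopa–Leindler on the line for functions with supremum `1`, by the layer-cake formula. -/
lemma lintegral_add_lintegral_le_of_midpoint {F G H : ℝ → ℝ} (hF : Measurable F)
    (hG : Measurable G) (hH : Measurable H) (hF0 : ∀ x, 0 ≤ F x) (hG0 : ∀ x, 0 ≤ G x)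
    (hH0 : ∀ x, 0 ≤ H x) (hF1 : IsLUB (Set.range F) 1) (hG1 : IsLUB (Set.range G) 1)
    (h : ∀ x y, F x * G y ≤ H ((x + y) / 2) ^ 2) :
    (∫⁻ x, ENNReal.ofReal (F x)) + ∫⁻ x, ENNReal.ofReal (G x) ≤
      2 * ∫⁻ x, ENNReal.ofReal (H x) := by
  rw [lintegral_eq_lintegral_meas_lt _ (.of_forall hF0) hF.aemeasurable,
    lintegral_eq_lintegral_meas_lt _ (.of_forall hG0) hG.aemeasurable,
    lintegral_eq_lintegral_meas_lt _ (.of_forall hH0) hH.aemeasurable,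
    ← lintegral_const_mul' _ _ (by simp), ← lintegral_add_left']
  · refine setLIntegral_mono' measurableSet_Ioi fun t (ht : 0 < t) ↦ ?_
    rcases lt_or_ge t 1 with ht1 | ht1
    · have ne : ∀ {F : ℝ → ℝ}, IsLUB (Set.range F) 1 → {a | t < F a}.Nonempty := by
        intro F hF1
        obtain ⟨_, ⟨x, rfl⟩, hx⟩ := (lt_isLUB_iff hF1).1 ht1
        exact ⟨x, hx⟩
      refine volume_add_volume_le_of_midpoint (measurableSet_lt measurable_const hF)
        (measurableSet_lt measurable_const hG) (ne hF1) (ne hG1) fun x hx y hy ↦ ?_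
      have hx' : t < F x := hx
      have hy' : t < G y := hy
      have : t ^ 2 < H ((x + y) / 2) ^ 2 := by
        refine lt_of_lt_of_le ?_ (h x y)
        nlinarith
      exact lt_of_pow_lt_pow_left₀ 2 (hH0 _) this
    · have em : ∀ {F : ℝ → ℝ}, IsLUB (Set.range F) 1 → {a | t < F a} = ∅ := by
        intro F hF1
        ext x
        simp only [Set.mem_ofPred_eq, Set.mem_empty_iff_false, iff_false, not_lt]
        exact (hF1.1 ⟨x, rfl⟩).trans ht1
      rw [em hF1, em hG1]
      simp
  · refine Measurable.aemeasurable (Antitone.measurable fun s t hst ↦ ?_)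
    exact measure_mono fun x (hx : t < F x) ↦ hst.trans_lt hx

lemma integral_mul_integral_le_of_midpoint {F G H : ℝ → ℝ} (hF : Measurable F)
    (hG : Measurable G) (hH : Measurable H) (hF0 : ∀ x, 0 ≤ F x) (hG0 : ∀ x, 0 ≤ G x)
    (hH0 : ∀ x, 0 ≤ H x) (hFb : BddAbove (Set.range F)) (hGb : BddAbove (Set.range G))
    (hFi : Integrable F) (hGi : Integrable G) (hHi : Integrable H)
    (h : ∀ x y, F x * G y ≤ H ((x + y) / 2) ^ 2) :
    (∫ x, F x) * ∫ x, G x ≤ (∫ x, H x) ^ 2 := by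
  have hF0' : 0 ≤ ∫ x, F x := integral_nonneg hF0
  have hG0' : 0 ≤ ∫ x, G x := integral_nonneg hG0
  have hH0' : 0 ≤ ∫ x, H x := integral_nonneg hH0
  have hFs := isLUB_csSup (Set.range_nonempty F) hFb
  have hGs := isLUB_csSup (Set.range_nonempty G) hGb
  set a := sSup (Set.range F)
  set b := sSup (Set.range G)
  have ha0 : 0 ≤ a := (hF0 0).trans (hFs.1 ⟨0, rfl⟩)
  have hb0 : 0 ≤ b := (hG0 0).trans (hGs.1 ⟨0, rfl⟩)
  rcases ha0.eq_or_lt with ha | ha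
  · have : ∀ x, F x = 0 := fun x ↦ le_antisymm (ha ▸ hFs.1 ⟨x, rfl⟩) (hF0 x)
    simp only [this, integral_zero, zero_mul]
    positivity
  rcases hb0.eq_or_lt with hb | hb
  · have : ∀ x, G x = 0 := fun x ↦ le_antisymm (hb ▸ hGs.1 ⟨x, rfl⟩) (hG0 x)
    simp only [this, integral_zero, mul_zero]
    positivity
  have hlub : ∀ {F : ℝ → ℝ} {a : ℝ}, 0 < a → IsLUB (Set.range F) a →
      IsLUB (Set.range fun x ↦ F x / a) 1 := by
    intro F a ha hFs
    constructor
    · rintro _ ⟨x, rfl⟩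
      exact (div_le_one ha).2 (hFs.1 ⟨x, rfl⟩)
    · intro u hu
      have : a ≤ u * a := hFs.2 (by
        rintro _ ⟨x, rfl⟩
        exact (div_le_iff₀ ha).1 (hu ⟨x, rfl⟩))
      nlinarith
  have hs : 0 < √(a * b) := Real.sqrt_pos.2 (by positivity)
  have hss : √(a * b) ^ 2 = a * b := Real.sq_sqrt (by positivity)
  have key := lintegral_add_lintegral_le_of_midpoint (F := fun x ↦ F x / a) (G := fun x ↦ G x / b)
    (H := fun x ↦ H x / √(a * b)) (hF.div_const _) (hG.div_const _) (hH.div_const _)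
    (fun x ↦ div_nonneg (hF0 x) ha.le) (fun x ↦ div_nonneg (hG0 x) hb.le)
    (fun x ↦ div_nonneg (hH0 x) hs.le) (hlub ha hFs) (hlub hb hGs) (fun x y ↦ by
      rw [div_mul_div_comm, div_pow, hss]
      gcongr
      exact h x y)
  rw [← ofReal_integral_eq_lintegral_ofReal (hFi.div_const _)
      (.of_forall fun x ↦ div_nonneg (hF0 x) ha.le),
    ← ofReal_integral_eq_lintegral_ofReal (hGi.div_const _)
      (.of_forall fun x ↦ div_nonneg (hG0 x) hb.le),
    ← ofReal_integral_eq_lintegral_ofReal (hHi.div_const _)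
      (.of_forall fun x ↦ div_nonneg (hH0 x) hs.le), integral_div, integral_div, integral_div,
    ← ENNReal.ofReal_add (by positivity) (by positivity),
    ← ENNReal.ofReal_ofNat, ← ENNReal.ofReal_mul (by norm_num),
    ENNReal.ofReal_le_ofReal_iff (by positivity)] at key
  have h1 : (∫ x, F x) / a * ((∫ x, G x) / b) ≤ ((∫ x, H x) / √(a * b)) ^ 2 := by
    have := sq_nonneg ((∫ x, F x) / a - (∫ x, G x) / b)
    have h3 : 0 ≤ (∫ x, F x) / a + (∫ x, G x) / b := by positivity
    nlinarith
  rw [div_mul_div_comm, div_pow, hss] at h1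
  exact (div_le_div_iff_of_pos_right (by positivity)).1 h1

/-- Maurey's property in dimension one: Prékopa–Leindler applied to `f φ`, `g φ` and `φ`, where
`φ` is the Gaussian density, since `φ x * φ y * exp ((x - y) ^ 2 / 4) = φ ((x + y) / 2) ^ 2`. -/
lemma lintegral_gaussianReal_mul_lintegral_le_one {f g : ℝ → ℝ≥0∞} (hf : Measurable f)
    (hg : Measurable g) {M : ℝ≥0∞} (hM : M ≠ ∞) (hfM : ∀ x, f x ≤ M) (hgM : ∀ x, g x ≤ M)
    (h : ∀ x y, f x * g y ≤ ENNReal.ofReal (Real.exp ((x - y) ^ 2 / 4))) :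
    (∫⁻ x, f x ∂gaussianReal 0 1) * ∫⁻ x, g x ∂gaussianReal 0 1 ≤ 1 := by
  set φ := gaussianPDFReal 0 1 with hφ
  have hφm : Measurable φ := measurable_gaussianPDFReal 0 1
  have hφ0 : ∀ x, 0 ≤ φ x := gaussianPDFReal_nonneg 0 1
  have hφi : Integrable φ := integrable_gaussianPDFReal 0 1
  have hφ1 : ∀ x, φ x ≤ (√(2 * Real.pi))⁻¹ := by
    intro x
    simp only [hφ, gaussianPDFReal, NNReal.coe_one, mul_one, sub_zero]
    refine mul_le_of_le_one_right (by positivity) (Real.exp_le_one_iff.2 ?_)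
    have := sq_nonneg x
    linarith
  have facts : ∀ {f : ℝ → ℝ≥0∞}, Measurable f → (∀ x, f x ≤ M) →
      (Measurable fun x ↦ (f x).toReal * φ x) ∧ (∀ x, 0 ≤ (f x).toReal * φ x) ∧
      BddAbove (Set.range fun x ↦ (f x).toReal * φ x) ∧
      Integrable (fun x ↦ (f x).toReal * φ x) ∧
      ∫⁻ x, f x ∂gaussianReal 0 1 = ENNReal.ofReal (∫ x, (f x).toReal * φ x) := by
    intro f hf hfM
    have hb : ∀ x, (f x).toReal ≤ M.toReal := fun x ↦ ENNReal.toReal_mono hM (hfM x)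
    have hn : ∀ x, 0 ≤ (f x).toReal * φ x := fun x ↦ mul_nonneg ENNReal.toReal_nonneg (hφ0 x)
    have hi : Integrable (fun x ↦ (f x).toReal * φ x) := by
      refine hφi.bdd_mul (c := M.toReal) hf.ennreal_toReal.aestronglyMeasurable
        (.of_forall fun x ↦ ?_)
      rw [Real.norm_of_nonneg ENNReal.toReal_nonneg]
      exact hb x
    refine ⟨hf.ennreal_toReal.mul hφm, hn, ⟨M.toReal * (√(2 * Real.pi))⁻¹, ?_⟩, hi, ?_⟩
    · rintro _ ⟨x, rfl⟩
      exact mul_le_mul (hb x) (hφ1 x) (hφ0 x) ENNReal.toReal_nonneg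
    · rw [gaussianReal_of_var_ne_zero _ one_ne_zero, lintegral_withDensity_eq_lintegral_mul _
        (measurable_gaussianPDF 0 1) hf, ofReal_integral_eq_lintegral_ofReal hi (.of_forall hn)]
      refine lintegral_congr fun x ↦ ?_
      rw [ENNReal.ofReal_mul ENNReal.toReal_nonneg,
        ENNReal.ofReal_toReal ((hfM x).trans_lt hM.lt_top).ne, Pi.mul_apply, mul_comm]
      rfl
  obtain ⟨f1, f2, f3, f4, f5⟩ := facts hf hfM
  obtain ⟨g1, g2, g3, g4, g5⟩ := facts hg hgM
  have key := integral_mul_integral_le_of_midpoint f1 g1 hφm f2 g2 hφ0 f3 g3 f4 g4 hφi (by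
    intro x y
    have h1 : (f x).toReal * (g y).toReal ≤ Real.exp ((x - y) ^ 2 / 4) := by
      rw [← ENNReal.toReal_mul]
      exact ENNReal.toReal_le_of_le_ofReal (Real.exp_pos _).le (h x y)
    have h2 : Real.exp ((x - y) ^ 2 / 4) * (φ x * φ y) = φ ((x + y) / 2) ^ 2 := by
      simp only [hφ, gaussianPDFReal, NNReal.coe_one, mul_one, sub_zero]
      rw [mul_mul_mul_comm, mul_left_comm, ← Real.exp_add, ← Real.exp_add, mul_pow, ← Real.exp_nat_mul,
        sq (√(2 * Real.pi))⁻¹]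
      congr 2
      push_cast
      ring
    calc (f x).toReal * φ x * ((g y).toReal * φ y)
        = (f x).toReal * (g y).toReal * (φ x * φ y) := by ring
      _ ≤ Real.exp ((x - y) ^ 2 / 4) * (φ x * φ y) :=
          mul_le_mul_of_nonneg_right h1 (mul_nonneg (hφ0 x) (hφ0 y))
      _ = _ := h2)
  rw [integral_gaussianPDFReal_eq_one 0 one_ne_zero, one_pow] at key
  rw [f5, g5, ← ENNReal.ofReal_mul (integral_nonneg f2), ← ENNReal.ofReal_one]
  exact ENNReal.ofReal_le_ofReal key

/-- Maurey's property of the standard Gaussian measure on `ℝⁿ`: it tensorises by integrating out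
one coordinate at a time. -/
lemma lintegral_pi_gaussianReal_mul_lintegral_le_one (n : ℕ) {f g : (Fin n → ℝ) → ℝ≥0∞}
    (hf : Measurable f) (hg : Measurable g) {M : ℝ≥0∞} (hM : M ≠ ∞) (hfM : ∀ x, f x ≤ M)
    (hgM : ∀ x, g x ≤ M)
    (h : ∀ x y, f x * g y ≤ ENNReal.ofReal (Real.exp ((∑ i, (x i - y i) ^ 2) / 4))) :
    (∫⁻ x, f x ∂Measure.pi fun _ ↦ gaussianReal 0 1) *
      ∫⁻ x, g x ∂Measure.pi (fun _ ↦ gaussianReal 0 1) ≤ 1 := by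
  induction n with
  | zero =>
    rw [Measure.pi_of_empty, lintegral_dirac, lintegral_dirac]
    simpa using h isEmptyElim isEmptyElim
  | succ n ih =>
    set e := MeasurableEquiv.piFinSuccAbove (fun _ : Fin (n + 1) ↦ ℝ) 0
    have he := (measurePreserving_piFinSuccAbove (fun _ : Fin (n + 1) ↦ gaussianReal 0 1) 0).symm
    have hfub : ∀ {f : (Fin (n + 1) → ℝ) → ℝ≥0∞}, Measurable f →
        ∫⁻ x, f x ∂Measure.pi (fun _ ↦ gaussianReal 0 1) =
        ∫⁻ a, ∫⁻ x, f (e.symm (a, x)) ∂Measure.pi (fun _ ↦ gaussianReal 0 1)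
          ∂gaussianReal 0 1 := by
      intro f hf
      rw [← he.lintegral_comp hf]
      exact lintegral_prod _ (hf.comp e.symm.measurable).aemeasurable
    have hbd : ∀ {f : (Fin (n + 1) → ℝ) → ℝ≥0∞}, (∀ x, f x ≤ M) → ∀ a,
        ∫⁻ x, f (e.symm (a, x)) ∂Measure.pi (fun _ ↦ gaussianReal 0 1) ≤ M := by
      intro f hfM a
      exact (lintegral_mono fun x ↦ hfM _).trans (by simp)
    rw [hfub hf, hfub hg]
    refine lintegral_gaussianReal_mul_lintegral_le_one
      (hf.comp e.symm.measurable).lintegral_prod_right'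
      (hg.comp e.symm.measurable).lintegral_prod_right' hM (hbd hfM) (hbd hgM) fun a b ↦ ?_
    -- absorb the factor of the first coordinate into `f`
    set c := ENNReal.ofReal (Real.exp (-((a - b) ^ 2 / 4))) with hc
    have hc1 : c ≤ 1 := by
      rw [hc, ENNReal.ofReal_le_one, Real.exp_le_one_iff]
      have := sq_nonneg (a - b)
      linarith
    have hcc : ENNReal.ofReal (Real.exp ((a - b) ^ 2 / 4)) * c = 1 := by
      rw [hc, ← ENNReal.ofReal_mul (Real.exp_pos _).le, ← Real.exp_add]
      simp
    have hma : Measurable fun x ↦ f (e.symm (a, x)) :=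
      hf.comp (e.symm.measurable.comp measurable_prodMk_left)
    have hmb : Measurable fun x ↦ g (e.symm (b, x)) :=
      hg.comp (e.symm.measurable.comp measurable_prodMk_left)
    have key := ih (f := fun x ↦ c * f (e.symm (a, x))) (g := fun x ↦ g (e.symm (b, x)))
      (hma.const_mul c) hmb
      (fun x ↦ (mul_le_of_le_one_left zero_le hc1).trans (hfM _)) (fun x ↦ hgM _) (by
        intro x y
        rw [mul_assoc]
        refine (mul_le_mul_right (h _ _) c).trans_eq ?_
        rw [hc, ← ENNReal.ofReal_mul (Real.exp_pos _).le, ← Real.exp_add, Fin.sum_univ_succ]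
        congr 2
        simp only [e, MeasurableEquiv.piFinSuccAbove_symm_apply, Fin.insertNthEquiv_zero,
          Fin.consEquiv_apply, Fin.cons_zero, Fin.cons_succ]
        ring)
    rw [lintegral_const_mul _ hma] at key
    calc _ = ENNReal.ofReal (Real.exp ((a - b) ^ 2 / 4)) * c * _ := by rw [hcc, one_mul]
      _ ≤ ENNReal.ofReal (Real.exp ((a - b) ^ 2 / 4)) * 1 := by
        rw [mul_assoc, ← mul_assoc c]
        exact mul_le_mul_right key _
      _ = _ := mul_one _

/-- Two sets at distance at least `r` cannot both have large Gaussian measure. -/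
lemma stdGaussian_mul_le {E : Type*} [NormedAddCommGroup E] [InnerProductSpace ℝ E]
    [FiniteDimensional ℝ E] [MeasurableSpace E] [BorelSpace E] {A B : Set E}
    (hA : MeasurableSet A) (hB : MeasurableSet B) {r : ℝ} (hr : 0 ≤ r)
    (h : ∀ x ∈ A, ∀ y ∈ B, r ≤ ‖y - x‖) :
    stdGaussian E A * stdGaussian E B ≤ ENNReal.ofReal (Real.exp (-(r ^ 2 / 4))) := by
  set b := stdOrthonormalBasis ℝ E
  set L : (Fin (Module.finrank ℝ E) → ℝ) → E := fun x ↦ ∑ i, x i • b i with hL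
  have hLm : Measurable L := by fun_prop
  have hdist : ∀ x y, ‖L y - L x‖ ^ 2 = ∑ i, (x i - y i) ^ 2 := by
    intro x y
    rw [← b.sum_sq_norm_inner_right]
    refine Finset.sum_congr rfl fun i _ ↦ ?_
    have : inner ℝ (b i) (L y - L x) = y i - x i := by
      simp only [hL, ← Finset.sum_sub_distrib, ← sub_smul]
      exact b.orthonormal.inner_right_fintype _ i
    rw [this, Real.norm_eq_abs, sq_abs]
    ring
  set M := ENNReal.ofReal (Real.exp (r ^ 2 / 4)) with hMdef
  have hM1 : 1 ≤ M := by
    rw [hMdef, ENNReal.one_le_ofReal, Real.one_le_exp_iff]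
    positivity
  have key := lintegral_pi_gaussianReal_mul_lintegral_le_one (Module.finrank ℝ E)
    (f := (L ⁻¹' A).indicator fun _ ↦ M) (g := (L ⁻¹' B).indicator fun _ ↦ 1)
    (measurable_const.indicator (hLm hA)) (measurable_const.indicator (hLm hB))
    (M := M) ENNReal.ofReal_ne_top
    (fun x ↦ Set.indicator_le_self' (fun _ _ ↦ zero_le) x)
    (fun x ↦ (Set.indicator_le_self' (fun _ _ ↦ zero_le) x).trans hM1) (by
      intro x y
      by_cases hx : x ∈ L ⁻¹' A
      · by_cases hy : y ∈ L ⁻¹' B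
        · rw [Set.indicator_of_mem hx, Set.indicator_of_mem hy, mul_one]
          refine ENNReal.ofReal_le_ofReal (Real.exp_le_exp.2 ?_)
          have := h _ hx _ hy
          rw [← hdist]
          gcongr
        · simp [Set.indicator_of_notMem hy]
      · simp [Set.indicator_of_notMem hx])
  rw [lintegral_indicator (hLm hA), lintegral_indicator (hLm hB), setLIntegral_const,
    setLIntegral_const, one_mul] at key
  have hA' : stdGaussian E A = Measure.pi (fun _ ↦ gaussianReal 0 1) (L ⁻¹' A) := by
    rw [stdGaussian, Measure.map_apply hLm hA]
  have hB' : stdGaussian E B = Measure.pi (fun _ ↦ gaussianReal 0 1) (L ⁻¹' B) := by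
    rw [stdGaussian, Measure.map_apply hLm hB]
  rw [hA', hB']
  have hMM : ENNReal.ofReal (Real.exp (-(r ^ 2 / 4))) * M = 1 := by
    rw [hMdef, ← ENNReal.ofReal_mul (Real.exp_pos _).le, ← Real.exp_add]
    simp
  calc _ = ENNReal.ofReal (Real.exp (-(r ^ 2 / 4))) * M * _ := by rw [hMM, one_mul]
    _ ≤ ENNReal.ofReal (Real.exp (-(r ^ 2 / 4))) * 1 := by
      rw [mul_assoc, ← mul_assoc M]
      exact mul_le_mul_right key _
    _ = _ := mul_one _

open scoped MatrixOrder in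
/-- Gaussian concentration for two sets of finite-dimensional trajectories. If no trajectory of `B`
is reached from `A` by a vector of Cameron–Martin norm at most `r`, that is by a vector on which
each linear functional is at most `r` times its standard deviation, then one of the two sets has
small probability. -/
lemma ProbabilityTheory.IsGaussianProcess.measure_mul_le {T Ω : Type*} [MeasurableSpace Ω]
    {P : Measure Ω} {W : T → Ω → ℝ} (hW : IsGaussianProcess W P) (h0 : ∀ t, ∫ ω, W t ω ∂P = 0)
    (I : Finset T) {A B : Set (I → ℝ)} (hA : MeasurableSet A) (hB : MeasurableSet B)
    {r : ℝ} (hr : 0 ≤ r)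
    (h : ∀ x ∈ A, ∀ y ∈ B, ¬ ∀ ℓ : StrongDual ℝ (I → ℝ),
      ℓ (y - x) ≤ r * √Var[fun ω ↦ ℓ (I.restrict (W · ω)); P]) :
    P {ω | I.restrict (W · ω) ∈ A} * P {ω | I.restrict (W · ω) ∈ B} ≤
      ENNReal.ofReal (Real.exp (-(r ^ 2 / 4))) := by
  classical
  have hP := hW.isProbabilityMeasure
  set X : Ω → I → ℝ := fun ω ↦ I.restrict (W · ω) with hX
  have hXg : HasGaussianLaw X P := hW.hasGaussianLaw I
  have hXm : AEMeasurable X P := hXg.aemeasurable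
  have := hXg.isGaussian_map
  let e : (I → ℝ) ≃L[ℝ] EuclideanSpace ℝ I := (PiLp.continuousLinearEquiv 2 ℝ fun _ : I ↦ ℝ).symm
  have he : Measurable e := e.continuous.measurable
  set S : Matrix I I ℝ := fun i j ↦ cov[W i, W j; P] with hS
  have hcov : ∀ x y : EuclideanSpace ℝ I, covarianceBilin ((P.map X).map e) x y =
      x ⬝ᵥ S.mulVec y := by
    intro x y
    have : (e : (I → ℝ) → EuclideanSpace ℝ I) = WithLp.toLp 2 := rfl
    rw [this, covarianceBilin_apply_pi]
    · simp only [dotProduct, Matrix.mulVec, Finset.mul_sum]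
      refine Finset.sum_congr rfl fun i _ ↦ Finset.sum_congr rfl fun j _ ↦ ?_
      rw [covariance_map (measurable_pi_apply i).aestronglyMeasurable
        (measurable_pi_apply j).aestronglyMeasurable hXm, mul_assoc, mul_comm (y j)]
      rfl
    · exact fun i ↦ (IsGaussian.hasGaussianLaw_id.eval i).memLp_two
  have hSp : S.PosSemidef := by
    refine Matrix.PosSemidef.of_dotProduct_mulVec_nonneg ?_ fun x ↦ ?_
    · ext i j
      exact covariance_comm _ _
    · have := isPosSemidef_covarianceBilin (μ := (P.map X).map e)
      have h2 := this.nonneg (WithLp.toLp 2 x)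
      rw [ContinuousLinearMap.toBilinForm_apply, hcov] at h2
      simpa using h2
  have hlaw : (P.map X).map e = multivariateGaussian 0 S := by
    apply IsGaussian.ext
    · rw [integral_map he.aemeasurable (by fun_prop), integral_id_multivariateGaussian']
      simp only [id_eq]
      rw [ContinuousLinearEquiv.integral_comp_comm, integral_map hXm (by fun_prop)]
      rw [EmbeddingLike.map_eq_zero_iff]
      ext i
      exact ((ContinuousLinearMap.proj i : (I → ℝ) →L[ℝ] ℝ).integral_comp_comm
        hXg.integrable).symm.trans (h0 i)
    · ext x y
      rw [hcov, covarianceBilin_multivariateGaussian hSp]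
  set L := Matrix.toEuclideanCLM (𝕜 := ℝ) (CFC.sqrt S) with hL
  have hmap : (P.map X).map e = (stdGaussian (EuclideanSpace ℝ I)).map L := by
    rw [hlaw, multivariateGaussian]
    simp [hL]
  have hLm : Measurable L := L.continuous.measurable
  have hpr : ∀ {A : Set (I → ℝ)}, MeasurableSet A → P {ω | X ω ∈ A} =
      stdGaussian (EuclideanSpace ℝ I) ((fun ξ ↦ e.symm (L ξ)) ⁻¹' A) := by
    intro A hA
    have hA' : MeasurableSet (e.symm ⁻¹' A) := e.symm.continuous.measurable hA
    calc P {ω | X ω ∈ A} = P.map X A := (Measure.map_apply_of_aemeasurable hXm hA).symm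
      _ = (P.map X).map e (e.symm ⁻¹' A) := by
        rw [Measure.map_apply he hA', ← Set.preimage_comp]
        simp
      _ = _ := by rw [hmap, Measure.map_apply hLm hA', ← Set.preimage_comp]; rfl
  have hm : ∀ {A : Set (I → ℝ)}, MeasurableSet A →
      MeasurableSet ((fun ξ ↦ e.symm (L ξ)) ⁻¹' A) := fun hA ↦
    (e.symm.continuous.comp L.continuous).measurable hA
  rw [hpr hA, hpr hB]
  refine stdGaussian_mul_le (hm hA) (hm hB) hr fun ξ hξ η hη ↦ ?_
  by_contra! hlt
  refine h _ hξ _ hη fun ℓ ↦ ?_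
  set ℓ' : StrongDual ℝ (EuclideanSpace ℝ I) := (ℓ ∘L e.symm.toContinuousLinearMap) ∘L L with hℓ
  have h1 : Var[fun ω ↦ ℓ (X ω); P] = ‖ℓ'‖ ^ 2 := by
    rw [← variance_dual_stdGaussian]
    have e1 : Var[ℓ'; stdGaussian (EuclideanSpace ℝ I)] =
        Var[ℓ ∘L e.symm.toContinuousLinearMap; (P.map X).map e] := by
      rw [hmap, variance_map (by fun_prop) hLm.aemeasurable]
      rfl
    rw [e1, variance_map (by fun_prop) he.aemeasurable, variance_map (by fun_prop) hXm]
    congr 1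
  rw [h1, Real.sqrt_sq (norm_nonneg _)]
  have h2 : ℓ (e.symm (L η) - e.symm (L ξ)) = ℓ' (η - ξ) := by simp [hℓ]
  rw [h2]
  calc ℓ' (η - ξ) ≤ ‖ℓ'‖ * ‖η - ξ‖ := (le_abs_self _).trans (ℓ'.le_opNorm _)
    _ ≤ ‖ℓ'‖ * r := by gcongr
    _ = _ := mul_comm _ _

/-! ### Increments of fractional Brownian motion over disjoint intervals -/

lemma rpow_add_rpow_le_of_le_one {α p q r : ℝ} (hα0 : 0 ≤ α) (hα : α ≤ 1) (hp : 0 ≤ p)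
    (hq : 0 ≤ q) (hr : 0 ≤ r) :
    p ^ α + (p + q + r) ^ α ≤ (p + q) ^ α + (p + r) ^ α := by
  rcases (add_nonneg hq hr).eq_or_lt with h0 | h0
  · obtain rfl : q = 0 := by linarith
    obtain rfl : r = 0 := by linarith
    simp
  have hc := Real.concaveOn_rpow hα0 hα
  have m1 : p ∈ Set.Ici (0 : ℝ) := hp
  have m2 : p + q + r ∈ Set.Ici (0 : ℝ) := by simp only [Set.mem_Ici]; positivity
  have w : r / (q + r) + q / (q + r) = 1 := by field_simp; ring
  have h1 := hc.2 m1 m2 (div_nonneg hr h0.le) (div_nonneg hq h0.le) w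
  have h2 := hc.2 m1 m2 (div_nonneg hq h0.le) (div_nonneg hr h0.le) (by rw [add_comm]; exact w)
  simp only [smul_eq_mul] at h1 h2
  have e1 : r / (q + r) * p + q / (q + r) * (p + q + r) = p + q := by field_simp; ring
  have e2 : q / (q + r) * p + r / (q + r) * (p + q + r) = p + r := by field_simp; ring
  rw [e1] at h1
  rw [e2] at h2
  have e3 : q / (q + r) = 1 - r / (q + r) := by linarith
  rw [e3] at h1 h2
  linarith

lemma sum_sub_le_of_antitoneOn {ψ : ℝ → ℝ} {T : ℝ} (hψ : AntitoneOn ψ (Set.Icc 0 T))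
    {n : ℕ} {s t : Fin n → ℝ} (hst : ∀ i, 0 ≤ s i ∧ s i ≤ t i) (hchain : ∀ i j, i < j → t i ≤ s j)
    {x : ℝ} (hx0 : 0 ≤ x) (hxT : x ≤ T) (hx : ∀ i, t i ≤ x) :
    ∑ i, (ψ (s i) - ψ (t i)) ≤ ψ 0 - ψ x := by
  induction n generalizing x with
  | zero =>
    simpa using hψ ⟨le_rfl, hx0.trans hxT⟩ ⟨hx0, hxT⟩ hx0
  | succ n ih =>
    rw [Fin.sum_univ_castSucc]
    have hl := hst (Fin.last n)
    have hlx := hx (Fin.last n)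
    have h1 := ih (s := fun i ↦ s i.castSucc) (t := fun i ↦ t i.castSucc) (fun i ↦ hst _)
      (fun i j hij ↦ hchain _ _ (by simpa using hij)) hl.1 (hl.2.trans (hlx.trans hxT))
      (fun i ↦ hchain _ _ (Fin.castSucc_lt_last i))
    have h2 : ψ x ≤ ψ (t (Fin.last n)) :=
      hψ ⟨hl.1.trans hl.2, hlx.trans hxT⟩ ⟨hx0, hxT⟩ hlx
    linarith

/-- The covariance of the increments of fractional Brownian motion over `[s, t]` and `[u, v]`. -/
noncomputable def fbmIncrementCov (H s t u v : ℝ) : ℝ :=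
  1 / 2 * (|v - s| ^ (2 * H) + |t - u| ^ (2 * H) - |u - s| ^ (2 * H) - |v - t| ^ (2 * H))

lemma fbmIncrementCov_comm (H s t u v : ℝ) :
    fbmIncrementCov H s t u v = fbmIncrementCov H u v s t := by
  simp only [fbmIncrementCov, abs_sub_comm v s, abs_sub_comm t u, abs_sub_comm u s,
    abs_sub_comm v t]
  ring

lemma fbmIncrementCov_self {H s t : ℝ} (hH : 0 < H) (hst : s ≤ t) :
    fbmIncrementCov H s t s t = (t - s) ^ (2 * H) := by
  rw [fbmIncrementCov, sub_self, sub_self, abs_zero, Real.zero_rpow (by positivity),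
    abs_of_nonneg (sub_nonneg.2 hst)]
  ring

/-- For `H < 1 / 2` the covariances of one increment with the later ones are negative and, being
differences of an antitone function, they telescope. A gap `γ` between the intervals makes their
sum strictly smaller than half of the variance. -/
lemma sum_abs_fbmIncrementCov_le {H : ℝ} (hH0 : 0 < H) (hH : H < 1 / 2) {n : ℕ} {s t : Fin n → ℝ}
    (hst : ∀ i, 0 ≤ s i ∧ s i ≤ t i) {γ : ℝ} (hγ : 0 ≤ γ) (hchain : ∀ i j, i < j → t i + γ ≤ s j)
    (i : Fin n) :
    ∑ j, (if i < j then |fbmIncrementCov H (s i) (t i) (s j) (t j)| else 0) ≤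
      1 / 2 * ((t i - s i + γ) ^ (2 * H) - γ ^ (2 * H)) := by
  have hsi := hst i
  set ψ : ℝ → ℝ := fun x ↦ (max x (t i + γ) - s i) ^ (2 * H) - (max x (t i + γ) - t i) ^ (2 * H)
    with hψ
  have hanti : Antitone ψ := by
    intro x y hxy
    have hm : max x (t i + γ) ≤ max y (t i + γ) := max_le_max_right _ hxy
    have h1 : t i + γ ≤ max x (t i + γ) := le_max_right _ _
    have := rpow_add_rpow_le_of_le_one (α := 2 * H) (p := max x (t i + γ) - t i)
      (q := t i - s i) (r := max y (t i + γ) - max x (t i + γ)) (by positivity) (by linarith)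
      (by linarith) (by linarith) (by linarith)
    have e1 : max x (t i + γ) - t i + (t i - s i) + (max y (t i + γ) - max x (t i + γ)) =
      max y (t i + γ) - s i := by ring
    have e2 : max x (t i + γ) - t i + (t i - s i) = max x (t i + γ) - s i := by ring
    have e3 : max x (t i + γ) - t i + (max y (t i + γ) - max x (t i + γ)) =
      max y (t i + γ) - t i := by ring
    rw [e1, e2, e3] at this
    simp only [hψ]
    linarith
  have hterm : ∀ j, (if i < j then |fbmIncrementCov H (s i) (t i) (s j) (t j)| else 0) ≤
      1 / 2 * (ψ (s j) - ψ (t j)) := by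
    intro j
    have hnn : 0 ≤ ψ (s j) - ψ (t j) := sub_nonneg.2 (hanti (hst j).2)
    split_ifs with hij
    · have h1 := hchain i j hij
      have h2 := (hst j).2
      have e : fbmIncrementCov H (s i) (t i) (s j) (t j) = -(1 / 2 * (ψ (s j) - ψ (t j))) := by
        simp only [hψ, fbmIncrementCov, max_eq_left h1, max_eq_left (h1.trans h2)]
        rw [abs_of_nonneg (by linarith : 0 ≤ t j - s i), abs_sub_comm (t i) (s j),
          abs_of_nonneg (by linarith : 0 ≤ s j - t i),
          abs_of_nonneg (by linarith : 0 ≤ s j - s i), abs_of_nonneg (by linarith : 0 ≤ t j - t i)]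
        ring
      rw [e, abs_neg, abs_of_nonneg (by positivity)]
    · positivity
  refine (Finset.sum_le_sum fun j _ ↦ hterm j).trans ?_
  rw [← Finset.mul_sum]
  refine mul_le_mul_of_nonneg_left ?_ (by norm_num)
  obtain ⟨T, hT⟩ : ∃ T, ∀ j, t j ≤ T := ⟨_, fun j ↦
    Finset.single_le_sum (f := t) (fun j _ ↦ (hst j).1.trans (hst j).2) (Finset.mem_univ j)⟩
  have hT0 : 0 ≤ T := (hsi.1.trans hsi.2).trans (hT i)
  refine (sum_sub_le_of_antitoneOn (hanti.antitoneOn (Set.Icc 0 T)) hst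
    (fun i j hij ↦ by linarith [hchain i j hij]) hT0 le_rfl hT).trans ?_
  have h0 : ψ 0 = (t i - s i + γ) ^ (2 * H) - γ ^ (2 * H) := by
    simp only [hψ, max_eq_right (by linarith : 0 ≤ t i + γ)]
    congr 2 <;> ring
  have hψT : 0 ≤ ψ T := by
    have : t i + γ ≤ max T (t i + γ) := le_max_right _ _
    refine sub_nonneg.2 (Real.rpow_le_rpow ?_ ?_ (by positivity)) <;> linarith
  linarith

lemma sum_sum_eq_diag_add_two_mul {n : ℕ} (F : Fin n → Fin n → ℝ) (hF : ∀ i j, F i j = F j i) :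
    ∑ i, ∑ j, F i j = ∑ i, F i i + 2 * ∑ i, ∑ j, (if i < j then F i j else 0) := by
  have h : ∀ i j, F i j = (if i = j then F i j else 0) + (if i < j then F i j else 0) +
      (if j < i then F j i else 0) := by
    intro i j
    rcases lt_trichotomy i j with h | h | h
    · simp [h, h.ne, h.not_gt]
    · simp [h]
    · simp [h, h.ne', h.not_gt, hF i j]
  have hc : ∑ i, ∑ j, (if j < i then F j i else 0) = ∑ i, ∑ j, (if i < j then F i j else 0) :=
    Finset.sum_comm
  calc ∑ i, ∑ j, F i j = ∑ i, ∑ j, ((if i = j then F i j else 0) + (if i < j then F i j else 0) +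
      (if j < i then F j i else 0)) :=
        Finset.sum_congr rfl fun i _ ↦ Finset.sum_congr rfl fun j _ ↦ h i j
    _ = _ := by
      simp only [Finset.sum_add_distrib, hc, Finset.sum_ite_eq, Finset.mem_univ, if_true]
      ring

/-- The variance of a signed sum of disjoint increments is at most twice the sum of the variances. -/
lemma sum_sum_fbmIncrementCov_le {H : ℝ} (hH0 : 0 < H) (hH : H < 1 / 2) {n : ℕ} {s t a : Fin n → ℝ}
    (hst : ∀ i, 0 ≤ s i ∧ s i ≤ t i) (hchain : ∀ i j, i < j → t i ≤ s j) (J : Finset (Fin n))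
    (ha : ∀ i, |a i| ≤ 1) (haJ : ∀ i ∉ J, a i = 0) :
    ∑ i, ∑ j, a i * a j * fbmIncrementCov H (s i) (t i) (s j) (t j) ≤
      2 * ∑ i ∈ J, (t i - s i) ^ (2 * H) := by
  rw [sum_sum_eq_diag_add_two_mul _ fun i j ↦ by
    rw [fbmIncrementCov_comm]; ring]
  have h1 : ∑ i, a i * a i * fbmIncrementCov H (s i) (t i) (s i) (t i) ≤
      ∑ i ∈ J, (t i - s i) ^ (2 * H) := by
    rw [← Finset.sum_subset (Finset.subset_univ J) fun i _ hi ↦ by simp [haJ i hi]]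
    refine Finset.sum_le_sum fun i _ ↦ ?_
    rw [fbmIncrementCov_self hH0 (hst i).2]
    refine mul_le_of_le_one_left (Real.rpow_nonneg (sub_nonneg.2 (hst i).2) _) ?_
    rw [← sq, ← sq_abs]
    exact pow_le_one₀ (abs_nonneg _) (ha i)
  have h2 : ∑ i, ∑ j, (if i < j then
      a i * a j * fbmIncrementCov H (s i) (t i) (s j) (t j) else 0) ≤
      ∑ i ∈ J, 1 / 2 * (t i - s i) ^ (2 * H) := by
    rw [← Finset.sum_subset (Finset.subset_univ J) fun i _ hi ↦ by simp [haJ i hi]]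
    refine Finset.sum_le_sum fun i _ ↦ ?_
    have := sum_abs_fbmIncrementCov_le hH0 hH hst le_rfl (γ := 0) (by simpa using hchain) i
    rw [Real.zero_rpow (by positivity), add_zero, sub_zero] at this
    refine (Finset.sum_le_sum fun j _ ↦ ?_).trans this
    split_ifs with hij
    · refine (le_abs_self _).trans ?_
      rw [abs_mul, abs_mul]
      exact mul_le_of_le_one_left (abs_nonneg _)
        (mul_le_one₀ (ha i) (abs_nonneg _) (ha j))
    · exact le_rfl
  rw [← Finset.mul_sum] at h2
  linarith

/-- Intervals of length `δ` with gaps of length at least `δ`: the negative correlations take away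
only part of the variance. -/
lemma le_sum_sum_fbmIncrementCov {H : ℝ} (hH0 : 0 < H) (hH : H < 1 / 2) {n : ℕ} {s t : Fin n → ℝ}
    {δ : ℝ} (hδ : 0 ≤ δ) (hst : ∀ i, 0 ≤ s i ∧ t i = s i + δ)
    (hchain : ∀ i j, i < j → t i + δ ≤ s j) :
    n * ((2 - 2 ^ (2 * H)) * δ ^ (2 * H)) ≤
      ∑ i, ∑ j, fbmIncrementCov H (s i) (t i) (s j) (t j) := by
  rw [sum_sum_eq_diag_add_two_mul _ fun i j ↦ by rw [fbmIncrementCov_comm]]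
  have hst' : ∀ i, 0 ≤ s i ∧ s i ≤ t i := fun i ↦ ⟨(hst i).1, by linarith [(hst i).2]⟩
  have hd : ∀ i, t i - s i = δ := fun i ↦ by linarith [(hst i).2]
  have h1 : ∑ i, fbmIncrementCov H (s i) (t i) (s i) (t i) = n * δ ^ (2 * H) := by
    simp [fbmIncrementCov_self hH0 (hst' _).2, hd]
  have h2 : -(n * (1 / 2 * ((2 * δ) ^ (2 * H) - δ ^ (2 * H)))) ≤
      ∑ i, ∑ j, (if i < j then fbmIncrementCov H (s i) (t i) (s j) (t j) else 0) := by
    rw [neg_le, ← Finset.sum_neg_distrib]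
    calc _ ≤ ∑ i : Fin n, (1 / 2 * ((2 * δ) ^ (2 * H) - δ ^ (2 * H))) := by
          refine Finset.sum_le_sum fun i _ ↦ ?_
          have := sum_abs_fbmIncrementCov_le hH0 hH hst' hδ hchain i
          rw [hd, ← two_mul] at this
          refine le_trans ?_ this
          rw [← Finset.sum_neg_distrib]
          refine Finset.sum_le_sum fun j _ ↦ ?_
          split_ifs
          · exact neg_le_abs _
          · simp
      _ = _ := by simp
  rw [Real.mul_rpow (by norm_num) hδ] at h2
  rw [h1]
  nlinarith

lemma sum_length_rpow_le {H T : ℝ} (hH0 : 0 < H) (hH : H < 1 / 2) (hT : 0 ≤ T) {n : ℕ}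
    {s t : Fin n → ℝ} (hst : ∀ i, 0 ≤ s i ∧ s i ≤ t i ∧ t i ≤ T)
    (hchain : ∀ i j, i < j → t i ≤ s j) (J : Finset (Fin n)) :
    ∑ i ∈ J, (t i - s i) ^ (2 * H) ≤ (J.card : ℝ) ^ (1 - 2 * H) * T ^ (2 * H) := by
  rcases J.eq_empty_or_nonempty with rfl | hJ
  · simp [Real.zero_rpow (by linarith : 1 - 2 * H ≠ 0)]
  have hc : 0 < (J.card : ℝ) := by exact_mod_cast hJ.card_pos
  have hlen : ∑ i ∈ J, (t i - s i) ≤ T := by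
    have h1 : ∑ i ∈ J, (t i - s i) ≤ ∑ i, (t i - s i) :=
      Finset.sum_le_univ_sum_of_nonneg fun i ↦ sub_nonneg.2 (hst i).2.1
    have h2 := sum_sub_le_of_antitoneOn (ψ := fun x ↦ -x) (T := T)
      (fun x _ y _ h ↦ neg_le_neg h) (fun i ↦ ⟨(hst i).1, (hst i).2.1⟩) hchain hT le_rfl
      (fun i ↦ (hst i).2.2)
    refine h1.trans (le_trans (le_of_eq ?_) (h2.trans_eq (by ring)))
    exact Finset.sum_congr rfl fun i _ ↦ by ring
  have h1 := (Real.concaveOn_rpow (p := 2 * H) (by positivity) (by linarith)).le_map_sum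
    (t := J) (w := fun _ ↦ (J.card : ℝ)⁻¹) (p := fun i ↦ t i - s i)
    (fun i _ ↦ by positivity) (by simp [hc.ne']) (fun i _ ↦ sub_nonneg.2 (hst i).2.1)
  simp only [smul_eq_mul, ← Finset.mul_sum] at h1
  have hs0 : 0 ≤ ∑ i ∈ J, (t i - s i) := Finset.sum_nonneg fun i _ ↦ sub_nonneg.2 (hst i).2.1
  have h2 : ((J.card : ℝ)⁻¹ * ∑ i ∈ J, (t i - s i)) ^ (2 * H) ≤ ((J.card : ℝ)⁻¹ * T) ^ (2 * H) :=
    Real.rpow_le_rpow (by positivity) (by gcongr) (by positivity)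
  rw [Real.mul_rpow (by positivity) hT] at h2
  have h3 := mul_le_mul_of_nonneg_left (h1.trans h2) hc.le
  rw [mul_inv_cancel_left₀ hc.ne'] at h3
  refine h3.trans_eq ?_
  rw [← mul_assoc, Real.rpow_sub hc, Real.rpow_one, Real.inv_rpow hc.le]
  rfl

namespace IsFractionalBrownianMotion

variable {Ω : Type*} [MeasurableSpace Ω] {H : ℝ} {W : ℝ≥0 → Ω → ℝ} {P : Measure Ω}

lemma memLp_two (hW : IsFractionalBrownianMotion H W P) (t : ℝ≥0) : MemLp (W t) 2 P :=
  (hW.isGaussianProcess.hasGaussianLaw_eval t).memLp_two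

lemma covariance_eq (hW : IsFractionalBrownianMotion H W P) (s t : ℝ≥0) :
    cov[W s, W t; P] =
      1 / 2 * ((s : ℝ) ^ (2 * H) + (t : ℝ) ^ (2 * H) - |(t : ℝ) - (s : ℝ)| ^ (2 * H)) := by
  have := hW.isGaussianProcess.isProbabilityMeasure
  rw [covariance_eq_sub (hW.memLp_two s) (hW.memLp_two t), hW.centered s, zero_mul, sub_zero,
    ← hW.covariance]
  rfl

lemma covariance_increment (hW : IsFractionalBrownianMotion H W P) (s t u v : ℝ≥0) :
    cov[fun ω ↦ W t ω - W s ω, fun ω ↦ W v ω - W u ω; P] = fbmIncrementCov H s t u v := by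
  have := hW.isGaussianProcess.isProbabilityMeasure
  rw [covariance_fun_sub_fun_sub (hW.memLp_two _) (hW.memLp_two _) (hW.memLp_two _)
    (hW.memLp_two _)]
  have h := hW.covariance_eq
  simp only [h, fbmIncrementCov]
  rw [abs_sub_comm (u : ℝ) t]
  ring

lemma variance_sum_increments (hW : IsFractionalBrownianMotion H W P) {n : ℕ}
    (s t : Fin n → ℝ≥0) (a : Fin n → ℝ) :
    Var[fun ω ↦ ∑ i, a i * (W (t i) ω - W (s i) ω); P] =
      ∑ i, ∑ j, a i * a j * fbmIncrementCov H (s i) (t i) (s j) (t j) := by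
  have := hW.isGaussianProcess.isProbabilityMeasure
  have hm : ∀ i, MemLp (fun ω ↦ a i * (W (t i) ω - W (s i) ω)) 2 P := fun i ↦
    ((hW.memLp_two _).sub (hW.memLp_two _)).const_mul _
  rw [← covariance_self (memLp_finsetSum _ fun i _ ↦ hm i).aemeasurable,
    covariance_fun_sum_fun_sum (fun i ↦ hm i) (fun i ↦ hm i)]
  refine Finset.sum_congr rfl fun i _ ↦ Finset.sum_congr rfl fun j _ ↦ ?_
  rw [covariance_const_mul_left, covariance_const_mul_right, hW.covariance_increment]
  ring

lemma variance_increment (hW : IsFractionalBrownianMotion H W P) (hH0 : 0 < H) {s t : ℝ≥0}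
    (hst : s ≤ t) : Var[fun ω ↦ W t ω - W s ω; P] = ((t : ℝ) - s) ^ (2 * H) := by
  have hm : MemLp (fun ω ↦ W t ω - W s ω) 2 P := (hW.memLp_two _).sub (hW.memLp_two _)
  rw [← covariance_self hm.aemeasurable,
    hW.covariance_increment, fbmIncrementCov_self hH0 (by exact_mod_cast hst)]

/-- A signed sum of `J.card` disjoint increments has variance at most
`2 * J.card ^ (1 - 2 * H) * T ^ (2 * H)`, the order which independent increments would give. -/
lemma variance_sum_increments_le (hW : IsFractionalBrownianMotion H W P) (hH0 : 0 < H)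
    (hH : H < 1 / 2) {T : ℝ≥0} {n : ℕ} {s t : Fin n → ℝ≥0} (hst : IsWeakChain 0 T s t)
    {a : Fin n → ℝ} (J : Finset (Fin n)) (ha : ∀ i, |a i| ≤ 1) (haJ : ∀ i ∉ J, a i = 0) :
    Var[fun ω ↦ ∑ i, a i * (W (t i) ω - W (s i) ω); P] ≤
      2 * ((J.card : ℝ) ^ (1 - 2 * H) * (T : ℝ) ^ (2 * H)) := by
  have h1 : ∀ i, (0 : ℝ) ≤ s i ∧ (s i : ℝ) ≤ t i ∧ (t i : ℝ) ≤ T := fun i ↦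
    ⟨(s i).2, by exact_mod_cast (hst.1 i).2.1.le, by exact_mod_cast (hst.1 i).2.2⟩
  have h2 : ∀ i j, i < j → (t i : ℝ) ≤ s j := fun i j hij ↦ by exact_mod_cast hst.2 i j hij
  rw [hW.variance_sum_increments]
  refine (sum_sum_fbmIncrementCov_le hH0 hH (fun i ↦ ⟨(h1 i).1, (h1 i).2.1⟩) h2 J ha haJ).trans ?_
  exact mul_le_mul_of_nonneg_left (sum_length_rpow_le hH0 hH T.2 h1 h2 J) (by norm_num)

end IsFractionalBrownianMotion

/-! ### Suprema over chains of intervals -/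

/-- A finite sequence of intervals `[s i, t i]`, without any condition on the end points. -/
abbrev IntervalChain : Type := Σ n : ℕ, (Fin n → ℝ≥0) × (Fin n → ℝ≥0)

/-- The chains over which the truncated variation on `[0, T]` is a supremum. -/
def weakChains (T : ℝ≥0) : Set IntervalChain := {κ | 1 ≤ κ.1 ∧ IsWeakChain 0 T κ.2.1 κ.2.2}

/-- The chains over which the upward and downward truncated variations on `[0, T]` are suprema. -/
def strictChains (T : ℝ≥0) : Set IntervalChain := {κ | 1 ≤ κ.1 ∧ IsStrictChain 0 T κ.2.1 κ.2.2}

lemma strictChains_subset_weakChains (T : ℝ≥0) : strictChains T ⊆ weakChains T :=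
  fun _ hκ ↦ ⟨hκ.1, hκ.2.1, fun i j hij ↦ (hκ.2.2 i j hij).le⟩

/-- The sum of the positive parts of `φ (f (t i) - f (s i))` over a chain. -/
noncomputable def chainSum (φ : ℝ → ℝ) (f : ℝ≥0 → ℝ) (κ : IntervalChain) : ℝ :=
  ∑ i, max (φ (f (κ.2.2 i) - f (κ.2.1 i))) 0

/-- The supremum of `chainSum φ f` over a set of chains. The three truncated variations are the
cases `φ x = |x| - c`, `φ x = x - c` and `φ x = -x - c`. -/
noncomputable def chainSup (φ : ℝ → ℝ) (K : Set IntervalChain) (f : ℝ≥0 → ℝ) : ℝ≥0∞ :=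
  ⨆ κ ∈ K, ENNReal.ofReal (chainSum φ f κ)

/-- The properties of `x ↦ |x| - c`, `x ↦ x - c` and `x ↦ -x - c` used below. -/
structure IsTruncation (c : ℝ) (φ : ℝ → ℝ) : Prop where
  add_le : ∀ x y, φ (x + y) ≤ φ x + |y|
  le_abs_sub : ∀ x, φ x ≤ |x| - c

lemma isTruncation_abs (c : ℝ) : IsTruncation c fun x ↦ |x| - c :=
  ⟨fun x y ↦ by linarith [abs_add_le x y], fun _ ↦ le_rfl⟩

lemma isTruncation_id (c : ℝ) : IsTruncation c fun x ↦ x - c :=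
  ⟨fun x y ↦ by linarith [le_abs_self y], fun x ↦ by linarith [le_abs_self x]⟩

lemma isTruncation_neg (c : ℝ) : IsTruncation c fun x ↦ -x - c :=
  ⟨fun x y ↦ by linarith [neg_le_abs y], fun x ↦ by linarith [neg_le_abs x]⟩

lemma IsTruncation.continuous {c : ℝ} {φ : ℝ → ℝ} (hφ : IsTruncation c φ) : Continuous φ := by
  refine LipschitzWith.continuous (K := 1) (LipschitzWith.of_dist_le_mul fun x y ↦ ?_)
  rw [Real.dist_eq, Real.dist_eq, NNReal.coe_one, one_mul, abs_le]
  have h1 := hφ.add_le y (x - y)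
  have h2 := hφ.add_le x (y - x)
  rw [add_sub_cancel] at h1 h2
  rw [abs_sub_comm y x] at h2
  constructor <;> linarith

lemma le_chainSup {φ : ℝ → ℝ} {K : Set IntervalChain} {f : ℝ≥0 → ℝ} {κ : IntervalChain}
    (hκ : κ ∈ K) : ENNReal.ofReal (chainSum φ f κ) ≤ chainSup φ K f :=
  le_iSup₂ (f := fun κ (_ : κ ∈ K) ↦ ENNReal.ofReal (chainSum φ f κ)) κ hκ

lemma chainSup_le_iff {φ : ℝ → ℝ} {K : Set IntervalChain} {f : ℝ≥0 → ℝ} {a : ℝ≥0∞} :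
    chainSup φ K f ≤ a ↔ ∀ κ ∈ K, ENNReal.ofReal (chainSum φ f κ) ≤ a := iSup₂_le_iff

lemma chainSup_mono {φ : ℝ → ℝ} {K K' : Set IntervalChain} (h : K ⊆ K') (f : ℝ≥0 → ℝ) :
    chainSup φ K f ≤ chainSup φ K' f := biSup_mono h

lemma chainSup_le_chainSup {φ ψ : ℝ → ℝ} (h : ∀ x, φ x ≤ ψ x) (K : Set IntervalChain)
    (f : ℝ≥0 → ℝ) : chainSup φ K f ≤ chainSup ψ K f :=
  iSup₂_mono fun _ _ ↦ ENNReal.ofReal_le_ofReal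
    (Finset.sum_le_sum fun _ _ ↦ max_le_max_right _ (h _))

lemma ofReal_chainSum (φ : ℝ → ℝ) (f : ℝ≥0 → ℝ) (κ : IntervalChain) :
    ENNReal.ofReal (chainSum φ f κ) =
      ∑ i, ENNReal.ofReal (φ (f (κ.2.2 i) - f (κ.2.1 i))) := by
  rw [chainSum, ENNReal.ofReal_sum_of_nonneg fun _ _ ↦ le_max_right _ _]
  exact Finset.sum_congr rfl fun i _ ↦ by rw [ENNReal.ofReal_max]; simp

lemma truncatedVariation_eq_chainSup (f : ℝ≥0 → ℝ) (T : ℝ≥0) (c : ℝ) :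
    truncatedVariation f 0 T c = chainSup (fun x ↦ |x| - c) (weakChains T) f := by
  refine le_antisymm ?_ ?_
  · refine iSup_le fun n ↦ iSup_le fun hn ↦ iSup_le fun s ↦ iSup_le fun t ↦ iSup_le fun h ↦ ?_
    have := le_chainSup (φ := fun x ↦ |x| - c) (f := f) (K := weakChains T)
      (κ := ⟨n, s, t⟩) ⟨hn, h⟩
    rwa [ofReal_chainSum] at this
  · rw [chainSup_le_iff]
    rintro ⟨n, s, t⟩ ⟨hn, h⟩
    rw [ofReal_chainSum]
    exact le_iSup_of_le n (le_iSup_of_le hn (le_iSup_of_le s (le_iSup_of_le t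
      (le_iSup_of_le h le_rfl))))

lemma upwardTruncatedVariation_eq_chainSup (f : ℝ≥0 → ℝ) (T : ℝ≥0) (c : ℝ) :
    upwardTruncatedVariation f 0 T c = chainSup (fun x ↦ x - c) (strictChains T) f := by
  refine le_antisymm ?_ ?_
  · refine iSup_le fun n ↦ iSup_le fun hn ↦ iSup_le fun s ↦ iSup_le fun t ↦ iSup_le fun h ↦ ?_
    have := le_chainSup (φ := fun x ↦ x - c) (f := f) (K := strictChains T)
      (κ := ⟨n, s, t⟩) ⟨hn, h⟩
    rwa [ofReal_chainSum] at this
  · rw [chainSup_le_iff]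
    rintro ⟨n, s, t⟩ ⟨hn, h⟩
    rw [ofReal_chainSum]
    exact le_iSup_of_le n (le_iSup_of_le hn (le_iSup_of_le s (le_iSup_of_le t
      (le_iSup_of_le h le_rfl))))

lemma downwardTruncatedVariation_eq_chainSup (f : ℝ≥0 → ℝ) (T : ℝ≥0) (c : ℝ) :
    downwardTruncatedVariation f 0 T c = chainSup (fun x ↦ -x - c) (strictChains T) f := by
  refine le_antisymm ?_ ?_
  · refine iSup_le fun n ↦ iSup_le fun hn ↦ iSup_le fun s ↦ iSup_le fun t ↦ iSup_le fun h ↦ ?_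
    have := le_chainSup (φ := fun x ↦ -x - c) (f := f) (K := strictChains T)
      (κ := ⟨n, s, t⟩) ⟨hn, h⟩
    rw [ofReal_chainSum] at this
    simpa only [neg_sub] using this
  · rw [chainSup_le_iff]
    rintro ⟨n, s, t⟩ ⟨hn, h⟩
    rw [ofReal_chainSum]
    refine le_iSup_of_le n (le_iSup_of_le hn (le_iSup_of_le s (le_iSup_of_le t
      (le_iSup_of_le h ?_))))
    simp only [neg_sub, le_refl]

/-- The dyadic fractions of `T`. -/
def dyadicFractions (T : ℝ≥0) : Set ℝ≥0 := Set.range fun p : ℕ × ℕ ↦ T * (p.1 / 2 ^ p.2)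

/-- The chains in `K` all of whose end points are dyadic fractions of `T`. -/
def dyadicChains (T : ℝ≥0) (K : Set IntervalChain) : Set IntervalChain :=
  {κ ∈ K | ∀ i, κ.2.1 i ∈ dyadicFractions T ∧ κ.2.2 i ∈ dyadicFractions T}

lemma countable_dyadicChains (T : ℝ≥0) (K : Set IntervalChain) : (dyadicChains T K).Countable := by
  have hD : Countable (dyadicFractions T) := (Set.countable_range _).to_subtype
  let F : (Σ n : ℕ, (Fin n → dyadicFractions T) × (Fin n → dyadicFractions T)) → IntervalChain :=
    fun κ ↦ ⟨κ.1, fun i ↦ κ.2.1 i, fun i ↦ κ.2.2 i⟩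
  refine (Set.countable_range F).mono ?_
  rintro ⟨n, s, t⟩ ⟨-, h⟩
  exact ⟨⟨n, fun i ↦ ⟨s i, (h i).1⟩, fun i ↦ ⟨t i, (h i).2⟩⟩, rfl⟩

/-- The largest multiple of `T / 2 ^ m` which is at most `x`. -/
noncomputable def dyadicFloor (T : ℝ≥0) (m : ℕ) (x : ℝ≥0) : ℝ≥0 := T * (⌊x / T * 2 ^ m⌋₊ / 2 ^ m)

lemma dyadicFloor_mem (T : ℝ≥0) (m : ℕ) (x : ℝ≥0) : dyadicFloor T m x ∈ dyadicFractions T :=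
  ⟨(_, m), rfl⟩

lemma dyadicFloor_mono (T : ℝ≥0) (m : ℕ) : Monotone (dyadicFloor T m) := by
  intro x y hxy
  unfold dyadicFloor
  gcongr

lemma dyadicFloor_le {T : ℝ≥0} (hT : 0 < T) (m : ℕ) (x : ℝ≥0) : dyadicFloor T m x ≤ x := by
  unfold dyadicFloor
  calc T * (⌊x / T * 2 ^ m⌋₊ / 2 ^ m) ≤ T * ((x / T * 2 ^ m) / 2 ^ m) := by
        gcongr
        exact Nat.floor_le zero_le
    _ = x := by field_simp

lemma tendsto_dyadicFloor {T : ℝ≥0} (hT : 0 < T) (x : ℝ≥0) :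
    Filter.Tendsto (fun m ↦ dyadicFloor T m x) Filter.atTop (nhds x) := by
  have h1 : Filter.Tendsto (fun m : ℕ ↦ (2 : ℝ) ^ m) Filter.atTop Filter.atTop :=
    tendsto_pow_atTop_atTop_of_one_lt (by norm_num)
  have h2 := (tendsto_nat_floor_mul_div_atTop (a := (x : ℝ) / T) (by positivity)).comp h1
  have h3 := h2.const_mul (T : ℝ)
  rw [mul_div_cancel₀ _ (by positivity)] at h3
  rw [← NNReal.tendsto_coe]
  refine h3.congr fun m ↦ ?_
  simp only [Function.comp_apply, dyadicFloor, NNReal.coe_mul, NNReal.coe_div, NNReal.coe_natCast,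
    NNReal.coe_pow, NNReal.coe_ofNat]
  congr 3

lemma tendsto_chainSum_dyadicFloor {T : ℝ≥0} (hT : 0 < T) {φ : ℝ → ℝ} (hφ : Continuous φ)
    {f : ℝ≥0 → ℝ} (hf : Continuous f) (κ : IntervalChain) :
    Filter.Tendsto (fun m ↦ ENNReal.ofReal (chainSum φ f
      ⟨κ.1, fun i ↦ dyadicFloor T m (κ.2.1 i), fun i ↦ dyadicFloor T m (κ.2.2 i)⟩)) Filter.atTop
      (nhds (ENNReal.ofReal (chainSum φ f κ))) := by
  have hterm (i : Fin κ.1) : Filter.Tendsto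
      (fun m ↦ max (φ (f (dyadicFloor T m (κ.2.2 i)) - f (dyadicFloor T m (κ.2.1 i)))) 0)
      Filter.atTop (nhds (max (φ (f (κ.2.2 i) - f (κ.2.1 i))) 0)) := by
    have h1 := (hf.tendsto (κ.2.2 i)).comp (tendsto_dyadicFloor hT (κ.2.2 i))
    have h2 := (hf.tendsto (κ.2.1 i)).comp (tendsto_dyadicFloor hT (κ.2.1 i))
    exact ((hφ.tendsto _).comp (h1.sub h2)).max tendsto_const_nhds
  have hsum : Filter.Tendsto
      (fun m ↦ ∑ i, max (φ (f (dyadicFloor T m (κ.2.2 i)) - f (dyadicFloor T m (κ.2.1 i)))) 0)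
      Filter.atTop (nhds (∑ i, max (φ (f (κ.2.2 i) - f (κ.2.1 i))) 0)) :=
    tendsto_finsetSum Finset.univ fun i _ ↦ hterm i
  exact ENNReal.tendsto_ofReal hsum

/-- A continuous function may be tested on dyadic chains only. -/
lemma chainSup_dyadicChains {T : ℝ≥0} (hT : 0 < T) {K : Set IntervalChain}
    (hK : K = weakChains T ∨ K = strictChains T) {φ : ℝ → ℝ} (hφ : Continuous φ) {f : ℝ≥0 → ℝ}
    (hf : Continuous f) : chainSup φ (dyadicChains T K) f = chainSup φ K f := by
  refine le_antisymm (chainSup_mono (fun _ h ↦ h.1) f) ?_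
  rw [chainSup_le_iff]
  rintro ⟨n, s, t⟩ hκ
  set κ' : ℕ → IntervalChain := fun m ↦
    ⟨n, fun i ↦ dyadicFloor T m (s i), fun i ↦ dyadicFloor T m (t i)⟩ with hκ'
  refine le_of_tendsto (tendsto_chainSum_dyadicFloor hT hφ hf ⟨n, s, t⟩) ?_
  have hlt (x y : ℝ≥0) (hxy : x < y) :
      ∀ᶠ m in Filter.atTop, dyadicFloor T m x < dyadicFloor T m y :=
    (tendsto_dyadicFloor hT _).eventually_lt (tendsto_dyadicFloor hT _) hxy
  have hb : ∀ i, s i < t i ∧ t i ≤ T := by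
    intro i
    rcases hK with hK | hK <;> rw [hK] at hκ
    · exact (hκ.2.1 i).2
    · exact (hκ.2.1 i).2
  have h1 : ∀ᶠ m in Filter.atTop, ∀ i, 0 ≤ dyadicFloor T m (s i) ∧
      dyadicFloor T m (s i) < dyadicFloor T m (t i) ∧ dyadicFloor T m (t i) ≤ T := by
    rw [Filter.eventually_all]
    intro i
    filter_upwards [hlt _ _ (hb i).1] with m hm
    exact ⟨zero_le, hm, (dyadicFloor_le hT m _).trans (hb i).2⟩
  have h2 : ∀ᶠ m in Filter.atTop, κ' m ∈ K := by
    rcases hK with hK | hK <;> rw [hK] at hκ <;> rw [hK]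
    · filter_upwards [h1] with m hm
      exact ⟨hκ.1, hm, fun i j hij ↦ dyadicFloor_mono T m (hκ.2.2 i j hij)⟩
    · have h3 : ∀ᶠ m in Filter.atTop, ∀ i j, i < j →
          dyadicFloor T m (t i) < dyadicFloor T m (s j) := by
        simp only [Filter.eventually_all]
        exact fun i j hij ↦ hlt _ _ (hκ.2.2 i j hij)
      filter_upwards [h1, h3] with m hm hm3
      exact ⟨hκ.1, hm, hm3⟩
  filter_upwards [h2] with m hm
  exact le_chainSup ⟨hm, fun i ↦ ⟨dyadicFloor_mem _ _ _, dyadicFloor_mem _ _ _⟩⟩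

section Measurability

variable {Ω : Type*} [MeasurableSpace Ω] {P : Measure Ω} {W : ℝ≥0 → Ω → ℝ}

lemma aemeasurable_chainSum (hW : ∀ t, AEMeasurable (W t) P) {φ : ℝ → ℝ} (hφ : Continuous φ)
    (κ : IntervalChain) : AEMeasurable (fun ω ↦ chainSum φ (fun t ↦ W t ω) κ) P :=
  Finset.aemeasurable_fun_sum _ fun _ _ ↦
    (hφ.measurable.comp_aemeasurable ((hW _).sub (hW _))).max aemeasurable_const

lemma aemeasurable_chainSup (hW : ∀ t, AEMeasurable (W t) P)
    (hc : ∀ᵐ ω ∂P, Continuous fun t ↦ W t ω) {T : ℝ≥0} (hT : 0 < T) {K : Set IntervalChain}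
    (hK : K = weakChains T ∨ K = strictChains T) {φ : ℝ → ℝ} (hφ : Continuous φ) :
    AEMeasurable (fun ω ↦ chainSup φ K fun t ↦ W t ω) P := by
  have h : AEMeasurable (fun ω ↦ chainSup φ (dyadicChains T K) fun t ↦ W t ω) P :=
    AEMeasurable.biSup _ (countable_dyadicChains T K) fun κ _ ↦
      (aemeasurable_chainSum hW hφ κ).ennreal_ofReal
  refine h.congr ?_
  filter_upwards [hc] with ω hω
  exact chainSup_dyadicChains hT hK hφ hω

end Measurability

/-! ### Concentration of chain suprema -/

/-- The effect on a chain sum with truncation level `1` of moving from the path `f` to the path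
`g`. Only the `m` intervals which contribute for `g` matter. Each of them contributes at least
`1 / 2` to the sum with truncation level `1 / 2`, so that this sum controls `m`. -/
lemma exists_chainSum_le_add {φ : ℝ → ℝ} (hφ : IsTruncation 1 φ) {f g : ℝ≥0 → ℝ}
    {κ : IntervalChain} {G : ℕ → ℝ}
    (hG : ∀ (a : Fin κ.1 → ℝ) (J : Finset (Fin κ.1)), (∀ i, |a i| ≤ 1) → (∀ i ∉ J, a i = 0) →
      ∑ i, a i * ((g (κ.2.2 i) - f (κ.2.2 i)) - (g (κ.2.1 i) - f (κ.2.1 i))) ≤ G J.card) :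
    ∃ m : ℕ, chainSum φ g κ ≤ chainSum φ f κ + G m ∧
      (m : ℝ) / 2 ≤ chainSum (fun x ↦ |x| - 1 / 2) g κ ∧
      (m : ℝ) / 2 ≤ chainSum (fun x ↦ |x| - 1 / 2) f κ + G m := by
  classical
  set x : Fin κ.1 → ℝ := fun i ↦ f (κ.2.2 i) - f (κ.2.1 i) with hx
  set y : Fin κ.1 → ℝ := fun i ↦ g (κ.2.2 i) - g (κ.2.1 i) with hy
  set J : Finset (Fin κ.1) := Finset.univ.filter fun i ↦ 0 < φ (y i) with hJ
  have hJy : ∀ i ∈ J, 1 < |y i| := fun i hi ↦ by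
    have h1 := (Finset.mem_filter.1 hi).2
    have h2 := hφ.le_abs_sub (y i)
    linarith
  set a : Fin κ.1 → ℝ := fun i ↦ if i ∈ J then (SignType.sign (y i - x i) : ℝ) else 0 with ha
  have ha1 : ∀ i, |a i| ≤ 1 := by
    intro i
    simp only [ha]
    split_ifs
    · rcases lt_trichotomy (y i - x i) 0 with h | h | h <;> simp [h, sign_neg, sign_pos]
    · simp
  have hsum : ∑ i ∈ J, |y i - x i| ≤ G J.card := by
    refine le_trans (le_of_eq ?_) (hG a J ha1 fun i hi ↦ by simp [ha, hi])
    rw [← Finset.sum_subset (Finset.subset_univ J) fun i _ hi ↦ by simp [ha, hi]]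
    refine Finset.sum_congr rfl fun i hi ↦ ?_
    simp only [ha, hi, if_true, hx, hy]
    rw [← sign_mul_self (_ : ℝ)]
    congr 1
    ring
  have hmono : ∀ (ψ : ℝ → ℝ) (z : Fin κ.1 → ℝ), ∑ i ∈ J, ψ (z i) ≤ ∑ i, max (ψ (z i)) 0 := by
    intro ψ z
    refine (Finset.sum_le_sum fun i _ ↦ le_max_left _ 0).trans ?_
    exact Finset.sum_le_univ_sum_of_nonneg fun i ↦ le_max_right _ _
  have hcard : (J.card : ℝ) / 2 ≤ ∑ i ∈ J, (|y i| - 1 / 2) := by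
    have : ∑ i ∈ J, (1 / 2 : ℝ) ≤ ∑ i ∈ J, (|y i| - 1 / 2) :=
      Finset.sum_le_sum fun i hi ↦ by linarith [hJy i hi]
    refine le_trans (le_of_eq ?_) this
    simp
    ring
  refine ⟨J.card, ?_, hcard.trans (hmono (fun x ↦ |x| - 1 / 2) y), ?_⟩
  · have e : chainSum φ g κ = ∑ i ∈ J, φ (y i) := by
      rw [chainSum, hJ, Finset.sum_filter]
      refine Finset.sum_congr rfl fun i _ ↦ ?_
      split_ifs with h
      · exact max_eq_left h.le
      · exact max_eq_right (not_lt.1 h)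
    rw [e]
    calc ∑ i ∈ J, φ (y i) ≤ ∑ i ∈ J, (φ (x i) + |y i - x i|) := by
          refine Finset.sum_le_sum fun i _ ↦ ?_
          have := hφ.add_le (x i) (y i - x i)
          rwa [add_sub_cancel] at this
      _ ≤ _ := by
          rw [Finset.sum_add_distrib]
          exact add_le_add (hmono φ x) hsum
  · calc (J.card : ℝ) / 2 ≤ ∑ i ∈ J, (|y i| - 1 / 2) := hcard
      _ ≤ ∑ i ∈ J, ((|x i| - 1 / 2) + |y i - x i|) := by
          refine Finset.sum_le_sum fun i _ ↦ ?_
          have := abs_add_le (x i) (y i - x i)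
          rw [add_sub_cancel] at this
          linarith
      _ ≤ _ := by
          rw [Finset.sum_add_distrib]
          exact add_le_add (hmono (fun x ↦ |x| - 1 / 2) x) hsum

/-- The radius of the Cameron–Martin ball within which a chain supremum on `[0, T]` with truncation
level `1` varies by at most `T v`, at paths whose truncated variation with level `1 / 2` is at most
`K T`. -/
noncomputable def concentrationRadius (H K T v : ℝ) : ℝ :=
  1 / (8 * K) * √(T * min (v ^ (1 + 2 * H)) (v ^ (2 : ℝ)))

lemma mul_rpow_le_of_concentrationRadius {H K T v m : ℝ} (hH0 : 0 < H) (hH : H < 1 / 2)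
    (hK : 1 ≤ K) (hT : 0 < T) (hv : 0 < v) (hm : 0 ≤ m)
    (h : m / 2 ≤ K * T + concentrationRadius H K T v * √(2 * (m ^ (1 - 2 * H) * T ^ (2 * H)))) :
    concentrationRadius H K T v * √(2 * (m ^ (1 - 2 * H) * T ^ (2 * H))) ≤ T * v := by
  set r := concentrationRadius H K T v with hr
  have hr0 : 0 ≤ r := by rw [hr, concentrationRadius]; positivity
  have hs2 : √2 ≤ 2 := by
    rw [Real.sqrt_le_left (by norm_num)]; norm_num
  have hroot : √(2 * (m ^ (1 - 2 * H) * T ^ (2 * H))) = √2 * (m ^ (1 / 2 - H) * T ^ H) := by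
    rw [Real.sqrt_mul (by norm_num), Real.sqrt_mul (by positivity), Real.sqrt_eq_rpow (m ^ _),
      Real.sqrt_eq_rpow (T ^ _), ← Real.rpow_mul hm, ← Real.rpow_mul hT.le]
    congr 3 <;> ring_nf
  rw [hroot] at h ⊢
  have hTT : T ^ H * T ^ (1 / 2 - H) = T ^ (1 / 2 : ℝ) := by
    rw [← Real.rpow_add hT]; congr 1; ring
  rcases le_or_gt m (4 * K * T) with hm1 | hm1
  · -- few intervals: the bound by `v ^ 2` is used
    have hr1 : r ≤ 1 / (8 * K) * (T ^ (1 / 2 : ℝ) * v) := by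
      rw [hr, concentrationRadius]
      gcongr
      calc √(T * min (v ^ (1 + 2 * H)) (v ^ (2 : ℝ))) ≤ √(T * v ^ (2 : ℝ)) := by
            gcongr; exact min_le_right _ _
        _ = _ := by
          rw [Real.sqrt_mul hT.le, Real.rpow_two, Real.sqrt_sq hv.le, Real.sqrt_eq_rpow]
    have hm2 : m ^ (1 / 2 - H) ≤ 4 * K * T ^ (1 / 2 - H) := by
      calc m ^ (1 / 2 - H) ≤ (4 * K * T) ^ (1 / 2 - H) :=
            Real.rpow_le_rpow hm hm1 (by linarith)
        _ = (4 * K) ^ (1 / 2 - H) * T ^ (1 / 2 - H) := Real.mul_rpow (by positivity) hT.le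
        _ ≤ (4 * K) ^ (1 : ℝ) * T ^ (1 / 2 - H) := by
            gcongr
            · linarith
            · linarith
        _ = _ := by rw [Real.rpow_one]
    calc r * (√2 * (m ^ (1 / 2 - H) * T ^ H))
        ≤ (1 / (8 * K) * (T ^ (1 / 2 : ℝ) * v)) * (2 * ((4 * K * T ^ (1 / 2 - H)) * T ^ H)) := by
          gcongr
      _ = (T ^ (1 / 2 : ℝ) * (T ^ H * T ^ (1 / 2 - H))) * v := by field_simp; ring
      _ = T * v := by rw [hTT, ← Real.rpow_add hT]; norm_num
  · -- many intervals: the bound by `v ^ (1 + 2 * H)` shows that their number is at most `T * v`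
    have hm0 : 0 < m := lt_trans (by positivity) hm1
    have hr2 : r ≤ 1 / 8 * (T ^ (1 / 2 : ℝ) * v ^ (1 / 2 + H)) := by
      rw [hr, concentrationRadius]
      have h8 : 1 / (8 * K) ≤ 1 / 8 := by
        apply one_div_le_one_div_of_le <;> linarith
      refine mul_le_mul h8 ?_ (by positivity) (by norm_num)
      calc √(T * min (v ^ (1 + 2 * H)) (v ^ (2 : ℝ))) ≤ √(T * v ^ (1 + 2 * H)) := by
            gcongr; exact min_le_left _ _
        _ = _ := by
          rw [Real.sqrt_mul hT.le, Real.sqrt_eq_rpow, Real.sqrt_eq_rpow, ← Real.rpow_mul hv.le]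
          congr 2; ring
    have hrT : r * √2 * T ^ H ≤ 1 / 4 * (T * v) ^ (1 / 2 + H) := by
      calc r * √2 * T ^ H ≤ 1 / 8 * (T ^ (1 / 2 : ℝ) * v ^ (1 / 2 + H)) * 2 * T ^ H := by gcongr
        _ = 1 / 4 * ((T ^ (1 / 2 : ℝ) * T ^ H) * v ^ (1 / 2 + H)) := by ring
        _ = _ := by rw [← Real.rpow_add hT, ← Real.mul_rpow hT.le hv.le]
    have hmm : m = m ^ (1 / 2 + H) * m ^ (1 / 2 - H) := by
      rw [← Real.rpow_add hm0]; norm_num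
    have hmp : 0 < m ^ (1 / 2 - H) := Real.rpow_pos_of_pos hm0 _
    have hle : m ^ (1 / 2 + H) ≤ (T * v) ^ (1 / 2 + H) := by
      have h1 : m ≤ 4 * (r * √2 * T ^ H * m ^ (1 / 2 - H)) := by nlinarith
      have h2 : m ^ (1 / 2 + H) * m ^ (1 / 2 - H) ≤ 4 * (r * √2 * T ^ H) * m ^ (1 / 2 - H) := by
        rw [← hmm]; linarith
      have h3 := le_of_mul_le_mul_right h2 hmp
      linarith
    have hmTv : m ≤ T * v :=
      (Real.rpow_le_rpow_iff hm (by positivity) (by linarith)).1 hle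
    have hTv : (T * v) ^ (1 / 2 + H) * (T * v) ^ (1 / 2 - H) = T * v := by
      rw [← Real.rpow_add (by positivity)]; norm_num
    calc r * (√2 * (m ^ (1 / 2 - H) * T ^ H)) = r * √2 * T ^ H * m ^ (1 / 2 - H) := by ring
      _ ≤ 1 / 4 * (T * v) ^ (1 / 2 + H) * (T * v) ^ (1 / 2 - H) := by
          gcongr
      _ ≤ T * v := by
          rw [mul_assoc, hTv]
          have : 0 ≤ T * v := by positivity
          linarith

namespace IsFractionalBrownianMotion

variable {Ω : Type*} [MeasurableSpace Ω] {H : ℝ} {W : ℝ≥0 → Ω → ℝ} {P : Measure Ω}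

lemma measure_finset_chainSum_mul_le (hW : IsFractionalBrownianMotion H W P) (hH0 : 0 < H)
    (hH : H < 1 / 2) {T : ℝ≥0} (hT : 0 < T) {K v : ℝ} (hK : 1 ≤ K) (hv : 0 < v) {φ : ℝ → ℝ}
    (hφ : IsTruncation 1 φ) (F : Finset IntervalChain) (hF : ∀ κ ∈ F, κ ∈ weakChains T)
    {a b : ℝ} (hab : a + T * v ≤ b) {b₁ b₂ : ℝ≥0∞} (hb : min b₁ b₂ ≤ ENNReal.ofReal (K * T)) :
    P {ω | ∀ κ ∈ F, chainSum φ (fun t ↦ W t ω) κ ≤ a ∧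
        ENNReal.ofReal (chainSum (fun x ↦ |x| - 1 / 2) (fun t ↦ W t ω) κ) ≤ b₁} *
      P {ω | (∃ κ ∈ F, b < chainSum φ (fun t ↦ W t ω) κ) ∧
        ∀ κ ∈ F, ENNReal.ofReal (chainSum (fun x ↦ |x| - 1 / 2) (fun t ↦ W t ω) κ) ≤ b₂} ≤
    ENNReal.ofReal (Real.exp (-(concentrationRadius H K T v ^ 2 / 4))) := by
  classical
  set ψ : ℝ → ℝ := fun x ↦ |x| - 1 / 2 with hψ
  have hψc : Continuous ψ := (isTruncation_abs _).continuous
  set I : Finset ℝ≥0 :=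
    F.biUnion fun κ ↦ Finset.univ.image κ.2.1 ∪ Finset.univ.image κ.2.2 with hI
  have hmem : ∀ κ ∈ F, ∀ i, κ.2.1 i ∈ I ∧ κ.2.2 i ∈ I := by
    intro κ hκ i
    simp only [hI, Finset.mem_biUnion]
    exact ⟨⟨κ, hκ, by simp⟩, ⟨κ, hκ, by simp⟩⟩
  set ext : (I → ℝ) → ℝ≥0 → ℝ := fun x t ↦ if h : t ∈ I then x ⟨t, h⟩ else 0 with hext
  have hextm : ∀ t, Measurable fun x ↦ ext x t := by
    intro t
    by_cases h : t ∈ I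
    · simp only [hext, h, dif_pos]
      exact measurable_pi_apply _
    · simp only [hext, h]
      exact measurable_const
  have hcm : ∀ {χ : ℝ → ℝ}, Continuous χ → ∀ κ, Measurable fun x ↦ chainSum χ (ext x) κ :=
    fun hχ κ ↦ Finset.measurable_fun_sum _ fun i _ ↦
      (hχ.measurable.comp ((hextm _).sub (hextm _))).max measurable_const
  have hres : ∀ (χ : ℝ → ℝ) (κ) (_ : κ ∈ F) (ω),
      chainSum χ (ext (I.restrict (W · ω))) κ = chainSum χ (fun t ↦ W t ω) κ := by
    intro χ κ hκ ω
    refine Finset.sum_congr rfl fun i _ ↦ ?_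
    simp only [hext, hmem κ hκ i, dif_pos, Finset.restrict]
  set A : Set (I → ℝ) := {x | ∀ κ ∈ F, chainSum φ (ext x) κ ≤ a ∧
    ENNReal.ofReal (chainSum ψ (ext x) κ) ≤ b₁} with hA
  set B : Set (I → ℝ) := {x | (∃ κ ∈ F, b < chainSum φ (ext x) κ) ∧
    ∀ κ ∈ F, ENNReal.ofReal (chainSum ψ (ext x) κ) ≤ b₂} with hB
  have hAm : MeasurableSet A := by
    have : A = ⋂ κ ∈ F, ({x | chainSum φ (ext x) κ ≤ a} ∩
        {x | ENNReal.ofReal (chainSum ψ (ext x) κ) ≤ b₁}) := by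
      ext x; simp [hA]
    rw [this]
    exact F.measurableSet_biInter fun κ _ ↦
      (measurableSet_le (hcm hφ.continuous κ) measurable_const).inter
        (measurableSet_le (hcm hψc κ).ennreal_ofReal measurable_const)
  have hBm : MeasurableSet B := by
    have : B = (⋃ κ ∈ F, {x | b < chainSum φ (ext x) κ}) ∩
        ⋂ κ ∈ F, {x | ENNReal.ofReal (chainSum ψ (ext x) κ) ≤ b₂} := by
      ext x; simp [hB]
    rw [this]
    exact (F.measurableSet_biUnion fun κ _ ↦
      measurableSet_lt measurable_const (hcm hφ.continuous κ)).inter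
        (F.measurableSet_biInter fun κ _ ↦
          measurableSet_le (hcm hψc κ).ennreal_ofReal measurable_const)
  set r := concentrationRadius H K T v with hr
  have hr0 : 0 ≤ r := by rw [hr, concentrationRadius]; positivity
  have key := hW.isGaussianProcess.measure_mul_le hW.centered I hAm hBm hr0 (by
    rintro x hx y ⟨⟨κ, hκ, hby⟩, hy⟩ hℓ
    obtain ⟨m, hm1, hm2, hm3⟩ := exists_chainSum_le_add hφ (f := ext x) (g := ext y) (κ := κ)
      (G := fun m ↦ r * √(2 * ((m : ℝ) ^ (1 - 2 * H) * (T : ℝ) ^ (2 * H)))) (by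
        intro α J hα hαJ
        let ℓ : StrongDual ℝ (I → ℝ) := ∑ i, α i •
          ((ContinuousLinearMap.proj ⟨κ.2.2 i, (hmem κ hκ i).2⟩ : (I → ℝ) →L[ℝ] ℝ) -
            ContinuousLinearMap.proj ⟨κ.2.1 i, (hmem κ hκ i).1⟩)
        have hℓv : ∀ z : I → ℝ, ℓ z = ∑ i, α i * (ext z (κ.2.2 i) - ext z (κ.2.1 i)) := by
          intro z
          simp only [ℓ, sum_apply, smul_apply, sub_apply,
            ContinuousLinearMap.proj_apply, smul_eq_mul]
          refine Finset.sum_congr rfl fun i _ ↦ ?_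
          simp only [hext, hmem κ hκ i, dif_pos]
        have h1 := hℓ ℓ
        have h2 : (fun ω ↦ ℓ (I.restrict (W · ω))) =
            fun ω ↦ ∑ i, α i * (W (κ.2.2 i) ω - W (κ.2.1 i) ω) := by
          funext ω
          rw [hℓv]
          refine Finset.sum_congr rfl fun i _ ↦ ?_
          simp only [hext, hmem κ hκ i, dif_pos, Finset.restrict]
        rw [h2] at h1
        have h3 : ℓ (y - x) = ∑ i, α i * ((ext y (κ.2.2 i) - ext x (κ.2.2 i)) -
            (ext y (κ.2.1 i) - ext x (κ.2.1 i))) := by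
          rw [map_sub, hℓv, hℓv, ← Finset.sum_sub_distrib]
          exact Finset.sum_congr rfl fun i _ ↦ by ring
        rw [← h3]
        refine h1.trans ?_
        gcongr
        exact hW.variance_sum_increments_le hH0 hH (hF κ hκ).2 J hα hαJ)
    have hx' := hx κ hκ
    have hy' := hy κ hκ
    have hG0 : 0 ≤ r * √(2 * ((m : ℝ) ^ (1 - 2 * H) * (T : ℝ) ^ (2 * H))) := by positivity
    have hKT : 0 ≤ K * T := by positivity
    have hm4 : (m : ℝ) / 2 ≤ K * T + r * √(2 * ((m : ℝ) ^ (1 - 2 * H) * (T : ℝ) ^ (2 * H))) := by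
      rcases min_le_iff.1 hb with hb | hb
      · have := (ENNReal.ofReal_le_ofReal_iff hKT).1 (hx'.2.trans hb)
        linarith
      · have := (ENNReal.ofReal_le_ofReal_iff hKT).1 (hy'.trans hb)
        linarith
    have := mul_rpow_le_of_concentrationRadius hH0 hH hK (by exact_mod_cast hT) hv
      (Nat.cast_nonneg m) hm4
    linarith [hx'.1])
  refine le_trans (mul_le_mul' (measure_mono ?_) (measure_mono ?_)) key
  · intro ω hω κ hκ
    rw [hres φ κ hκ, hres ψ κ hκ]
    exact hω κ hκ
  · rintro ω ⟨⟨κ, hκ, h1⟩, h2⟩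
    refine ⟨⟨κ, hκ, ?_⟩, fun κ hκ ↦ ?_⟩
    · rw [hres φ κ hκ]; exact h1
    · rw [hres ψ κ hκ]; exact h2 κ hκ

/-- Concentration of a chain supremum `X` with truncation level `1`. The auxiliary variable `Y` has
truncation level `1 / 2`, and it has to be controlled on one of the two events only. -/
lemma measure_chainSup_mul_le (hW : IsFractionalBrownianMotion H W P) (hH0 : 0 < H)
    (hH : H < 1 / 2) {T : ℝ≥0} (hT : 0 < T) {C v : ℝ} (hC : 1 ≤ C) (hv : 0 < v) {φ : ℝ → ℝ}
    (hφ : IsTruncation 1 φ) {K : Set IntervalChain} (hK : K = weakChains T ∨ K = strictChains T)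
    {a b : ℝ} (ha : 0 ≤ a) (hab : a + T * v ≤ b) {b₁ b₂ : ℝ≥0∞}
    (hb : min b₁ b₂ ≤ ENNReal.ofReal (C * T)) :
    P {ω | chainSup φ K (fun t ↦ W t ω) ≤ ENNReal.ofReal a ∧
        chainSup (fun x ↦ |x| - 1 / 2) (weakChains T) (fun t ↦ W t ω) ≤ b₁} *
      P {ω | ENNReal.ofReal b < chainSup φ K (fun t ↦ W t ω) ∧
        chainSup (fun x ↦ |x| - 1 / 2) (weakChains T) (fun t ↦ W t ω) ≤ b₂} ≤
    ENNReal.ofReal (Real.exp (-(concentrationRadius H C T v ^ 2 / 4))) := by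
  classical
  have hb0 : 0 ≤ b := le_trans (by positivity) hab
  set D := dyadicChains T K with hD
  have hDK : D ⊆ K := fun _ h ↦ h.1
  have hKw : K ⊆ weakChains T := by
    rcases hK with rfl | rfl
    exacts [subset_rfl, strictChains_subset_weakChains T]
  rcases D.eq_empty_or_nonempty with hDe | hDn
  · have h0 : P {ω | ENNReal.ofReal b < chainSup φ K (fun t ↦ W t ω) ∧
        chainSup (fun x ↦ |x| - 1 / 2) (weakChains T) (fun t ↦ W t ω) ≤ b₂} = 0 := by
      rw [measure_eq_zero_iff_ae_notMem]
      filter_upwards [hW.continuous] with ω hω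
      rw [← chainSup_dyadicChains hT hK hφ.continuous hω, ← hD, hDe]
      simp [chainSup]
    rw [h0, mul_zero]
    exact zero_le
  obtain ⟨κ, hκ⟩ := (countable_dyadicChains T K).exists_eq_range hDn
  have hκD : ∀ n, κ n ∈ D := fun n ↦ by rw [hD, hκ]; exact ⟨n, rfl⟩
  set F : ℕ → Finset IntervalChain := fun N ↦ (Finset.range N).image κ with hF
  have hFD : ∀ N, ∀ k ∈ F N, k ∈ D := by
    intro N k hk
    obtain ⟨n, -, rfl⟩ := Finset.mem_image.1 hk
    exact hκD n
  set ψ : ℝ → ℝ := fun x ↦ |x| - 1 / 2 with hψ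
  set Y : Ω → ℝ≥0∞ := fun ω ↦ chainSup ψ (weakChains T) (fun t ↦ W t ω) with hY
  have hcont := hW.continuous
  -- exhaust the second event by the events which involve finitely many chains only
  set E : ℕ → Set Ω := fun N ↦
    {ω | (∃ k ∈ F N, b < chainSum φ (fun t ↦ W t ω) k) ∧ Y ω ≤ b₂} with hE
  have hEmono : Monotone E := by
    rintro N M hNM ω ⟨⟨k, hk, h1⟩, h2⟩
    refine ⟨⟨k, ?_, h1⟩, h2⟩
    exact Finset.image_subset_image (Finset.range_mono hNM) hk
  have hU : P {ω | ENNReal.ofReal b < chainSup φ K (fun t ↦ W t ω) ∧ Y ω ≤ b₂} ≤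
      P (⋃ N, E N) := by
    refine measure_mono_ae ?_
    filter_upwards [hcont] with ω hω hmem
    obtain ⟨h1, h2⟩ := hmem
    rw [← chainSup_dyadicChains hT hK hφ.continuous hω, chainSup, lt_iSup_iff] at h1
    obtain ⟨k, hk⟩ := h1
    rw [lt_iSup_iff] at hk
    obtain ⟨hkD, hk⟩ := hk
    have hkD' : k ∈ Set.range κ := hκ ▸ hkD
    obtain ⟨n, rfl⟩ := hkD'
    have hlt := (ENNReal.ofReal_lt_ofReal_iff_of_nonneg hb0).1 hk
    show ω ∈ ⋃ N, E N
    exact Set.mem_iUnion.2 ⟨n + 1, ⟨κ n, Finset.mem_image.2 ⟨n, by simp, rfl⟩, hlt⟩, h2⟩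
  refine (mul_le_mul_right hU _).trans ?_
  rw [hEmono.directed_le.measure_iUnion, ENNReal.mul_iSup]
  refine iSup_le fun N ↦ ?_
  refine le_trans (mul_le_mul' (measure_mono ?_) (measure_mono ?_))
    (hW.measure_finset_chainSum_mul_le hH0 hH hT hC hv hφ (F N)
      (fun k hk ↦ hKw (hDK (hFD N k hk))) hab hb)
  · rintro ω ⟨h1, h2⟩ k hk
    have hkK := hDK (hFD N k hk)
    exact ⟨(ENNReal.ofReal_le_ofReal_iff ha).1 ((le_chainSup hkK).trans h1),
      (le_chainSup (hKw hkK)).trans h2⟩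
  · rintro ω ⟨h1, h2⟩
    exact ⟨h1, fun k hk ↦ (le_chainSup (hKw (hDK (hFD N k hk)))).trans h2⟩

end IsFractionalBrownianMotion

/-! ### The expectation of chain suprema -/

/-- Chaining along the dyadic grid, for the values `F m j` of a path at the points `j / 2 ^ m`.
Rounding the end points of disjoint intervals of level `m + 1` inwards to level `m` costs at most
two increments of level `m + 1` per interval, and each such increment is used only once. So the
truncation level can be distributed over the levels. -/
lemma sum_dyadic_increments_le {F : ℕ → ℕ → ℝ} (hF : ∀ m j, F (m + 1) (2 * j) = F m j)
    {c : ℕ → ℝ} (hc : ∀ k, 0 ≤ c k) (m : ℕ) {ι : Type*} (J : Finset ι) (s t : ι → ℕ)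
    (hst : ∀ i ∈ J, s i < t i ∧ t i ≤ 2 ^ m)
    (hd : ∀ i ∈ J, ∀ j ∈ J, i ≠ j → t i ≤ s j ∨ t j ≤ s i) :
    ∑ i ∈ J, max (|F m (t i) - F m (s i)| - ∑ k ∈ Finset.range (m + 1), 2 * c k) 0 ≤
      ∑ k ∈ Finset.range (m + 1), ∑ j ∈ Finset.range (2 ^ k),
        max (|F k (j + 1) - F k j| - c k) 0 := by
  classical
  induction m generalizing J s t with
  | zero =>
    have h01 : ∀ i ∈ J, s i = 0 ∧ t i = 1 := fun i hi ↦ by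
      have := hst i hi
      simp only [pow_zero] at this
      omega
    have hcard : J.card ≤ 1 := by
      refine Finset.card_le_one.2 fun i hi j hj ↦ ?_
      by_contra hij
      have := hd i hi j hj hij
      have := h01 i hi
      have := h01 j hj
      omega
    have hle : ∀ i ∈ J, max (|F 0 (t i) - F 0 (s i)| - ∑ k ∈ Finset.range (0 + 1), 2 * c k) 0 ≤
        max (|F 0 1 - F 0 0| - c 0) 0 := fun i hi ↦ by
      rw [(h01 i hi).1, (h01 i hi).2]
      refine max_le_max_right _ ?_
      simp only [zero_add, Finset.range_one, Finset.sum_singleton]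
      linarith [hc 0]
    refine (Finset.sum_le_card_nsmul J _ _ hle).trans ?_
    simp only [zero_add, Finset.range_one, Finset.sum_singleton, pow_zero, nsmul_eq_mul]
    exact mul_le_of_le_one_left (le_max_right _ _) (by exact_mod_cast hcard)
  | succ m ih =>
    set e : ℕ → ℝ := fun j ↦ max (|F (m + 1) (j + 1) - F (m + 1) j| - c (m + 1)) 0 with he
    have he0 : ∀ j, 0 ≤ e j := fun j ↦ le_max_right _ _
    set θ := ∑ k ∈ Finset.range (m + 1), 2 * c k with hθ
    have hθ0 : 0 ≤ θ := Finset.sum_nonneg fun k _ ↦ by linarith [hc k]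
    rw [Finset.sum_range_succ _ (m + 1), Finset.sum_range_succ _ (m + 1), ← hθ]
    have hterm : ∀ i ∈ J, max (|F (m + 1) (t i) - F (m + 1) (s i)| - (θ + 2 * c (m + 1))) 0 ≤
        max (|F m (t i / 2) - F m ((s i + 1) / 2)| - θ) 0 +
          ((if t i % 2 = 1 then e (t i - 1) else 0) + if s i % 2 = 1 then e (s i) else 0) := by
      intro i hi
      have ht : |F (m + 1) (t i) - F m (t i / 2)| ≤
          c (m + 1) + if t i % 2 = 1 then e (t i - 1) else 0 := by
        rw [← hF m (t i / 2)]
        split_ifs with h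
        · have h1 : 2 * (t i / 2) = t i - 1 := by omega
          have h2 : t i = t i - 1 + 1 := by omega
          have h3 : |F (m + 1) (t i) - F (m + 1) (t i - 1)| - c (m + 1) ≤ e (t i - 1) := by
            rw [he]
            simp only
            rw [← h2]
            exact le_max_left _ _
          rw [h1]
          linarith
        · have h1 : 2 * (t i / 2) = t i := by omega
          rw [h1, sub_self, abs_zero, add_zero]
          exact hc _
      have hs : |F (m + 1) (s i) - F m ((s i + 1) / 2)| ≤
          c (m + 1) + if s i % 2 = 1 then e (s i) else 0 := by
        rw [← hF m ((s i + 1) / 2)]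
        split_ifs with h
        · have h1 : 2 * ((s i + 1) / 2) = s i + 1 := by omega
          have h3 : |F (m + 1) (s i + 1) - F (m + 1) (s i)| - c (m + 1) ≤ e (s i) :=
            le_max_left _ _
          rw [h1, abs_sub_comm]
          linarith
        · have h1 : 2 * ((s i + 1) / 2) = s i := by omega
          rw [h1, sub_self, abs_zero, add_zero]
          exact hc _
      have htri : |F (m + 1) (t i) - F (m + 1) (s i)| ≤
          |F (m + 1) (t i) - F m (t i / 2)| + |F m (t i / 2) - F m ((s i + 1) / 2)| +
            |F (m + 1) (s i) - F m ((s i + 1) / 2)| := by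
        have h1 := abs_sub_le (F (m + 1) (t i)) (F m (t i / 2)) (F (m + 1) (s i))
        have h2 := abs_sub_le (F m (t i / 2)) (F m ((s i + 1) / 2)) (F (m + 1) (s i))
        rw [abs_sub_comm (F m ((s i + 1) / 2))] at h2
        linarith
      have h4 := le_max_left (|F m (t i / 2) - F m ((s i + 1) / 2)| - θ) 0
      have h5 := le_max_right (|F m (t i / 2) - F m ((s i + 1) / 2)| - θ) 0
      refine max_le (by linarith) ?_
      have h6 : 0 ≤ if t i % 2 = 1 then e (t i - 1) else 0 := by
        split_ifs
        exacts [he0 _, le_rfl]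
      have h7 : 0 ≤ if s i % 2 = 1 then e (s i) else 0 := by
        split_ifs
        exacts [he0 _, le_rfl]
      positivity
    refine (Finset.sum_le_sum hterm).trans ?_
    rw [Finset.sum_add_distrib]
    refine add_le_add ?_ ?_
    · set J' := J.filter fun i ↦ (s i + 1) / 2 < t i / 2 with hJ'
      have hzero : ∀ i ∈ J, i ∉ J' →
          max (|F m (t i / 2) - F m ((s i + 1) / 2)| - θ) 0 = 0 := by
        intro i hi hi'
        have h1 : ¬(s i + 1) / 2 < t i / 2 := fun h ↦ hi' (Finset.mem_filter.2 ⟨hi, h⟩)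
        have h2 := (hst i hi).1
        have h3 : (s i + 1) / 2 = t i / 2 := by omega
        rw [h3, sub_self, abs_zero, zero_sub]
        exact max_eq_right (by linarith)
      rw [← Finset.sum_subset (Finset.filter_subset _ J) hzero]
      refine ih J' (fun i ↦ (s i + 1) / 2) (fun i ↦ t i / 2) (fun i hi ↦ ?_)
        fun i hi j hj hij ↦ ?_
      · have h1 := Finset.mem_filter.1 hi
        have h2 := (hst i h1.1).2
        rw [pow_succ] at h2
        exact ⟨h1.2, by omega⟩
      · have := hd i (Finset.mem_filter.1 hi).1 j (Finset.mem_filter.1 hj).1 hij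
        omega
    · rw [Finset.sum_add_distrib, ← Finset.sum_filter, ← Finset.sum_filter]
      have hinj : ∀ i ∈ J, ∀ j ∈ J, (s i = s j ∨ t i = t j) → i = j := by
        intro i hi j hj h
        by_contra hij
        have := hd i hi j hj hij
        have := hst i hi
        have := hst j hj
        omega
      rw [← Finset.sum_image (s := J.filter fun i ↦ t i % 2 = 1) (g := fun i ↦ t i - 1) (f := e) ?_,
        ← Finset.sum_image (s := J.filter fun i ↦ s i % 2 = 1) (g := s) (f := e) ?_,
        ← Finset.sum_union]
      · refine Finset.sum_le_sum_of_subset_of_nonneg ?_ fun j _ _ ↦ he0 j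
        intro j hj
        rw [Finset.mem_range]
        rcases Finset.mem_union.1 hj with hj | hj
        · obtain ⟨i, hi, rfl⟩ := Finset.mem_image.1 hj
          have := hst i (Finset.mem_filter.1 hi).1
          omega
        · obtain ⟨i, hi, rfl⟩ := Finset.mem_image.1 hj
          have := hst i (Finset.mem_filter.1 hi).1
          omega
      · rw [Finset.disjoint_left]
        intro j hj hj'
        obtain ⟨i, hi, rfl⟩ := Finset.mem_image.1 hj
        obtain ⟨i', hi', h⟩ := Finset.mem_image.1 hj'
        have := (Finset.mem_filter.1 hi).2
        have := (Finset.mem_filter.1 hi').2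
        omega
      · intro i hi j hj hij
        exact hinj i (Finset.mem_filter.1 hi).1 j (Finset.mem_filter.1 hj).1 (.inl hij)
      · intro i hi j hj hij
        have h1 := (Finset.mem_filter.1 hi).2
        have h2 := (Finset.mem_filter.1 hj).2
        have h3 : t i - 1 = t j - 1 := hij
        exact hinj i (Finset.mem_filter.1 hi).1 j (Finset.mem_filter.1 hj).1 (.inr (by omega))

lemma eventually_exists_eq_of_mem_dyadicFractions {T x : ℝ≥0} (hx : x ∈ dyadicFractions T) :
    ∀ᶠ m : ℕ in Filter.atTop, ∃ j : ℕ, x = T * (j / 2 ^ m) := by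
  obtain ⟨⟨p, q⟩, rfl⟩ := hx
  filter_upwards [Filter.eventually_ge_atTop q] with m hm
  obtain ⟨d, rfl⟩ := Nat.exists_eq_add_of_le hm
  refine ⟨p * 2 ^ d, ?_⟩
  push_cast
  rw [pow_add]
  field_simp

lemma chainSum_le_sum_dyadic_increments {T : ℝ≥0} (hT : 0 < T) (f : ℝ≥0 → ℝ) {c : ℕ → ℝ}
    (hc : ∀ k, 0 ≤ c k) {θ : ℝ} (hθ : ∀ m, ∑ k ∈ Finset.range m, 2 * c k ≤ θ) {κ : IntervalChain}
    (hκ : κ ∈ dyadicChains T (weakChains T)) :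
    ENNReal.ofReal (chainSum (fun x ↦ |x| - θ) f κ) ≤ ∑' k : ℕ, ∑ j ∈ Finset.range (2 ^ k),
      ENNReal.ofReal (|f (T * ((j + 1 : ℕ) / 2 ^ k)) - f (T * ((j : ℕ) / 2 ^ k))| - c k) := by
  obtain ⟨n, s, t⟩ := κ
  obtain ⟨⟨-, hw⟩, hD⟩ := hκ
  change IsWeakChain 0 T s t at hw
  have hev : ∀ᶠ m : ℕ in Filter.atTop, ∀ i,
      (∃ j : ℕ, s i = T * (j / 2 ^ m)) ∧ ∃ j : ℕ, t i = T * (j / 2 ^ m) := by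
    rw [Filter.eventually_all]
    exact fun i ↦ (eventually_exists_eq_of_mem_dyadicFractions (hD i).1).and
      (eventually_exists_eq_of_mem_dyadicFractions (hD i).2)
  obtain ⟨m, hm⟩ := hev.exists
  choose s' hs' using fun i ↦ (hm i).1
  choose t' ht' using fun i ↦ (hm i).2
  have hle : ∀ p q : ℕ, T * (p / 2 ^ m) ≤ T * (q / 2 ^ m) ↔ p ≤ q := by
    intro p q
    rw [mul_le_mul_iff_right₀ hT, div_le_div_iff_of_pos_right (by positivity), Nat.cast_le]
  have hlt : ∀ p q : ℕ, T * (p / 2 ^ m) < T * (q / 2 ^ m) ↔ p < q := by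
    intro p q
    rw [← not_le, hle, not_le]
  have hTm : T = T * ((2 ^ m : ℕ) / 2 ^ m) := by
    push_cast
    rw [div_self (by positivity), mul_one]
  have key := sum_dyadic_increments_le (F := fun m j ↦ f (T * ((j : ℕ) / 2 ^ m))) (fun m j ↦ by
      congr 2
      push_cast
      rw [pow_succ]
      field_simp) hc m Finset.univ s' t' (fun i _ ↦ by
      have h1 := (hw.1 i).2
      rw [hs' i, ht' i, hlt] at h1
      exact ⟨h1.1, (hle _ _).1 (h1.2.trans_eq hTm)⟩) (fun i _ j _ hij ↦ by
      have h2 : ∀ i j, i < j → t' i ≤ s' j := fun i j hij ↦ by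
        have := hw.2 i j hij
        rwa [ht' i, hs' j, hle] at this
      rcases lt_or_gt_of_ne hij with h | h
      · exact .inl (h2 i j h)
      · exact .inr (h2 j i h))
  calc ENNReal.ofReal (chainSum (fun x ↦ |x| - θ) f ⟨n, s, t⟩)
      ≤ ENNReal.ofReal (∑ k ∈ Finset.range (m + 1), ∑ j ∈ Finset.range (2 ^ k),
        max (|f (T * ((j + 1 : ℕ) / 2 ^ k)) - f (T * ((j : ℕ) / 2 ^ k))| - c k) 0) := by
        refine ENNReal.ofReal_le_ofReal (le_trans ?_ key)
        refine Finset.sum_le_sum fun i _ ↦ max_le_max_right _ ?_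
        simp only [← hs', ← ht']
        linarith [hθ (m + 1)]
    _ = ∑ k ∈ Finset.range (m + 1), ∑ j ∈ Finset.range (2 ^ k),
        ENNReal.ofReal (|f (T * ((j + 1 : ℕ) / 2 ^ k)) - f (T * ((j : ℕ) / 2 ^ k))| - c k) := by
        rw [ENNReal.ofReal_sum_of_nonneg fun k _ ↦ Finset.sum_nonneg fun j _ ↦ le_max_right _ _]
        refine Finset.sum_congr rfl fun k _ ↦ ?_
        rw [ENNReal.ofReal_sum_of_nonneg fun j _ ↦ le_max_right _ _]
        refine Finset.sum_congr rfl fun j _ ↦ ?_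
        rw [ENNReal.ofReal_max]
        simp
    _ ≤ _ := ENNReal.sum_le_tsum _

lemma sum_rpow_of_le_one_le {T α : ℝ} (hT : 0 < T) (hα : 0 < α) (n : ℕ) :
    ∑ k ∈ Finset.range n, (if T / 2 ^ k ≤ 1 then (T / 2 ^ k) ^ α else 0) ≤
      (1 - 2 ^ (-α) : ℝ)⁻¹ := by
  have hq : (2 : ℝ) ^ (-α) < 1 := Real.rpow_lt_one_of_one_lt_of_neg (by norm_num) (by linarith)
  have hq' : 0 < (1 - 2 ^ (-α) : ℝ) := by linarith
  set h : ℕ → ℝ := fun k ↦ min (T / 2 ^ k) 1 ^ α with hh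
  have hanti : ∀ k, h (k + 1) ≤ h k := by
    intro k
    refine Real.rpow_le_rpow (by positivity) (min_le_min_right _ ?_) hα.le
    gcongr
    · norm_num
    · omega
  have hterm : ∀ k, (1 - 2 ^ (-α) : ℝ) * (if T / 2 ^ k ≤ 1 then (T / 2 ^ k) ^ α else 0) ≤
      h k - h (k + 1) := by
    intro k
    split_ifs with hk
    · have e : T / 2 ^ (k + 1) = T / 2 ^ k * 2⁻¹ := by rw [pow_succ]; field_simp
      have h1 : T / 2 ^ (k + 1) ≤ 1 := by
        rw [e]
        linarith [show 0 < T / 2 ^ k by positivity]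
      simp only [hh, min_eq_left hk, min_eq_left h1]
      rw [e, Real.mul_rpow (by positivity) (by norm_num), Real.inv_rpow (by norm_num),
        ← Real.rpow_neg (by norm_num)]
      linarith
    · rw [mul_zero]
      linarith [hanti k]
  have hsum := Finset.sum_le_sum fun k (_ : k ∈ Finset.range n) ↦ hterm k
  rw [← Finset.mul_sum, Finset.sum_range_sub'] at hsum
  have h0 : h 0 ≤ 1 := Real.rpow_le_one (by positivity) (min_le_right _ _) hα.le
  have hn : 0 ≤ h n := by positivity
  rw [← one_div, le_div_iff₀ hq']
  linarith

lemma sum_rpow_neg_of_one_lt_le {T α : ℝ} (hT : 0 < T) (hα : 0 < α) (n : ℕ) :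
    ∑ k ∈ Finset.range n, (if 1 < T / 2 ^ k then (T / 2 ^ k) ^ (-α) else 0) ≤
      2 ^ α * (2 ^ α - 1 : ℝ)⁻¹ := by
  have hq : 1 < (2 : ℝ) ^ α := Real.one_lt_rpow (by norm_num) hα
  have hq' : 0 < (2 ^ α - 1 : ℝ) := by linarith
  set h : ℕ → ℝ := fun k ↦ max (T / 2 ^ k) 2⁻¹ ^ (-α) with hh
  have hmono : ∀ k, h k ≤ h (k + 1) := by
    intro k
    refine Real.rpow_le_rpow_of_nonpos (by positivity) (max_le_max_right _ ?_) (by linarith)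
    gcongr
    · norm_num
    · omega
  have hterm : ∀ k, (2 ^ α - 1 : ℝ) * (if 1 < T / 2 ^ k then (T / 2 ^ k) ^ (-α) else 0) ≤
      h (k + 1) - h k := by
    intro k
    split_ifs with hk
    · have e : T / 2 ^ (k + 1) = T / 2 ^ k * 2⁻¹ := by rw [pow_succ]; field_simp
      have h1 : 2⁻¹ ≤ T / 2 ^ (k + 1) := by
        rw [e]
        linarith
      have h2 : (2⁻¹ : ℝ) ≤ T / 2 ^ k := by linarith
      simp only [hh, max_eq_left h1, max_eq_left h2]
      rw [e, Real.mul_rpow (by positivity) (by norm_num), Real.inv_rpow (by norm_num),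
        ← Real.rpow_neg (by norm_num), neg_neg]
      linarith
    · rw [mul_zero]
      linarith [hmono k]
  have hsum := Finset.sum_le_sum fun k (_ : k ∈ Finset.range n) ↦ hterm k
  rw [← Finset.mul_sum, Finset.sum_range_sub] at hsum
  have h0 : h n ≤ 2 ^ α := by
    calc h n ≤ (2⁻¹ : ℝ) ^ (-α) :=
          Real.rpow_le_rpow_of_nonpos (by positivity) (le_max_right _ _) (by linarith)
      _ = 2 ^ α := by
          rw [Real.inv_rpow (by norm_num), ← Real.rpow_neg (by norm_num), neg_neg]
  have hn : 0 ≤ h 0 := by positivity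
  rw [← div_eq_mul_inv, le_div_iff₀ hq']
  linarith

/-- The part of the truncation level `1 / 2` which is spent on dyadic increments over a time
`ℓ`. Long increments are not truncated at all, as there are few of them. -/
noncomputable def truncationShare (H ℓ : ℝ) : ℝ :=
  if ℓ ≤ 1 then (1 - 2 ^ (-(H / 2))) / 4 * ℓ ^ (H / 2) else 0

lemma truncationShare_nonneg {H ℓ : ℝ} (hH0 : 0 < H) (hℓ : 0 ≤ ℓ) : 0 ≤ truncationShare H ℓ := by
  have hq : (2 : ℝ) ^ (-(H / 2)) < 1 :=
    Real.rpow_lt_one_of_one_lt_of_neg (by norm_num) (by linarith)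
  rw [truncationShare]
  split_ifs
  · have : 0 ≤ (1 - 2 ^ (-(H / 2)) : ℝ) / 4 := by linarith
    positivity
  · exact le_rfl

lemma sum_truncationShare_le {H T : ℝ} (hH0 : 0 < H) (hT : 0 < T) (m : ℕ) :
    ∑ k ∈ Finset.range m, 2 * truncationShare H (T / 2 ^ k) ≤ 1 / 2 := by
  have hq : (2 : ℝ) ^ (-(H / 2)) < 1 :=
    Real.rpow_lt_one_of_one_lt_of_neg (by norm_num) (by linarith)
  have h1 : 0 < (1 - 2 ^ (-(H / 2)) : ℝ) := by linarith
  have h := sum_rpow_of_le_one_le hT (half_pos hH0) m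
  calc ∑ k ∈ Finset.range m, 2 * truncationShare H (T / 2 ^ k) =
      (1 - 2 ^ (-(H / 2))) / 2 *
        ∑ k ∈ Finset.range m, (if T / 2 ^ k ≤ 1 then (T / 2 ^ k) ^ (H / 2) else 0) := by
        rw [Finset.mul_sum]
        refine Finset.sum_congr rfl fun k _ ↦ ?_
        rw [truncationShare]
        split_ifs <;> ring
    _ ≤ (1 - 2 ^ (-(H / 2))) / 2 * (1 - 2 ^ (-(H / 2)) : ℝ)⁻¹ := by gcongr
    _ = 1 / 2 := by field_simp

/-- Markov's inequality with a high moment `p` for short times and with the first moment for long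
times. The bound is multiplied by the number of increments later, so the powers `2` and `H` of the
time matter: one is larger than `1` and the other is smaller. -/
lemma exists_lintegral_gaussian_sub_truncationShare_le {H : ℝ} (hH0 : 0 < H) :
    ∃ C : ℝ, 0 ≤ C ∧ ∀ ℓ : ℝ, 0 < ℓ →
      ∫⁻ x, ENNReal.ofReal (|ℓ ^ H * x| - truncationShare H ℓ) ∂gaussianReal 0 1 ≤
        ENNReal.ofReal (C * if ℓ ≤ 1 then ℓ ^ 2 else ℓ ^ H) := by
  obtain ⟨p, hp⟩ := exists_nat_ge (4 / H)
  have hpH : 4 ≤ p * H := by rwa [div_le_iff₀ hH0] at hp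
  have hmom : ∀ q : ℕ, Integrable (fun x : ℝ ↦ |x| ^ q) (gaussianReal 0 1) := fun q ↦ by
    have h := (memLp_id_gaussianReal (μ := 0) (v := 1) (q : ℝ≥0))
    have h2 : MemLp id (q : ℝ≥0∞) (gaussianReal 0 1) := by exact_mod_cast h
    have := h2.integrable_norm_pow'
    simpa using this
  set M : ℕ → ℝ := fun q ↦ ∫ x, |x| ^ q ∂gaussianReal 0 1 with hM
  have hM0 : ∀ q, 0 ≤ M q := fun q ↦ integral_nonneg fun x ↦ by positivity
  have hlin : ∀ q : ℕ, ∫⁻ x, ENNReal.ofReal (|x| ^ q) ∂gaussianReal 0 1 = ENNReal.ofReal (M q) :=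
    fun q ↦ (ofReal_integral_eq_lintegral_ofReal (hmom q)
      (.of_forall fun x ↦ by positivity)).symm
  have hq : (2 : ℝ) ^ (-(H / 2)) < 1 :=
    Real.rpow_lt_one_of_one_lt_of_neg (by norm_num) (by linarith)
  set a : ℝ := (1 - 2 ^ (-(H / 2))) / 4 with ha
  have ha0 : 0 < a := by rw [ha]; linarith
  have hcint : ∀ (D : ℝ) (q : ℕ), 0 ≤ D →
      ∫⁻ x, ENNReal.ofReal (D * |x| ^ q) ∂gaussianReal 0 1 = ENNReal.ofReal (D * M q) := by
    intro D q hD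
    simp_rw [ENNReal.ofReal_mul hD]
    rw [lintegral_const_mul' _ _ ENNReal.ofReal_ne_top, hlin]
  refine ⟨a / a ^ p * M p + M 1, by have := hM0 p; have := hM0 1; positivity, fun ℓ hℓ ↦ ?_⟩
  have hℓH : 0 < ℓ ^ H := Real.rpow_pos_of_pos hℓ _
  rw [truncationShare]
  split_ifs with h1
  · set c := a * ℓ ^ (H / 2) with hc
    have hc0 : 0 < c := by positivity
    -- `y - c ≤ c (y / c) ^ p` for `y ≥ 0`
    have hpt : ∀ x : ℝ, |ℓ ^ H * x| - c ≤ c / c ^ p * (ℓ ^ H) ^ p * |x| ^ p := by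
      intro x
      rw [abs_mul, abs_of_pos hℓH]
      have hy : 0 ≤ ℓ ^ H * |x| := by positivity
      have e : c / c ^ p * (ℓ ^ H) ^ p * |x| ^ p = c * (ℓ ^ H * |x| / c) ^ p := by
        rw [div_pow, mul_pow]
        ring
      rw [e]
      rcases le_or_gt (ℓ ^ H * |x|) c with hle | hgt
      · have : 0 ≤ c * (ℓ ^ H * |x| / c) ^ p := by positivity
        linarith
      · have h2 : 1 ≤ ℓ ^ H * |x| / c := by rw [le_div_iff₀ hc0]; linarith
        have hp0 : p ≠ 0 := by
          rintro rfl
          simp at hpH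
          linarith
        have h3 := le_self_pow₀ h2 hp0
        have h4 : c * (ℓ ^ H * |x| / c) = ℓ ^ H * |x| := by field_simp
        have h5 := mul_le_mul_of_nonneg_left h3 hc0.le
        linarith
    have hD : c / c ^ p * (ℓ ^ H) ^ p ≤ a / a ^ p * ℓ ^ 2 := by
      have e : c / c ^ p * (ℓ ^ H) ^ p = a / a ^ p * (ℓ ^ (H / 2) * (ℓ ^ (H / 2)) ^ p) := by
        have : ℓ ^ H = ℓ ^ (H / 2) * ℓ ^ (H / 2) := by
          rw [← Real.rpow_add hℓ]; congr 1; ring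
        rw [hc, this, mul_pow, mul_pow]
        field_simp
      rw [e]
      refine mul_le_mul_of_nonneg_left ?_ (by positivity)
      rw [← Real.rpow_natCast, ← Real.rpow_mul hℓ.le, ← Real.rpow_add hℓ, ← Real.rpow_two]
      exact Real.rpow_le_rpow_of_exponent_ge hℓ h1 (by nlinarith)
    calc ∫⁻ x, ENNReal.ofReal (|ℓ ^ H * x| - c) ∂gaussianReal 0 1
        ≤ ∫⁻ x, ENNReal.ofReal (c / c ^ p * (ℓ ^ H) ^ p * |x| ^ p) ∂gaussianReal 0 1 :=
          lintegral_mono fun x ↦ ENNReal.ofReal_le_ofReal (hpt x)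
      _ = ENNReal.ofReal (c / c ^ p * (ℓ ^ H) ^ p * M p) := hcint _ _ (by positivity)
      _ ≤ _ := by
          refine ENNReal.ofReal_le_ofReal ?_
          have := mul_le_mul_of_nonneg_right hD (hM0 p)
          have := mul_nonneg (hM0 1) (sq_nonneg ℓ)
          linarith
  · calc ∫⁻ x, ENNReal.ofReal (|ℓ ^ H * x| - 0) ∂gaussianReal 0 1
        = ∫⁻ x, ENNReal.ofReal (ℓ ^ H * |x| ^ 1) ∂gaussianReal 0 1 := by
          refine lintegral_congr fun x ↦ ?_
          rw [abs_mul, abs_of_pos hℓH, sub_zero, pow_one]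
      _ = ENNReal.ofReal (ℓ ^ H * M 1) := hcint _ _ hℓH.le
      _ ≤ _ := by
          refine ENNReal.ofReal_le_ofReal ?_
          have := hM0 p
          have : 0 ≤ a / a ^ p * M p * ℓ ^ H := by positivity
          linarith

namespace IsFractionalBrownianMotion

variable {Ω : Type*} [MeasurableSpace Ω] {H : ℝ} {W : ℝ≥0 → Ω → ℝ} {P : Measure Ω}

lemma integrable (hW : IsFractionalBrownianMotion H W P) (t : ℝ≥0) : Integrable (W t) P :=
  (hW.isGaussianProcess.hasGaussianLaw_eval t).integrable

lemma map_increment (hW : IsFractionalBrownianMotion H W P) (hH0 : 0 < H) {s t : ℝ≥0}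
    (hst : s ≤ t) :
    P.map (fun ω ↦ W t ω - W s ω) =
      (gaussianReal 0 1).map fun x ↦ ((t : ℝ) - s) ^ H * x := by
  have hd : 0 ≤ (t : ℝ) - s := sub_nonneg.2 (by exact_mod_cast hst)
  rw [hW.isGaussianProcess.hasGaussianLaw_fun_sub.map_eq_gaussianReal,
    integral_sub (hW.integrable t) (hW.integrable s), hW.centered, hW.centered, sub_zero,
    hW.variance_increment hH0 hst, gaussianReal_map_const_mul, mul_zero, mul_one]
  congr 1
  ext
  rw [Real.coe_toNNReal _ (Real.rpow_nonneg hd _), NNReal.coe_mk, ← Real.rpow_natCast,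
    ← Real.rpow_mul hd]
  congr 1
  push_cast
  ring

end IsFractionalBrownianMotion

/-- The expectation of a chain supremum with truncation level `1 / 2` grows at most linearly in the
length of the time interval. -/
lemma exists_lintegral_chainSup_le {H : ℝ} (hH0 : 0 < H) (hH : H < 1 / 2) :
    ∃ C : ℝ, 1 ≤ C ∧ ∀ (Ω : Type*) [MeasurableSpace Ω] (P : Measure Ω) (W : ℝ≥0 → Ω → ℝ),
      IsFractionalBrownianMotion H W P → ∀ T : ℝ≥0, 0 < T →
      ∫⁻ ω, chainSup (fun x ↦ |x| - 1 / 2) (weakChains T) (fun t ↦ W t ω) ∂P ≤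
        ENNReal.ofReal (C * T) := by
  obtain ⟨C, hC0, hC⟩ := exists_lintegral_gaussian_sub_truncationShare_le hH0
  set C₁ : ℝ := (1 - 2 ^ (-1 : ℝ))⁻¹ with hC₁
  set C₂ : ℝ := 2 ^ (1 - H) * (2 ^ (1 - H) - 1)⁻¹ with hC₂
  have hC₁0 : 0 ≤ C₁ := by rw [hC₁]; norm_num
  have hC₂0 : 0 ≤ C₂ := by
    have : 1 < (2 : ℝ) ^ (1 - H) := Real.one_lt_rpow (by norm_num) (by linarith)
    have : 0 ≤ ((2 : ℝ) ^ (1 - H) - 1)⁻¹ := inv_nonneg.2 (by linarith)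
    positivity
  refine ⟨C * (C₁ + C₂) + 1, by linarith [mul_nonneg hC0 (add_nonneg hC₁0 hC₂0)],
    fun Ω _ P W hW T hT ↦ ?_⟩
  have hT' : (0 : ℝ) < T := by exact_mod_cast hT
  set c : ℕ → ℝ := fun k ↦ truncationShare H (T / 2 ^ k) with hc
  have hcn : ∀ k, 0 ≤ c k := fun k ↦ truncationShare_nonneg hH0 (by positivity)
  set X : ℕ → ℕ → Ω → ℝ := fun k j ω ↦
    W (T * ((j + 1 : ℕ) / 2 ^ k)) ω - W (T * ((j : ℕ) / 2 ^ k)) ω with hX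
  have hXm : ∀ k j, AEMeasurable (X k j) P := fun k j ↦
    (hW.integrable _).aemeasurable.sub (hW.integrable _).aemeasurable
  have hm : ∀ k j, AEMeasurable (fun ω ↦ ENNReal.ofReal (|X k j ω| - c k)) P := fun k j ↦ by
    have := (hXm k j)
    fun_prop
  have hE : ∀ k j, ∫⁻ ω, ENNReal.ofReal (|X k j ω| - c k) ∂P ≤
      ENNReal.ofReal (C * if (T / 2 ^ k : ℝ) ≤ 1 then (T / 2 ^ k : ℝ) ^ 2
        else (T / 2 ^ k : ℝ) ^ H) := by
    intro k j
    have hg : Measurable fun x : ℝ ↦ ENNReal.ofReal (|x| - c k) := by fun_prop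
    have hle : T * ((j : ℕ) / 2 ^ k) ≤ T * ((j + 1 : ℕ) / 2 ^ k) := by gcongr; omega
    have hlen : ((T * ((j + 1 : ℕ) / 2 ^ k) : ℝ≥0) : ℝ) - (T * ((j : ℕ) / 2 ^ k) : ℝ≥0) =
        T / 2 ^ k := by
      push_cast
      ring
    calc ∫⁻ ω, ENNReal.ofReal (|X k j ω| - c k) ∂P
        = ∫⁻ x, ENNReal.ofReal (|x| - c k) ∂P.map (X k j) := (lintegral_map' hg.aemeasurable
          (hXm k j)).symm
      _ = ∫⁻ x, ENNReal.ofReal (|(T / 2 ^ k : ℝ) ^ H * x| - c k) ∂gaussianReal 0 1 := by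
        rw [hX, hW.map_increment hH0 hle, hlen, lintegral_map hg (by fun_prop)]
      _ ≤ _ := hC _ (by positivity)
  have hpath : ∀ᵐ ω ∂P, chainSup (fun x ↦ |x| - 1 / 2) (weakChains T) (fun t ↦ W t ω) ≤
      ∑' k : ℕ, ∑ j ∈ Finset.range (2 ^ k), ENNReal.ofReal (|X k j ω| - c k) := by
    filter_upwards [hW.continuous] with ω hω
    rw [← chainSup_dyadicChains hT (.inl rfl) (isTruncation_abs _).continuous hω, chainSup_le_iff]
    exact fun κ hκ ↦ chainSum_le_sum_dyadic_increments hT (fun t ↦ W t ω) hcn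
      (sum_truncationShare_le hH0 hT') hκ
  refine (lintegral_mono_ae hpath).trans ?_
  rw [lintegral_tsum fun k ↦ Finset.aemeasurable_fun_sum _ fun j _ ↦ hm k j]
  refine ENNReal.tsum_le_of_sum_range_le fun n ↦ ?_
  set u : ℕ → ℝ := fun k ↦
    if (T / 2 ^ k : ℝ) ≤ 1 then (T / 2 ^ k : ℝ) ^ 2 else (T / 2 ^ k : ℝ) ^ H with hu
  have hu0 : ∀ k, 0 ≤ u k := fun k ↦ by
    simp only [hu]
    split_ifs <;> positivity
  calc ∑ k ∈ Finset.range n,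
        ∫⁻ ω, ∑ j ∈ Finset.range (2 ^ k), ENNReal.ofReal (|X k j ω| - c k) ∂P
      ≤ ∑ k ∈ Finset.range n, ENNReal.ofReal (2 ^ k * (C * u k)) := by
        refine Finset.sum_le_sum fun k _ ↦ ?_
        rw [lintegral_finsetSum' _ fun j _ ↦ hm k j]
        refine (Finset.sum_le_sum fun j _ ↦ hE k j).trans ?_
        rw [Finset.sum_const, Finset.card_range, nsmul_eq_mul, ENNReal.ofReal_mul (p := 2 ^ k) (by positivity),
          ENNReal.ofReal_pow (by norm_num)]
        simp [hu]
    _ = ENNReal.ofReal (∑ k ∈ Finset.range n, 2 ^ k * (C * u k)) :=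
        (ENNReal.ofReal_sum_of_nonneg fun k _ ↦ by have := hu0 k; positivity).symm
    _ ≤ _ := by
        refine ENNReal.ofReal_le_ofReal ?_
        have h1 := sum_rpow_of_le_one_le hT' one_pos n
        have h2 := sum_rpow_neg_of_one_lt_le hT' (by linarith : 0 < 1 - H) n
        have hterm : ∀ k, 2 ^ k * (C * u k) =
            C * T * ((if (T / 2 ^ k : ℝ) ≤ 1 then (T / 2 ^ k : ℝ) ^ (1 : ℝ) else 0) +
              if 1 < (T / 2 ^ k : ℝ) then (T / 2 ^ k : ℝ) ^ (-(1 - H)) else 0) := by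
          intro k
          have hl : (0 : ℝ) < T / 2 ^ k := by positivity
          have hTl : (T : ℝ) = 2 ^ k * (T / 2 ^ k) := by field_simp
          simp only [hu]
          generalize (T / 2 ^ k : ℝ) = l at hl hTl ⊢
          rw [hTl]
          by_cases h : l ≤ 1
          · rw [if_pos h, if_pos h, if_neg (not_lt.2 h), Real.rpow_one]
            ring
          · rw [if_neg h, if_neg h, if_pos (not_le.1 h)]
            have : l ^ H = l * l ^ (-(1 - H)) := by
              nth_rewrite 2 [← Real.rpow_one l]
              rw [← Real.rpow_add hl]
              congr 1
              ring
            rw [this]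
            ring
        rw [Finset.sum_congr rfl fun k _ ↦ hterm k, ← Finset.mul_sum, Finset.sum_add_distrib]
        have h3 := mul_le_mul_of_nonneg_left (add_le_add h1 h2) (mul_nonneg hC0 hT'.le)
        refine h3.trans ?_
        rw [← hC₁, ← hC₂]
        nlinarith

/-! ### From the median to the mean -/

lemma exists_median (μ : Measure ℝ) [IsProbabilityMeasure μ] :
    ∃ m : ℝ, 1 / 2 ≤ μ (Set.Iic m) ∧ 1 / 2 ≤ μ (Set.Ici m) := by
  have hhalf : (1 / 2 : ℝ≥0∞) < 1 := by
    rw [one_div]; exact ENNReal.one_half_lt_one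
  set S : Set ℝ := {x | 1 / 2 ≤ μ (Set.Iic x)} with hS
  have hne : S.Nonempty := by
    have h := tendsto_measure_Iic_atTop μ
    rw [measure_univ] at h
    obtain ⟨x, hx⟩ := (h.eventually_const_lt hhalf).exists
    exact ⟨x, hx.le⟩
  have hbd : BddBelow S := by
    obtain ⟨x, hx⟩ := ((tendsto_cdf_atBot μ).eventually_lt_const one_half_pos).exists
    replace hx : μ (Set.Iic x) < 1 / 2 := by
      rw [← ofReal_cdf, ENNReal.ofReal_lt_iff_lt_toReal (cdf_nonneg μ x) (by simp)]
      simpa using hx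
    refine ⟨x, fun y hy ↦ ?_⟩
    by_contra! hlt
    have h1 : (1 / 2 : ℝ≥0∞) ≤ μ (Set.Iic x) := le_trans hy (measure_mono (Set.Iic_subset_Iic.2 hlt.le))
    exact absurd h1 (not_le.2 hx)
  refine ⟨sInf S, ?_, ?_⟩
  · obtain ⟨u, hu, hlt, hlim⟩ := exists_seq_strictAnti_tendsto (sInf S)
    have e : Set.Iic (sInf S) = ⋂ n, Set.Iic (u n) := by
      ext x
      simp only [Set.mem_Iic, Set.mem_iInter]
      exact ⟨fun h n ↦ h.trans (hlt n).le, fun h ↦ ge_of_tendsto' hlim h⟩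
    rw [e, Antitone.measure_iInter (fun i j hij ↦ Set.Iic_subset_Iic.2 (hu.antitone hij))
      (fun _ ↦ measurableSet_Iic.nullMeasurableSet) ⟨0, measure_ne_top _ _⟩]
    refine le_iInf fun n ↦ ?_
    obtain ⟨y, hy, hyu⟩ := exists_lt_of_csInf_lt hne (hlt n)
    exact le_trans hy (measure_mono (Set.Iic_subset_Iic.2 hyu.le))
  · obtain ⟨u, hu, hlt, hlim⟩ := exists_seq_strictMono_tendsto (sInf S)
    have e : Set.Ici (sInf S) = ⋂ n, Set.Ioi (u n) := by
      ext x
      simp only [Set.mem_Ici, Set.mem_iInter, Set.mem_Ioi]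
      exact ⟨fun h n ↦ (hlt n).trans_le h, fun h ↦ le_of_tendsto' hlim fun n ↦ (h n).le⟩
    rw [e, Antitone.measure_iInter (fun i j hij ↦ Set.Ioi_subset_Ioi (hu.monotone hij))
      (fun _ ↦ measurableSet_Ioi.nullMeasurableSet) ⟨0, measure_ne_top _ _⟩]
    refine le_iInf fun n ↦ ?_
    have h1 : μ (Set.Iic (u n)) ≤ 1 / 2 := by
      by_contra! h
      exact absurd (csInf_le hbd h.le) (not_le.2 (hlt n))
    rw [← Set.compl_Iic, prob_compl_eq_one_sub measurableSet_Iic]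
    refine ENNReal.le_sub_of_add_le_right (by simp) ?_
    calc 1 / 2 + μ (Set.Iic (u n)) ≤ 1 / 2 + 1 / 2 := by gcongr
      _ = 1 := ENNReal.add_halves 1

/-- Exponential tails bound the first moment. -/
lemma lintegral_ofReal_le_of_exp_tail {Ω : Type*} [MeasurableSpace Ω] {P : Measure Ω} {Z : Ω → ℝ}
    (hZ : AEMeasurable Z P) (hZ0 : ∀ ω, 0 ≤ Z ω) {A b : ℝ} (hA : 0 ≤ A) (hb : 0 < b)
    (h : ∀ u : ℝ, 0 < u → P {ω | u < Z ω} ≤ ENNReal.ofReal (A * Real.exp (-(b * u)))) :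
    ∫⁻ ω, ENNReal.ofReal (Z ω) ∂P ≤ ENNReal.ofReal (A / b) := by
  rw [lintegral_eq_lintegral_meas_lt P (.of_forall hZ0) hZ]
  have hint : IntegrableOn (fun u ↦ A * Real.exp (-b * u)) (Set.Ioi 0) :=
    (integrableOn_exp_mul_Ioi (by linarith) 0).const_mul A
  calc ∫⁻ u in Set.Ioi 0, P {ω | u < Z ω}
      ≤ ∫⁻ u in Set.Ioi 0, ENNReal.ofReal (A * Real.exp (-b * u)) :=
        setLIntegral_mono' measurableSet_Ioi fun u hu ↦ (h u hu).trans_eq (by rw [neg_mul])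
    _ = ENNReal.ofReal (∫ u in Set.Ioi 0, A * Real.exp (-b * u)) :=
        (ofReal_integral_eq_lintegral_ofReal hint (.of_forall fun u ↦ by positivity)).symm
    _ ≤ _ := by
        refine ENNReal.ofReal_le_ofReal (le_of_eq ?_)
        rw [integral_const_mul, integral_exp_mul_Ioi (by linarith)]
        simp
        field_simp

/-- A bound on a probability with an arbitrary prefactor implies one with prefactor `2`, at the
cost of the constant in the exponent. -/
lemma le_two_mul_exp_of_le {p A z : ℝ} (hp1 : p ≤ 1) (hA : 2 ≤ A)
    (h : p ≤ A * Real.exp (-z)) : p ≤ 2 * Real.exp (-(Real.log 2 / Real.log A * z)) := by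
  have hl2 : 0 < Real.log 2 := Real.log_pos (by norm_num)
  have hlA : Real.log 2 ≤ Real.log A := Real.log_le_log (by norm_num) hA
  have hlA0 : 0 < Real.log A := hl2.trans_le hlA
  set θ := Real.log 2 / Real.log A with hθ
  have hθ1 : θ ≤ 1 := (div_le_one hlA0).2 hlA
  have hθ0 : 0 < θ := div_pos hl2 hlA0
  have hθA : θ * Real.log A = Real.log 2 := by rw [hθ]; field_simp
  have e2 : 2 * Real.exp (-(θ * z)) = Real.exp (θ * (Real.log A - z)) := by
    rw [mul_sub, hθA, sub_eq_add_neg, Real.exp_add, Real.exp_log (by norm_num)]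
  have eA : A * Real.exp (-z) = Real.exp (Real.log A - z) := by
    rw [sub_eq_add_neg, Real.exp_add, Real.exp_log (by linarith)]
  rw [e2]
  rcases le_or_gt (Real.log A - z) 0 with hz | hz
  · rw [eA] at h
    refine h.trans (Real.exp_le_exp.2 ?_)
    nlinarith
  · exact hp1.trans (Real.one_le_exp (by positivity))

/-- At deviations `T v = √T y` the tail function decays at least exponentially in `y`, uniformly in
`T ≥ 1`. -/
lemma sub_one_le_mul_min_rpow {H T y : ℝ} (hH : H < 1 / 2) (hH0 : 0 < H) (hT : 1 ≤ T)
    (hy : 0 < y) :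
    y - 1 ≤ T * min ((y / √T) ^ (1 + 2 * H)) ((y / √T) ^ (2 : ℝ)) := by
  have hT0 : 0 < T := by linarith
  have hs : 0 < √T := Real.sqrt_pos.2 hT0
  rcases le_or_gt y 1 with h1 | h1
  · have : 0 ≤ T * min ((y / √T) ^ (1 + 2 * H)) ((y / √T) ^ (2 : ℝ)) := by positivity
    linarith
  rw [mul_min_of_nonneg _ _ hT0.le, le_min_iff]
  constructor
  · have e : T * (y / √T) ^ (1 + 2 * H) = T ^ (1 / 2 - H) * y ^ (1 + 2 * H) := by
      rw [Real.div_rpow hy.le hs.le, Real.sqrt_eq_rpow, ← Real.rpow_mul hT0.le]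
      nth_rewrite 1 [← Real.rpow_one T]
      rw [mul_div_left_comm, ← Real.rpow_sub hT0, mul_comm]
      congr 2
      ring
    rw [e]
    have h2 : 1 ≤ T ^ (1 / 2 - H) := Real.one_le_rpow hT (by linarith)
    have h3 : y ≤ y ^ (1 + 2 * H) := by
      nth_rewrite 1 [← Real.rpow_one y]
      exact Real.rpow_le_rpow_of_exponent_le h1.le (by linarith)
    nlinarith
  · rw [Real.rpow_two, div_pow, Real.sq_sqrt hT0.le]
    have e : T * (y ^ 2 / T) = y ^ 2 := by field_simp
    rw [e]
    nlinarith

lemma min_rpow_le_min_rpow_div_four {H v : ℝ} (hH : H < 1 / 2) (hv : 0 < v) :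
    1 / 16 * min (v ^ (1 + 2 * H)) (v ^ (2 : ℝ)) ≤
      min ((v / 4) ^ (1 + 2 * H)) ((v / 4) ^ (2 : ℝ)) := by
  have h16 : (4 : ℝ) ^ (2 : ℝ) = 16 := by norm_num
  rw [mul_min_of_nonneg _ _ (by norm_num)]
  refine min_le_min ?_ ?_
  · rw [Real.div_rpow hv.le (by norm_num), one_div_mul_eq_div]
    gcongr
    rw [← h16]
    exact Real.rpow_le_rpow_of_exponent_le (by norm_num) (by linarith)
  · rw [Real.div_rpow hv.le (by norm_num), h16, one_div_mul_eq_div]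

/-- Concentration around the mean with sub-Gaussian scale `√T` and tail function
`exp (-β T min (v ^ (1 + 2 * H), v ^ 2))` follows from concentration around a median. -/
lemma exists_deviationProb_le_of_median {H β : ℝ} (hH0 : 0 < H) (hH : H < 1 / 2) (hβ : 0 < β) :
    ∃ B : ℝ, 0 < B ∧ ∀ (Ω : Type*) [MeasurableSpace Ω] (P : Measure Ω) [IsProbabilityMeasure P]
      (X : Ω → ℝ≥0∞), HasFiniteExpectation P X → ∀ (T m : ℝ), 1 ≤ T →
      (∀ v : ℝ, 0 < v → P {ω | 2 * (T * v) < |(X ω).toReal - m|} ≤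
        ENNReal.ofReal (8 * Real.exp (-(β * (T * min (v ^ (1 + 2 * H)) (v ^ (2 : ℝ))))))) →
      ∀ v : ℝ, 0 < v → deviationProb P X (T * v) ≤
        2 * Real.exp (-(B * (T * min (v ^ (1 + 2 * H)) (v ^ (2 : ℝ))))) := by
  set D : ℝ := 8 * Real.exp β / (β / 2) with hD
  have hD0 : 0 < D := by positivity
  set A : ℝ := 8 + Real.exp (β / 16 * (4 * D ^ 2)) with hA
  have hA2 : 2 ≤ A := by
    have := Real.exp_pos (β / 16 * (4 * D ^ 2))
    linarith
  refine ⟨Real.log 2 / Real.log A * (β / 16),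
    mul_pos (div_pos (Real.log_pos (by norm_num)) (Real.log_pos (by linarith))) (by positivity),
    fun Ω _ P _ X hX T m hT htail v hv ↦ ?_⟩
  have hT0 : 0 < T := by linarith
  have hs : 0 < √T := Real.sqrt_pos.2 hT0
  have hss : √T * √T = T := Real.mul_self_sqrt hT0.le
  have hXi : Integrable (fun ω ↦ (X ω).toReal) P := integrable_toReal_of_lintegral_ne_top hX.1 hX.2.ne
  have hmean : |(∫ ω, (X ω).toReal ∂P) - m| ≤ D * √T := by
    have h1 := lintegral_ofReal_le_of_exp_tail (P := P) (Z := fun ω ↦ |(X ω).toReal - m|)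
      (A := 8 * Real.exp β) (b := β / 2 / √T) (hXi.sub (integrable_const m)).aemeasurable.abs
      (fun ω ↦ abs_nonneg _) (by positivity) (by positivity) (fun u hu ↦ by
        have h2 := htail (u / 2 / √T / √T) (by positivity)
        have e : 2 * (T * (u / 2 / √T / √T)) = u := by
          rw [div_div, hss]; field_simp
        rw [e] at h2
        refine h2.trans (ENNReal.ofReal_le_ofReal ?_)
        rw [mul_assoc, ← Real.exp_add]
        gcongr
        have h3 := sub_one_le_mul_min_rpow hH hH0 hT (y := u / 2 / √T) (by positivity)
        have h4 := mul_le_mul_of_nonneg_left h3 hβ.le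
        have h5 : β * (u / 2 / √T - 1) = β / 2 / √T * u - β := by field_simp
        linarith)
    have hXm : Integrable (fun ω ↦ (X ω).toReal - m) P := hXi.sub (integrable_const m)
    rw [← ofReal_integral_eq_lintegral_ofReal hXm.abs (.of_forall fun ω ↦ abs_nonneg _),
      ENNReal.ofReal_le_ofReal_iff (by positivity)] at h1
    have h2 : (∫ ω, (X ω).toReal ∂P) - m = ∫ ω, ((X ω).toReal - m) ∂P := by
      rw [integral_sub hXi (integrable_const m)]
      simp
    rw [h2]
    refine (abs_integral_le_integral_abs).trans (h1.trans_eq ?_)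
    rw [hD]
    field_simp
  set w : ℝ := min (v ^ (1 + 2 * H)) (v ^ (2 : ℝ)) with hw
  rw [mul_assoc]
  refine le_two_mul_exp_of_le measureReal_le_one hA2 ?_
  rw [hA, add_mul]
  -- for `T v` below the distance `D √T` of mean and median the bound is trivial, by the choice of `A`
  rcases le_or_gt (2 * (D * √T)) (T * v) with hcase | hcase
  · have h1 : deviationProb P X (T * v) ≤ 8 * Real.exp (-(β / 16 * (T * w))) := by
      have hsub : {ω | T * v < |(X ω).toReal - ∫ ω', (X ω').toReal ∂P|} ⊆
          {ω | 2 * (T * (v / 4)) < |(X ω).toReal - m|} := by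
        intro ω hω
        have h2 := abs_sub_le (X ω).toReal m (∫ ω', (X ω').toReal ∂P)
        rw [abs_sub_comm m] at h2
        have h3 : T * v < |(X ω).toReal - ∫ ω', (X ω').toReal ∂P| := hω
        change 2 * (T * (v / 4)) < |(X ω).toReal - m|
        linarith
      have h4 := (measure_mono hsub).trans (htail (v / 4) (by positivity))
      refine (ENNReal.toReal_le_of_le_ofReal (by positivity) h4).trans ?_
      have h5 := mul_le_mul_of_nonneg_left (min_rpow_le_min_rpow_div_four hH hv)
        (mul_nonneg hβ.le hT0.le)
      rw [← hw] at h5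
      exact mul_le_mul_of_nonneg_left (Real.exp_le_exp.2 (by linarith)) (by norm_num)
    have h2 : 0 ≤ Real.exp (β / 16 * (4 * D ^ 2)) * Real.exp (-(β / 16 * (T * w))) := by positivity
    linarith
  · have h1 : T * w ≤ 4 * D ^ 2 := by
      have h2 : w ≤ v ^ 2 := by
        rw [hw, Real.rpow_two]
        exact min_le_right _ _
      have h3 : √T * v < 2 * D := by
        refine lt_of_mul_lt_mul_left ?_ hs.le
        rw [← mul_assoc, hss]
        linarith
      have h4 : (√T * v) ^ 2 ≤ (2 * D) ^ 2 := by gcongr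
      rw [mul_pow, sq √T, hss] at h4
      nlinarith
    have h2 : 1 ≤ Real.exp (β / 16 * (4 * D ^ 2)) * Real.exp (-(β / 16 * (T * w))) := by
      rw [← Real.exp_add]
      refine Real.one_le_exp ?_
      have := mul_le_mul_of_nonneg_left h1 (by positivity : 0 ≤ β / 16)
      linarith
    have h3 : 0 ≤ 8 * Real.exp (-(β / 16 * (T * w))) := by positivity
    have h4 : deviationProb P X (T * v) ≤ 1 := measureReal_le_one
    linarith

/-! ### Concentration at truncation level one -/

namespace IsFractionalBrownianMotion

variable {Ω : Type*} [MeasurableSpace Ω] {H : ℝ} {W : ℝ≥0 → Ω → ℝ} {P : Measure Ω}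

lemma aemeasurable_chainSup (hW : IsFractionalBrownianMotion H W P) {T : ℝ≥0} (hT : 0 < T)
    {φ : ℝ → ℝ} (hφ : Continuous φ) {K : Set IntervalChain}
    (hK : K = weakChains T ∨ K = strictChains T) :
    AEMeasurable (fun ω ↦ chainSup φ K (fun t ↦ W t ω)) P :=
  _root_.aemeasurable_chainSup (fun t ↦ hW.isGaussianProcess.aemeasurable t) hW.continuous hT hK hφ

end IsFractionalBrownianMotion

lemma chainSup_le_chainSup_abs_sub_half {φ : ℝ → ℝ} (hφ : IsTruncation 1 φ) {T : ℝ≥0}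
    {K : Set IntervalChain} (hK : K = weakChains T ∨ K = strictChains T) (f : ℝ≥0 → ℝ) :
    chainSup φ K f ≤ chainSup (fun x ↦ |x| - 1 / 2) (weakChains T) f := by
  have hK' : K ⊆ weakChains T := by
    rcases hK with rfl | rfl
    · exact subset_rfl
    · exact strictChains_subset_weakChains T
  refine (chainSup_mono hK' f).trans (chainSup_le_chainSup (fun x ↦ ?_) _ f)
  linarith [hφ.le_abs_sub x]

lemma ENNReal.le_four_mul_of_quarter_mul_le {p x q : ℝ≥0∞} (hp : 1 / 4 ≤ p) (h : p * x ≤ q) :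
    x ≤ 4 * q := by
  calc x = 4 * (1 / 4 * x) := by
        rw [← mul_assoc, ENNReal.mul_div_cancel (by simp) (by simp), one_mul]
    _ ≤ 4 * (p * x) := by gcongr
    _ ≤ 4 * q := by gcongr

/-- Concentration around a median `m`, from the estimate for two sublevel sets and a bound `C * T`
for the expectation of the control functional. -/
lemma IsFractionalBrownianMotion.exists_measure_deviation_median_le {Ω : Type*}
    [MeasurableSpace Ω] {H : ℝ} {W : ℝ≥0 → Ω → ℝ} {P : Measure Ω} [IsProbabilityMeasure P]
    (hW : IsFractionalBrownianMotion H W P) (hH0 : 0 < H) (hH : H < 1 / 2) {T : ℝ≥0} (hT : 0 < T)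
    {C : ℝ} (hC : 1 ≤ C)
    (hY : ∫⁻ ω, chainSup (fun x ↦ |x| - 1 / 2) (weakChains T) (fun t ↦ W t ω) ∂P ≤
      ENNReal.ofReal (C * T))
    {φ : ℝ → ℝ} (hφ : IsTruncation 1 φ) {K : Set IntervalChain}
    (hK : K = weakChains T ∨ K = strictChains T) :
    ∃ m : ℝ, ∀ v : ℝ, 0 < v →
      P {ω | 2 * (T * v) < |(chainSup φ K (fun t ↦ W t ω)).toReal - m|} ≤
        ENNReal.ofReal (8 * Real.exp (-(concentrationRadius H (4 * C) T v ^ 2 / 4))) := by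
  have hT' : (0 : ℝ) < T := hT
  set X : Ω → ℝ≥0∞ := fun ω ↦ chainSup φ K (fun t ↦ W t ω) with hX
  set Y : Ω → ℝ≥0∞ := fun ω ↦ chainSup (fun x ↦ |x| - 1 / 2) (weakChains T) (fun t ↦ W t ω) with hYd
  have hXY : ∀ ω, X ω ≤ Y ω := fun ω ↦ chainSup_le_chainSup_abs_sub_half hφ hK _
  have hXm : AEMeasurable X P := hW.aemeasurable_chainSup hT hφ.continuous hK
  have hYm : AEMeasurable Y P := hW.aemeasurable_chainSup hT (by fun_prop) (.inl rfl)
  have hXtop : P {ω | X ω = ∞} = 0 :=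
    measure_eq_top_of_lintegral_ne_top hXm
      (((lintegral_mono hXY).trans hY).trans_lt ENNReal.ofReal_lt_top).ne
  set M : ℝ≥0∞ := ENNReal.ofReal (4 * C * T) with hM
  have hYM : P {ω | M < Y ω} ≤ 1 / 4 := by
    have h1 := (mul_meas_ge_le_lintegral₀ hYm M).trans hY
    have h2 : M = ENNReal.ofReal (C * T) * 4 := by
      rw [hM, show (4 : ℝ≥0∞) = ENNReal.ofReal 4 by simp, ← ENNReal.ofReal_mul (by positivity)]
      congr 1
      ring
    rw [h2, mul_assoc] at h1
    have h3 : 4 * P {ω | M ≤ Y ω} ≤ 1 := by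
      rw [← h2] at h1
      refine (ENNReal.mul_le_mul_iff_right (a := ENNReal.ofReal (C * T)) ?_ ENNReal.ofReal_ne_top).1
        (by rwa [mul_one])
      exact (ENNReal.ofReal_pos.2 (by positivity)).ne'
    rw [ENNReal.le_div_iff_mul_le (by simp) (by simp), mul_comm]
    exact (mul_le_mul_right (measure_mono fun ω (h : M < Y ω) ↦ h.le) 4).trans h3
  -- the control functional is at most `M` up to probability `1 / 4`, less than that of a half line
  -- which is bounded by the median
  have hquarter : ∀ {s t : Set Ω}, 1 / 2 ≤ P s → s ⊆ (t ∪ {ω | X ω = ∞}) ∪ {ω | M < Y ω} →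
      1 / 4 ≤ P t := by
    intro s t hs hst
    have h1 : (1 / 2 : ℝ≥0∞) ≤ P t + 1 / 4 :=
      calc 1 / 2 ≤ P s := hs
        _ ≤ _ := measure_mono hst
        _ ≤ (P t + P {ω | X ω = ∞}) + P {ω | M < Y ω} :=
          (measure_union_le _ _).trans (by gcongr; exact measure_union_le _ _)
        _ ≤ P t + 1 / 4 := by rw [hXtop, add_zero]; gcongr
    have h2 : (1 / 2 : ℝ≥0∞) = 1 / 4 + 1 / 4 := by
      rw [ENNReal.div_add_div_same, show (1 + 1 : ℝ≥0∞) = 2 by norm_num,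
        ENNReal.div_eq_div_iff] <;> norm_num
    rw [h2] at h1
    exact ENNReal.le_of_add_le_add_right (by simp) h1
  have hXr : AEMeasurable (fun ω ↦ (X ω).toReal) P := hXm.ennreal_toReal
  have : IsProbabilityMeasure (P.map fun ω ↦ (X ω).toReal) := Measure.isProbabilityMeasure_map hXr
  obtain ⟨m, hm1, hm2⟩ := exists_median (P.map fun ω ↦ (X ω).toReal)
  rw [Measure.map_apply_of_aemeasurable hXr measurableSet_Iic] at hm1
  rw [Measure.map_apply_of_aemeasurable hXr measurableSet_Ici] at hm2
  have hm0 : 0 ≤ m := by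
    by_contra! h
    have : (fun ω ↦ (X ω).toReal) ⁻¹' Set.Iic m = ∅ := by
      ext ω
      simp only [Set.mem_preimage, Set.mem_Iic, Set.mem_empty_iff_false, iff_false, not_le]
      exact h.trans_le ENNReal.toReal_nonneg
    rw [this] at hm1
    simp at hm1
  refine ⟨m, fun v hv ↦ ?_⟩
  set q : ℝ≥0∞ := ENNReal.ofReal (Real.exp (-(concentrationRadius H (4 * C) T v ^ 2 / 4))) with hq
  have hTv : 0 < T * v := by positivity
  have hup : P {ω | ENNReal.ofReal (m + T * v) < X ω} ≤ 4 * q := by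
    have h1 := hW.measure_chainSup_mul_le hH0 hH hT (C := 4 * C) (by linarith) hv hφ hK hm0 le_rfl
      (b₁ := M) (b₂ := ∞) (min_le_left _ _)
    simp only [le_top, and_true] at h1
    refine ENNReal.le_four_mul_of_quarter_mul_le (hquarter hm1 ?_) h1
    intro ω hω
    by_cases hω1 : X ω = ∞
    · exact .inl (.inr hω1)
    by_cases hω2 : M < Y ω
    · exact .inr hω2
    exact .inl (.inl ⟨(ENNReal.le_ofReal_iff_toReal_le hω1 hm0).2 hω, not_lt.1 hω2⟩)
  -- here the control functional is bounded on the upper event, which is allowed as well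
  have hlow : P {ω | 0 ≤ m - 2 * (T * v) ∧ X ω ≤ ENNReal.ofReal (m - 2 * (T * v))} ≤ 4 * q := by
    rcases lt_or_ge (m - 2 * (T * v)) 0 with h0 | h0
    · simp [not_le.2 h0]
    have h1 := hW.measure_chainSup_mul_le hH0 hH hT (C := 4 * C) (by linarith) hv hφ hK h0
      (b := m - T * v) (by linarith) (b₁ := ∞) (b₂ := M) (min_le_right _ _)
    simp only [le_top, and_true] at h1
    rw [mul_comm] at h1
    simp only [h0, true_and]
    refine ENNReal.le_four_mul_of_quarter_mul_le (hquarter hm2 ?_) h1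
    intro ω hω
    by_cases hω1 : X ω = ∞
    · exact .inl (.inr hω1)
    by_cases hω2 : M < Y ω
    · exact .inr hω2
    refine .inl (.inl ⟨?_, not_lt.1 hω2⟩)
    have h2 : m ≤ (X ω).toReal := hω
    exact (ENNReal.ofReal_lt_iff_lt_toReal (by linarith) hω1).2 (by linarith)
  have hsub : {ω | 2 * (T * v) < |(X ω).toReal - m|} ⊆ ({ω | ENNReal.ofReal (m + T * v) < X ω} ∪
      {ω | 0 ≤ m - 2 * (T * v) ∧ X ω ≤ ENNReal.ofReal (m - 2 * (T * v))}) ∪ {ω | X ω = ∞} := by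
    intro ω hω
    by_cases hω1 : X ω = ∞
    · exact .inr hω1
    refine .inl ?_
    have hω' : 2 * (T * v) < |(X ω).toReal - m| := hω
    have hx0 : 0 ≤ (X ω).toReal := ENNReal.toReal_nonneg
    rcases lt_abs.1 hω' with h | h
    · exact .inl ((ENNReal.ofReal_lt_iff_lt_toReal (by positivity) hω1).2 (by linarith))
    · have h0 : 0 ≤ m - 2 * (T * v) := by linarith
      exact .inr ⟨h0, (ENNReal.le_ofReal_iff_toReal_le hω1 h0).2 (by linarith)⟩
  calc P {ω | 2 * (T * v) < |(X ω).toReal - m|}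
      ≤ (4 * q + 4 * q) + 0 := by
        refine (measure_mono hsub).trans ((measure_union_le _ _).trans ?_)
        rw [hXtop]
        gcongr
        exact (measure_union_le _ _).trans (add_le_add hup hlow)
    _ = ENNReal.ofReal 8 * q := by
        rw [add_zero, ← add_mul]
        norm_num
    _ = _ := by rw [hq, ← ENNReal.ofReal_mul (by norm_num)]

/-- The upper bound at truncation level `1`. -/
theorem exists_deviationProb_chainSup_le {H : ℝ} (hH0 : 0 < H) (hH : H < 1 / 2) :
    ∃ B : ℝ, 0 < B ∧ ∀ (Ω : Type*) [MeasurableSpace Ω] (P : Measure Ω) [IsProbabilityMeasure P]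
      (W : ℝ≥0 → Ω → ℝ), IsFractionalBrownianMotion H W P → ∀ T : ℝ≥0, 1 ≤ T →
      ∀ φ : ℝ → ℝ, IsTruncation 1 φ → ∀ K : Set IntervalChain,
      K = weakChains T ∨ K = strictChains T →
      HasFiniteExpectation P (fun ω ↦ chainSup φ K (fun t ↦ W t ω)) ∧
      ∀ v : ℝ, 0 < v → deviationProb P (fun ω ↦ chainSup φ K (fun t ↦ W t ω)) (T * v) ≤
        2 * Real.exp (-(B * (T * min (v ^ (1 + 2 * H)) (v ^ (2 : ℝ))))) := by
  obtain ⟨C, hC, hY⟩ := exists_lintegral_chainSup_le hH0 hH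
  obtain ⟨B, hB, h⟩ := exists_deviationProb_le_of_median (β := 1 / (256 * (4 * C) ^ 2)) hH0 hH
    (by positivity)
  refine ⟨B, hB, fun Ω _ P _ W hW T hT φ hφ K hK ↦ ?_⟩
  have hT0 : 0 < T := one_pos.trans_le hT
  have hT' : (1 : ℝ) ≤ T := hT
  have hfin : HasFiniteExpectation P (fun ω ↦ chainSup φ K (fun t ↦ W t ω)) :=
    ⟨hW.aemeasurable_chainSup hT0 hφ.continuous hK,
      ((lintegral_mono fun ω ↦ chainSup_le_chainSup_abs_sub_half hφ hK _).trans
        (hY Ω P W hW T hT0)).trans_lt ENNReal.ofReal_lt_top⟩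
  refine ⟨hfin, ?_⟩
  obtain ⟨m, hm⟩ := hW.exists_measure_deviation_median_le hH0 hH hT0 hC (hY Ω P W hW T hT0) hφ hK
  refine h Ω P _ hfin T m hT' fun v hv ↦ (hm v hv).trans_eq ?_
  congr 4
  rw [concentrationRadius, mul_pow, Real.sq_sqrt (by positivity)]
  field_simp
  norm_num

/-! ### Optimality of the exponent -/

lemma le_gaussianReal_Ioi {z : ℝ} (hz : 0 ≤ z) :
    ENNReal.ofReal (1 / 2 * Real.exp (-(z ^ 2 + 2))) ≤ gaussianReal 0 1 (Set.Ioi z) := by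
  have hconst : (1 / 2 : ℝ) * Real.exp (-1) ≤ (√(2 * Real.pi))⁻¹ := by
    have h1 : √(2 * Real.pi) ≤ 3 := by
      rw [Real.sqrt_le_left (by norm_num)]
      linarith [Real.pi_lt_four]
    have h2 : (2 : ℝ) ≤ Real.exp 1 := by linarith [Real.add_one_le_exp (1 : ℝ)]
    rw [Real.exp_neg]
    calc (1 / 2 : ℝ) * (Real.exp 1)⁻¹ ≤ 1 / 2 * 2⁻¹ := by gcongr
      _ ≤ 3⁻¹ := by norm_num
      _ ≤ _ := by gcongr
  calc ENNReal.ofReal (1 / 2 * Real.exp (-(z ^ 2 + 2)))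
      = ∫⁻ _ in Set.Ioc z (z + 1), ENNReal.ofReal (1 / 2 * Real.exp (-(z ^ 2 + 2))) := by
        simp
    _ ≤ ∫⁻ x in Set.Ioc z (z + 1), gaussianPDF 0 1 x := by
        refine setLIntegral_mono' measurableSet_Ioc fun x hx ↦ ENNReal.ofReal_le_ofReal ?_
        rw [gaussianPDFReal, NNReal.coe_one, mul_one, mul_one, sub_zero]
        have e : Real.exp (-(z ^ 2 + 2)) = Real.exp (-1) * Real.exp (-(z ^ 2 + 1)) := by
          rw [← Real.exp_add]
          congr 1
          ring
        rw [e, ← mul_assoc]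
        refine mul_le_mul hconst (Real.exp_le_exp.2 ?_) (by positivity) (by positivity)
        nlinarith [hx.1, hx.2, sq_nonneg (z - 1)]
    _ ≤ ∫⁻ x in Set.Ioi z, gaussianPDF 0 1 x := lintegral_mono_set Set.Ioc_subset_Ioi_self
    _ = _ := (gaussianReal_apply 0 one_ne_zero _).symm

namespace IsFractionalBrownianMotion

variable {Ω : Type*} [MeasurableSpace Ω] {H : ℝ} {W : ℝ≥0 → Ω → ℝ} {P : Measure Ω}

lemma map_sum_increments (hW : IsFractionalBrownianMotion H W P) {n : ℕ} (s t : Fin n → ℝ≥0)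
    (a : Fin n → ℝ) :
    P.map (fun ω ↦ ∑ i, a i * (W (t i) ω - W (s i) ω)) =
      gaussianReal 0 Var[fun ω ↦ ∑ i, a i * (W (t i) ω - W (s i) ω); P].toNNReal := by
  have hY : IsGaussianProcess (fun (i : Fin n) ω ↦ a i * (W (t i) ω - W (s i) ω)) P := by
    classical
    exact hW.isGaussianProcess.of_isGaussianProcess fun i ↦ ⟨{s i, t i},
      { toFun x := a i * (x ⟨t i, by simp⟩ - x ⟨s i, by simp⟩)
        map_add' x y := by simp; ring
        map_smul' c x := by simp; ring },
      by simp⟩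
  have hi : ∀ i, Integrable (fun ω ↦ a i * (W (t i) ω - W (s i) ω)) P := fun i ↦
    ((hW.integrable _).sub (hW.integrable _)).const_mul _
  rw [(hY.hasGaussianLaw_fun_sum (I := Finset.univ)).map_eq_gaussianReal,
    integral_finsetSum _ fun i _ ↦ hi i]
  congr 1
  refine Finset.sum_eq_zero fun i _ ↦ ?_
  rw [integral_const_mul, integral_sub (hW.integrable _) (hW.integrable _), hW.centered,
    hW.centered, sub_zero, mul_zero]

lemma le_measure_lt_sum_increments (hW : IsFractionalBrownianMotion H W P) {n : ℕ}
    (s t : Fin n → ℝ≥0) (a : Fin n → ℝ) {V y : ℝ} (hV : 0 < V)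
    (hVar : V ≤ Var[fun ω ↦ ∑ i, a i * (W (t i) ω - W (s i) ω); P]) (hy : 0 ≤ y) :
    ENNReal.ofReal (1 / 2 * Real.exp (-(y ^ 2 / V + 2))) ≤
      P {ω | y < ∑ i, a i * (W (t i) ω - W (s i) ω)} := by
  have hmap := hW.map_sum_increments s t a
  set L : Ω → ℝ := fun ω ↦ ∑ i, a i * (W (t i) ω - W (s i) ω) with hL
  have hLm : AEMeasurable L P := Finset.aemeasurable_fun_sum _ fun i _ ↦
    ((hW.integrable _).aemeasurable.sub (hW.integrable _).aemeasurable).const_mul _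
  set σ : ℝ := √(Var[L; P]) with hσ
  have hVar0 : 0 < Var[L; P] := hV.trans_le hVar
  have hσ0 : 0 < σ := Real.sqrt_pos.2 hVar0
  have hscale : gaussianReal 0 Var[L; P].toNNReal =
      (gaussianReal 0 1).map fun x ↦ σ * x := by
    rw [gaussianReal_map_const_mul, mul_zero, mul_one]
    congr 1
    ext
    rw [Real.coe_toNNReal _ hVar0.le, NNReal.coe_mk, Real.sq_sqrt hVar0.le]
  have e : P {ω | y < L ω} = gaussianReal 0 1 (Set.Ioi (y / σ)) := by
    have h1 : P {ω | y < L ω} = P.map L (Set.Ioi y) :=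
      (Measure.map_apply_of_aemeasurable hLm measurableSet_Ioi).symm
    rw [h1, hmap, hscale, Measure.map_apply (by fun_prop) measurableSet_Ioi]
    congr 1
    ext x
    simp only [Set.mem_preimage, Set.mem_Ioi]
    rw [div_lt_iff₀' hσ0]
  rw [e]
  refine le_trans (ENNReal.ofReal_le_ofReal ?_) (le_gaussianReal_Ioi (by positivity))
  have h2 : (y / σ) ^ 2 ≤ y ^ 2 / V := by
    rw [div_pow, Real.sq_sqrt hVar0.le]
    gcongr
  gcongr

end IsFractionalBrownianMotion

/-- `n` intervals of length `δ` which are separated by gaps of length `δ`. -/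
def equidistantChain (δ : ℝ≥0) (n : ℕ) : IntervalChain :=
  ⟨n, fun i ↦ (2 * (i : ℕ)) * δ, fun i ↦ (2 * (i : ℕ) + 1) * δ⟩

lemma equidistantChain_mem_strictChains {δ T : ℝ≥0} (hδ : 0 < δ) {n : ℕ} (hn : 1 ≤ n)
    (hT : 2 * n * δ = T) : equidistantChain δ n ∈ strictChains T := by
  refine ⟨hn, fun i ↦ ⟨zero_le, ?_, ?_⟩, fun i j hij ↦ ?_⟩
  · change 2 * ((i : ℕ) : ℝ≥0) * δ < (2 * ((i : ℕ) : ℝ≥0) + 1) * δ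
    gcongr
    exact lt_add_one _
  · change (2 * ((i : ℕ) : ℝ≥0) + 1) * δ ≤ T
    rw [← hT]
    gcongr
    have h : 2 * (i : ℕ) + 1 ≤ 2 * n := by have := i.2; change (i : ℕ) < n at this; omega
    exact_mod_cast h
  · change (2 * ((i : ℕ) : ℝ≥0) + 1) * δ < 2 * ((j : ℕ) : ℝ≥0) * δ
    gcongr
    have h : 2 * (i : ℕ) + 1 < 2 * j := by have : (i : ℕ) < j := hij; omega
    exact_mod_cast h

lemma IsFractionalBrownianMotion.le_variance_equidistantChain {Ω : Type*} [MeasurableSpace Ω]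
    {H : ℝ} {W : ℝ≥0 → Ω → ℝ} {P : Measure Ω} (hW : IsFractionalBrownianMotion H W P)
    (hH0 : 0 < H) (hH : H < 1 / 2) {ε : ℝ} (hε : ε * ε = 1) (δ : ℝ≥0) (n : ℕ) :
    n * ((2 - 2 ^ (2 * H)) * (δ : ℝ) ^ (2 * H)) ≤
      Var[fun ω ↦ ∑ i, ε * (W ((equidistantChain δ n).2.2 i) ω -
        W ((equidistantChain δ n).2.1 i) ω); P] := by
  have hvar := hW.variance_sum_increments (equidistantChain δ n).2.1 (equidistantChain δ n).2.2
    fun _ ↦ ε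
  refine le_of_le_of_eq ?_ hvar.symm
  simp only [hε, one_mul]
  refine le_sum_sum_fbmIncrementCov hH0 hH δ.2 (fun i ↦ ⟨NNReal.coe_nonneg _, ?_⟩)
    fun i j hij ↦ ?_
  · change (((2 * ((i : ℕ) : ℝ≥0) + 1) * δ : ℝ≥0) : ℝ) = ((2 * ((i : ℕ) : ℝ≥0) * δ : ℝ≥0) : ℝ) + δ
    push_cast
    ring
  · change (((2 * ((i : ℕ) : ℝ≥0) + 1) * δ : ℝ≥0) : ℝ) + δ ≤ ((2 * ((j : ℕ) : ℝ≥0) * δ : ℝ≥0) : ℝ)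
    have h : ((i : ℕ) : ℝ) + 1 ≤ ((j : ℕ) : ℝ) := by exact_mod_cast hij
    have h1 := mul_le_mul_of_nonneg_right h δ.2
    push_cast
    change (2 * ((i : ℕ) : ℝ) + 1) * δ + δ ≤ 2 * ((j : ℕ) : ℝ) * δ
    change (((i : ℕ) : ℝ) + 1) * δ ≤ ((j : ℕ) : ℝ) * δ at h1
    linarith

/-- The lower bound at truncation level `1`. A deviation `T * v` occurs as soon as the sum of about `T * v` increments over equidistant
intervals exceeds a multiple of `T * v`. -/
theorem exists_le_deviationProb_chainSup {H : ℝ} (hH0 : 0 < H) (hH : H < 1 / 2) :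
    ∃ B : ℝ, 0 < B ∧ ∀ (Ω : Type*) [MeasurableSpace Ω] (P : Measure Ω) [IsProbabilityMeasure P]
      (W : ℝ≥0 → Ω → ℝ), IsFractionalBrownianMotion H W P → ∀ T : ℝ≥0, 1 ≤ T →
      ∀ φ : ℝ → ℝ, IsTruncation 1 φ → ∀ ε : ℝ, ε * ε = 1 → (∀ x, ε * x - 1 ≤ φ x) →
      ∀ K : Set IntervalChain, K = weakChains T ∨ K = strictChains T →
      ∀ v : ℝ, 1 ≤ v → 1 / 2 * Real.exp (-(B * (T * v ^ (1 + 2 * H)))) ≤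
        deviationProb P (fun ω ↦ chainSup φ K (fun t ↦ W t ω)) (T * v) := by
  obtain ⟨C, hC, hY⟩ := exists_lintegral_chainSup_le hH0 hH
  set ϑ : ℝ := 2 - 2 ^ (2 * H) with hϑ
  have hϑ0 : 0 < ϑ := by
    have : (2 : ℝ) ^ (2 * H) < 2 ^ (1 : ℝ) :=
      Real.rpow_lt_rpow_of_exponent_lt (by norm_num) (by linarith)
    rw [Real.rpow_one] at this
    linarith
  refine ⟨4 * (C + 3) ^ 2 / ϑ + 2, by positivity, fun Ω _ P _ W hW T hT φ hφ ε hε hφε K hK v hv ↦ ?_⟩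
  have hT0 : 0 < T := one_pos.trans_le hT
  have hT1 : (1 : ℝ) ≤ T := hT
  have hv0 : 0 < v := by linarith
  have hTv1 : 1 ≤ T * v := by nlinarith
  set N : ℕ := ⌈(T : ℝ) * v⌉₊ with hN
  have hN1 : (T : ℝ) * v ≤ N := Nat.le_ceil _
  have hN2 : (N : ℝ) ≤ 2 * (T * v) := by
    have := (Nat.ceil_lt_add_one (by linarith : 0 ≤ (T : ℝ) * v)).le
    linarith
  have hNpos : 1 ≤ N := Nat.one_le_cast.1 (hTv1.trans hN1)
  have hN0 : (0 : ℝ) < N := by linarith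
  set δ : ℝ≥0 := T / (2 * N) with hδ
  have hδ0 : 0 < δ := by
    have : (0 : ℝ≥0) < N := by exact_mod_cast hNpos
    positivity
  have hδT : 2 * N * δ = T := by
    have : (N : ℝ≥0) ≠ 0 := by exact_mod_cast (by omega : N ≠ 0)
    rw [hδ]
    field_simp
  set κ := equidistantChain δ N with hκ
  have hκK : κ ∈ K := by
    have h := equidistantChain_mem_strictChains hδ0 hNpos hδT
    rcases hK with rfl | rfl
    · exact strictChains_subset_weakChains T h
    · exact h
  have hVar : ϑ / 4 * (T * v * v ^ (-(2 * H))) ≤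
      Var[fun ω ↦ ∑ i, ε * (W (κ.2.2 i) ω - W (κ.2.1 i) ω); P] := by
    refine le_trans ?_ (hW.le_variance_equidistantChain hH0 hH hε δ N)
    have hδv : v⁻¹ / 4 ≤ (δ : ℝ) := by
      rw [hδ]
      push_cast
      rw [div_le_div_iff₀ (by norm_num) (by positivity)]
      calc v⁻¹ * (2 * (N : ℝ)) ≤ v⁻¹ * (2 * (2 * (T * v))) := by gcongr
        _ = T * 4 := by field_simp; norm_num
    have h1 : v ^ (-(2 * H)) / 4 ≤ (δ : ℝ) ^ (2 * H) :=
      calc v ^ (-(2 * H)) / 4 ≤ v ^ (-(2 * H)) / 4 ^ (2 * H) := by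
            gcongr
            nth_rewrite 2 [← Real.rpow_one 4]
            exact Real.rpow_le_rpow_of_exponent_le (by norm_num) (by linarith)
        _ = (v⁻¹ / 4) ^ (2 * H) := by
            rw [Real.div_rpow (by positivity) (by norm_num), Real.rpow_neg hv0.le,
              Real.inv_rpow hv0.le]
        _ ≤ _ := by gcongr
    calc ϑ / 4 * (T * v * v ^ (-(2 * H))) = T * v * (ϑ * (v ^ (-(2 * H)) / 4)) := by ring
      _ ≤ N * (ϑ * (δ : ℝ) ^ (2 * H)) := by gcongr
  set X : Ω → ℝ≥0∞ := fun ω ↦ chainSup φ K (fun t ↦ W t ω) with hX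
  have hXY : ∀ ω, X ω ≤ chainSup (fun x ↦ |x| - 1 / 2) (weakChains T) (fun t ↦ W t ω) :=
    fun ω ↦ chainSup_le_chainSup_abs_sub_half hφ hK _
  have hXE : ∫⁻ ω, X ω ∂P ≤ ENNReal.ofReal (C * T) := (lintegral_mono hXY).trans (hY Ω P W hW T hT0)
  have hXm : AEMeasurable X P := hW.aemeasurable_chainSup hT0 hφ.continuous hK
  have hXtop : ∀ᵐ ω ∂P, X ω < ∞ := ae_lt_top' hXm (hXE.trans_lt ENNReal.ofReal_lt_top).ne
  have hE : ∫ ω, (X ω).toReal ∂P ≤ C * T := by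
    rw [integral_toReal hXm hXtop]
    exact ENNReal.toReal_le_of_le_ofReal (by positivity) hXE
  have hpath : ∀ᵐ ω ∂P, (C + 3) * (T * v) < ∑ i, ε * (W (κ.2.2 i) ω - W (κ.2.1 i) ω) →
      T * v < |(X ω).toReal - ∫ ω', (X ω').toReal ∂P| := by
    filter_upwards [hXtop] with ω hω hL
    have h1 : chainSum φ (fun t ↦ W t ω) κ ≤ (X ω).toReal :=
      (ENNReal.ofReal_le_iff_le_toReal hω.ne).1 (le_chainSup hκK)
    have h2 : ∑ i, ε * (W (κ.2.2 i) ω - W (κ.2.1 i) ω) - N ≤ chainSum φ (fun t ↦ W t ω) κ := by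
      have h3 : ∑ i : Fin κ.1, (ε * (W (κ.2.2 i) ω - W (κ.2.1 i) ω) - 1) =
          ∑ i, ε * (W (κ.2.2 i) ω - W (κ.2.1 i) ω) - N := by
        rw [Finset.sum_sub_distrib]
        simp [hκ, equidistantChain]
      rw [← h3]
      exact Finset.sum_le_sum fun i _ ↦ (hφε _).trans (le_max_left _ _)
    refine lt_of_lt_of_le ?_ (le_abs_self _)
    have h4 : C * T ≤ C * (T * v) := by nlinarith [mul_pos (one_pos.trans_le hC) (one_pos.trans_le hT1)]
    linarith
  have hlow := hW.le_measure_lt_sum_increments κ.2.1 κ.2.2 (fun _ ↦ ε)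
    (y := (C + 3) * (T * v)) (by positivity) hVar (by positivity)
  have h1 := hlow.trans (measure_mono_ae hpath)
  have h2 : 1 / 2 * Real.exp (-(((C + 3) * (T * v)) ^ 2 / (ϑ / 4 * (T * v * v ^ (-(2 * H)))) + 2)) ≤
      deviationProb P X (T * v) := (ENNReal.ofReal_le_iff_le_toReal (measure_ne_top _ _)).1 h1
  refine le_trans ?_ h2
  have h3 : ((C + 3) * (T * v)) ^ 2 / (ϑ / 4 * (T * v * v ^ (-(2 * H)))) =
      4 * (C + 3) ^ 2 / ϑ * (T * v ^ (1 + 2 * H)) := by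
    rw [Real.rpow_neg hv0.le, Real.rpow_add hv0, Real.rpow_one]
    field_simp
  rw [h3]
  have h4 : 1 ≤ T * v ^ (1 + 2 * H) := by
    have := Real.one_le_rpow hv (by linarith : 0 ≤ 1 + 2 * H)
    nlinarith
  refine mul_le_mul_of_nonneg_left (Real.exp_le_exp.2 ?_) (by norm_num)
  linarith

/-! ### Self-similarity -/

lemma IsFractionalBrownianMotion.rescale {Ω : Type*} [MeasurableSpace Ω] {H : ℝ}
    {W : ℝ≥0 → Ω → ℝ} {P : Measure Ω} (hW : IsFractionalBrownianMotion H W P) {δ : ℝ≥0} {c : ℝ}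
    (hc : c ≠ 0) (hδ : (δ : ℝ) ^ (2 * H) = c ^ 2) :
    IsFractionalBrownianMotion H (fun t ω ↦ c⁻¹ * W (δ * t) ω) P where
  isGaussianProcess := (hW.isGaussianProcess.comp_right fun t ↦ δ * t).smul fun _ ↦ c⁻¹
  centered t := by rw [integral_const_mul, hW.centered, mul_zero]
  covariance s t := by
    have e : ∀ ω, c⁻¹ * W (δ * s) ω * (c⁻¹ * W (δ * t) ω) =
        (c ^ 2)⁻¹ * (W (δ * s) ω * W (δ * t) ω) := fun ω ↦ by
      field_simp
    simp only [e]
    rw [integral_const_mul, hW.covariance]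
    push_cast
    rw [← mul_sub, abs_mul, abs_of_nonneg δ.coe_nonneg, Real.mul_rpow δ.coe_nonneg s.coe_nonneg,
      Real.mul_rpow δ.coe_nonneg t.coe_nonneg, Real.mul_rpow δ.coe_nonneg (abs_nonneg _), hδ]
    field_simp
  continuous := by
    filter_upwards [hW.continuous] with ω hω
    exact (hω.comp (by fun_prop : Continuous fun t : ℝ≥0 ↦ δ * t)).const_mul c⁻¹

/-- The chain obtained by the change of time `x ↦ δ * x`. -/
def IntervalChain.scale (δ : ℝ≥0) (κ : IntervalChain) : IntervalChain :=
  ⟨κ.1, fun i ↦ δ * κ.2.1 i, fun i ↦ δ * κ.2.2 i⟩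

lemma IntervalChain.scale_scale (δ ε : ℝ≥0) (κ : IntervalChain) :
    (κ.scale ε).scale δ = κ.scale (δ * ε) := by
  simp [IntervalChain.scale, mul_assoc]

lemma IntervalChain.scale_one (κ : IntervalChain) : κ.scale 1 = κ := by
  simp [IntervalChain.scale]

lemma scale_mem_weakChains {δ T : ℝ≥0} (hδ : 0 < δ) {κ : IntervalChain} (hκ : κ ∈ weakChains T) :
    κ.scale δ ∈ weakChains (δ * T) := by
  obtain ⟨n, s, t⟩ := κ
  obtain ⟨hn, h1, h2⟩ := hκ
  exact ⟨hn, fun i ↦ ⟨zero_le, mul_lt_mul_of_pos_left (h1 i).2.1 hδ,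
    mul_le_mul_of_nonneg_left (h1 i).2.2 zero_le⟩,
    fun i j hij ↦ mul_le_mul_of_nonneg_left (h2 i j hij) zero_le⟩

lemma scale_mem_strictChains {δ T : ℝ≥0} (hδ : 0 < δ) {κ : IntervalChain}
    (hκ : κ ∈ strictChains T) : κ.scale δ ∈ strictChains (δ * T) := by
  obtain ⟨n, s, t⟩ := κ
  obtain ⟨hn, h1, h2⟩ := hκ
  exact ⟨hn, fun i ↦ ⟨zero_le, mul_lt_mul_of_pos_left (h1 i).2.1 hδ,
    mul_le_mul_of_nonneg_left (h1 i).2.2 zero_le⟩,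
    fun i j hij ↦ mul_lt_mul_of_pos_left (h2 i j hij) hδ⟩

lemma image_scale_eq {K : ℝ≥0 → Set IntervalChain} (hK : K = weakChains ∨ K = strictChains)
    {δ : ℝ≥0} (hδ : 0 < δ) (T : ℝ≥0) : IntervalChain.scale δ '' K T = K (δ * T) := by
  have hmem : ∀ {ε U : ℝ≥0}, 0 < ε → ∀ {κ : IntervalChain}, κ ∈ K U → κ.scale ε ∈ K (ε * U) := by
    rcases hK with rfl | rfl
    · exact scale_mem_weakChains
    · exact scale_mem_strictChains
  refine Set.Subset.antisymm (Set.image_subset_iff.2 fun κ hκ ↦ hmem hδ hκ) fun κ hκ ↦ ?_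
  refine ⟨κ.scale δ⁻¹, ?_, ?_⟩
  · have h := hmem (inv_pos.2 hδ) hκ
    rwa [inv_mul_cancel_left₀ hδ.ne'] at h
  · rw [IntervalChain.scale_scale, mul_inv_cancel₀ hδ.ne', IntervalChain.scale_one]

lemma chainSup_image_scale {φ : ℝ → ℝ} {c : ℝ} (hc : 0 < c) (δ : ℝ≥0) (K : Set IntervalChain)
    (f : ℝ≥0 → ℝ) :
    chainSup (fun x ↦ c * φ (c⁻¹ * x)) (IntervalChain.scale δ '' K) f =
      ENNReal.ofReal c * chainSup φ K (fun t ↦ c⁻¹ * f (δ * t)) := by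
  rw [chainSup, chainSup, iSup_image]
  simp only [ENNReal.mul_iSup]
  refine iSup_congr fun κ ↦ iSup_congr fun _ ↦ ?_
  rw [← ENNReal.ofReal_mul hc.le, chainSum, chainSum, Finset.mul_sum]
  congr 1
  refine Finset.sum_congr rfl fun i _ ↦ ?_
  rw [mul_max_of_nonneg _ _ hc.le, mul_zero, ← mul_sub]
  rfl

lemma HasFiniteExpectation.const_mul {Ω : Type*} [MeasurableSpace Ω] {P : Measure Ω}
    {X : Ω → ℝ≥0∞} (hX : HasFiniteExpectation P X) (c : ℝ) :
    HasFiniteExpectation P (fun ω ↦ ENNReal.ofReal c * X ω) := by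
  refine ⟨hX.1.const_mul _, ?_⟩
  rw [lintegral_const_mul' _ _ ENNReal.ofReal_ne_top]
  exact ENNReal.mul_lt_top ENNReal.ofReal_lt_top hX.2

lemma deviationProb_const_mul {Ω : Type*} [MeasurableSpace Ω] (P : Measure Ω) (X : Ω → ℝ≥0∞)
    {c : ℝ} (hc : 0 < c) (u : ℝ) :
    deviationProb P (fun ω ↦ ENNReal.ofReal c * X ω) (c * u) = deviationProb P X u := by
  simp only [deviationProb, ENNReal.toReal_mul, ENNReal.toReal_ofReal hc.le, integral_const_mul,
    ← mul_sub, abs_mul, abs_of_pos hc, mul_lt_mul_iff_right₀ hc]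

lemma mul_rpow_mul_min_rpow {H M v : ℝ} (hH : H < 1 / 2) (hM : 0 < M) (hv : 0 < v) :
    (M * v) ^ (1 + 2 * H) * min M (M * v) ^ (1 - 2 * H) =
      M ^ 2 * min (v ^ (1 + 2 * H)) (v ^ (2 : ℝ)) := by
  have hexp : ∀ x : ℝ, 0 < x → x ^ (1 + 2 * H) * x ^ (1 - 2 * H) = x ^ 2 := fun x hx ↦ by
    rw [← Real.rpow_add hx, ← Real.rpow_two]
    congr 1
    ring
  rcases le_total v 1 with h | h
  · rw [min_eq_right (by nlinarith), hexp _ (by positivity), mul_pow,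
      min_eq_right (Real.rpow_le_rpow_of_exponent_ge hv h (by linarith)), Real.rpow_two]
  · rw [min_eq_left (by nlinarith),
      min_eq_left (Real.rpow_le_rpow_of_exponent_le h (by linarith)),
      Real.mul_rpow hM.le hv.le, mul_right_comm, hexp _ hM]

/-- The two-sided estimates for any of the functionals, at an arbitrary truncation level `c`. -/
theorem exists_bounds_deviationProb {H : ℝ} (hH0 : 0 < H) (hH : H < 1 / 2) :
    ∃ B D : ℝ, 0 < B ∧ 0 < D ∧ ∀ (Ω : Type*) [MeasurableSpace Ω] (P : Measure Ω)
      [IsProbabilityMeasure P] (W : ℝ≥0 → Ω → ℝ), IsFractionalBrownianMotion H W P →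
      ∀ (S : ℝ≥0) (c : ℝ), 0 < S → 0 < c → c ≤ (S : ℝ) ^ H →
      ∀ φ : ℝ → ℝ, IsTruncation 1 φ → ∀ ε : ℝ, ε * ε = 1 → (∀ x, ε * x - 1 ≤ φ x) →
      ∀ K : ℝ≥0 → Set IntervalChain, K = weakChains ∨ K = strictChains →
      ∀ X : Ω → ℝ≥0∞, X = (fun ω ↦ chainSup (fun x ↦ c * φ (c⁻¹ * x)) (K S) (fun t ↦ W t ω)) →
      HasFiniteExpectation P X ∧
      (∀ u : ℝ, 0 < u → deviationProb P X u ≤ 2 * Real.exp (-(B * (S : ℝ)⁻¹ * c ^ (1 / H - 2) *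
        u ^ (1 + 2 * H) * min ((S : ℝ) * c ^ (1 - 1 / H)) u ^ (1 - 2 * H)))) ∧
      (∀ v : ℝ, 0 < v → deviationProb P X ((S : ℝ) * c ^ (1 - 1 / H) * v) ≤
        2 * Real.exp (-(B * (S : ℝ) * c ^ (-1 / H) * min (v ^ (1 + 2 * H)) (v ^ (2 : ℝ))))) ∧
      ∀ v : ℝ, 1 ≤ v → 1 / 2 * Real.exp (-(D * (S : ℝ) * c ^ (-1 / H) * v ^ (1 + 2 * H))) ≤
        deviationProb P X ((S : ℝ) * c ^ (1 - 1 / H) * v) := by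
  obtain ⟨B, hB, hupper⟩ := exists_deviationProb_chainSup_le hH0 hH
  obtain ⟨D, hD, hlower⟩ := exists_le_deviationProb_chainSup hH0 hH
  refine ⟨B, D, hB, hD, fun Ω _ P _ W hW S c hS hc hcS φ hφ ε hε hφε K hK X hX ↦ ?_⟩
  have hS' : (0 : ℝ) < S := hS
  have hδ' : 0 < c ^ (1 / H) := by positivity
  set δ : ℝ≥0 := (c ^ (1 / H)).toNNReal with hδ
  have hδc : (δ : ℝ) = c ^ (1 / H) := Real.coe_toNNReal _ hδ'.le
  have hδ0 : 0 < δ := Real.toNNReal_pos.2 hδ'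
  set T : ℝ≥0 := S / δ with hT
  have hST : S = δ * T := by
    rw [hT, mul_div_cancel₀ _ hδ0.ne']
  have hTS : (T : ℝ) = S * c ^ (-1 / H) := by
    rw [hT, NNReal.coe_div, hδc, neg_div, Real.rpow_neg hc.le]
    rfl
  have hT1 : 1 ≤ T := by
    rw [hT, one_le_div hδ0, ← NNReal.coe_le_coe, hδc]
    calc c ^ (1 / H) ≤ ((S : ℝ) ^ H) ^ (1 / H) := by gcongr
      _ = S := by rw [← Real.rpow_mul hS'.le, mul_one_div_cancel hH0.ne', Real.rpow_one]
  have hδ2 : (δ : ℝ) ^ (2 * H) = c ^ 2 := by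
    rw [hδc, ← Real.rpow_mul hc.le, ← Real.rpow_two]
    congr 1
    field_simp
  have hW' := hW.rescale hc.ne' hδ2
  have hKT : K T = weakChains T ∨ K T = strictChains T := by
    rcases hK with rfl | rfl
    · exact .inl rfl
    · exact .inr rfl
  have hXscale : X = fun ω ↦ ENNReal.ofReal c * chainSup φ (K T) (fun t ↦ c⁻¹ * W (δ * t) ω) := by
    rw [hX]
    ext ω
    rw [← chainSup_image_scale hc δ (K T) fun t ↦ W t ω, image_scale_eq hK hδ0, ← hST]
  have hscale : ∀ v : ℝ, (S : ℝ) * c ^ (1 - 1 / H) * v = c * (T * v) := fun v ↦ by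
    rw [hTS, sub_eq_add_neg, Real.rpow_add hc, Real.rpow_one, neg_div]
    ring
  obtain ⟨hfin, hup⟩ := hupper Ω P _ hW' T hT1 φ hφ (K T) hKT
  have hlow := hlower Ω P _ hW' T hT1 φ hφ ε hε hφε (K T) hKT
  have hupv : ∀ v : ℝ, 0 < v → deviationProb P X ((S : ℝ) * c ^ (1 - 1 / H) * v) ≤
      2 * Real.exp (-(B * (S : ℝ) * c ^ (-1 / H) * min (v ^ (1 + 2 * H)) (v ^ (2 : ℝ)))) := by
    intro v hv
    rw [hscale, hXscale, deviationProb_const_mul P _ hc]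
    refine (hup v hv).trans_eq ?_
    rw [hTS]
    ring_nf
  refine ⟨hXscale ▸ hfin.const_mul c, fun u hu ↦ ?_, hupv, fun v hv ↦ ?_⟩
  · set M : ℝ := (S : ℝ) * c ^ (1 - 1 / H) with hM
    have hM0 : 0 < M := by positivity
    have hu' : u = M * (u / M) := by field_simp
    have hv : 0 < u / M := by positivity
    generalize u / M = v at hu' hv
    rw [hu']
    refine (hupv v hv).trans_eq ?_
    rw [mul_assoc _ _ (min M (M * v) ^ (1 - 2 * H)), mul_rpow_mul_min_rpow hH hM0 hv]
    have h1 : c ^ (1 / H - 2) * (c ^ (1 - 1 / H)) ^ 2 = c ^ (-1 / H) := by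
      rw [← Real.rpow_two, ← Real.rpow_mul hc.le, ← Real.rpow_add hc]
      congr 1
      field_simp
      ring
    have h2 : (S : ℝ)⁻¹ * c ^ (1 / H - 2) * M ^ 2 = S * c ^ (-1 / H) := by
      rw [← h1, hM]
      field_simp
    rw [mul_assoc B, ← h2]
    ring_nf
  · rw [hscale, hXscale, deviationProb_const_mul P _ hc]
    refine le_trans (le_of_eq ?_) (hlow v hv)
    rw [hTS]
    ring_nf

theorem theorem1 (H : ℝ) (hH0 : 0 < H) (hH : H < 1 / 2) :
    ∃ Abar Bbar Ahat Bhat T : ℝ,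
      0 < Abar ∧ Abar ≤ 36 ∧ 0 < Bbar ∧ 0 < Ahat ∧ Ahat ≤ 18 ∧ 0 < Bhat ∧ 0 < T ∧
      ∀ (Ω : Type*) [MeasurableSpace Ω] (P : Measure Ω) [IsProbabilityMeasure P]
        (W : ℝ≥0 → Ω → ℝ), IsFractionalBrownianMotion H W P →
      ∀ (S : ℝ≥0) (c : ℝ), 0 < S → 0 < c → c ≤ (S : ℝ) ^ H →
      ∀ TV UTV DTV : Ω → ℝ≥0∞,
        (TV = fun ω ↦ truncatedVariation (fun t ↦ W t ω) 0 S c) →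
        (UTV = fun ω ↦ upwardTruncatedVariation (fun t ↦ W t ω) 0 S c) →
        (DTV = fun ω ↦ downwardTruncatedVariation (fun t ↦ W t ω) 0 S c) →
        -- the three functionals are random variables with finite expectation
        (HasFiniteExpectation P TV ∧ HasFiniteExpectation P UTV ∧ HasFiniteExpectation P DTV) ∧
        -- upper bounds, for deviations of size `u`
        (∀ u : ℝ, 0 < u →
          deviationProb P TV u ≤ Abar * Real.exp (-(Bbar * (S : ℝ)⁻¹ * c ^ (1 / H - 2) *
            u ^ (1 + 2 * H) * min ((S : ℝ) * c ^ (1 - 1 / H)) u ^ (1 - 2 * H))) ∧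
          deviationProb P UTV u ≤ Ahat * Real.exp (-(Bhat * (S : ℝ)⁻¹ * c ^ (1 / H - 2) *
            u ^ (1 + 2 * H) * min ((S : ℝ) * c ^ (1 - 1 / H)) u ^ (1 - 2 * H))) ∧
          deviationProb P DTV u ≤ Ahat * Real.exp (-(Bhat * (S : ℝ)⁻¹ * c ^ (1 / H - 2) *
            u ^ (1 + 2 * H) * min ((S : ℝ) * c ^ (1 - 1 / H)) u ^ (1 - 2 * H)))) ∧
        -- upper bounds, for deviations of size `S * c ^ (1 - 1 / H) * v`
        (∀ v : ℝ, 0 < v →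
          deviationProb P TV ((S : ℝ) * c ^ (1 - 1 / H) * v) ≤
            Abar * Real.exp (-(Bbar * (S : ℝ) * c ^ (-1 / H) *
              min (v ^ (1 + 2 * H)) (v ^ (2 : ℝ)))) ∧
          deviationProb P UTV ((S : ℝ) * c ^ (1 - 1 / H) * v) ≤
            Ahat * Real.exp (-(Bhat * (S : ℝ) * c ^ (-1 / H) *
              min (v ^ (1 + 2 * H)) (v ^ (2 : ℝ)))) ∧
          deviationProb P DTV ((S : ℝ) * c ^ (1 - 1 / H) * v) ≤
            Ahat * Real.exp (-(Bhat * (S : ℝ) * c ^ (-1 / H) *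
              min (v ^ (1 + 2 * H)) (v ^ (2 : ℝ))))) ∧
        -- optimality for large `v`
        (∀ v : ℝ, 1 ≤ v →
          1 / 2 * Real.exp (-(T * (S : ℝ) * c ^ (-1 / H) * v ^ (1 + 2 * H))) ≤
            deviationProb P TV ((S : ℝ) * c ^ (1 - 1 / H) * v) ∧
          1 / 2 * Real.exp (-(T * (S : ℝ) * c ^ (-1 / H) * v ^ (1 + 2 * H))) ≤
            deviationProb P UTV ((S : ℝ) * c ^ (1 - 1 / H) * v) ∧
          1 / 2 * Real.exp (-(T * (S : ℝ) * c ^ (-1 / H) * v ^ (1 + 2 * H))) ≤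
            deviationProb P DTV ((S : ℝ) * c ^ (1 - 1 / H) * v)) := by
  obtain ⟨B, D, hB, hD, h⟩ := exists_bounds_deviationProb hH0 hH
  refine ⟨2, B, 2, B, D, two_pos, by norm_num, hB, two_pos, by norm_num, hB, hD,
    fun Ω _ P _ W hW S c hS hc hcS TV UTV DTV hTV hUTV hDTV ↦ ?_⟩
  have h1 := h Ω P W hW S c hS hc hcS
  obtain ⟨f₁, u₁, v₁, l₁⟩ := h1 _ (isTruncation_abs 1) 1 (one_mul 1)
    (fun x ↦ by linarith [le_abs_self x]) weakChains (.inl rfl) TV <| by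
      rw [hTV]
      ext ω
      rw [truncatedVariation_eq_chainSup]
      congr 1
      ext x
      rw [abs_mul, abs_of_pos (inv_pos.2 hc)]
      field_simp
  obtain ⟨f₂, u₂, v₂, l₂⟩ := h1 _ (isTruncation_id 1) 1 (one_mul 1)
    (fun x ↦ by rw [one_mul]) strictChains (.inr rfl) UTV <| by
      rw [hUTV]
      ext ω
      rw [upwardTruncatedVariation_eq_chainSup]
      congr 1
      ext x
      field_simp
  obtain ⟨f₃, u₃, v₃, l₃⟩ := h1 _ (isTruncation_neg 1) (-1) (by norm_num)
    (fun x ↦ by rw [neg_one_mul]) strictChains (.inr rfl) DTV <| by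
      rw [hDTV]
      ext ω
      rw [downwardTruncatedVariation_eq_chainSup]
      congr 1
      ext x
      field_simp
  exact ⟨⟨f₁, f₂, f₃⟩, fun u hu ↦ ⟨u₁ u hu, u₂ u hu, u₃ u hu⟩,
    fun v hv ↦ ⟨v₁ v hv, v₂ v hv, v₃ v hv⟩, fun v hv ↦ ⟨l₁ v hv, l₂ v hv, l₃ v hv⟩⟩
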